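/- We work over $\mathbb C$. For a positive integer $r$ and integers $a_1,\dots,a_5$, let $\frac1r(a_1,\dots,a_5)$ denote the cyclic quotient singularity $(X\ni x)$, where $X=\mathbb C^5/\mu_r$ is the quotient by the action $\xi\cdot(x_1,\dots,x_5)=(\xi^{a_1}x_1,\dots,\xi^{a_5}x_5)$ of the group $\mu_r$ of $r$-th roots of unity, and $x$ is the image of the origin. Let $\mathrm{mld}(X\ni x)$ denote its minimal log discrepancy, that is, the infimum of the log discrepancies $a(E,X)$ over all prime divisors $E$ over $X$ with center $x$. Let $\epsilon\in(0,\frac16)$ be a real number. Then there exists a finite set $\Gamma_0$ of positive integers, depending only on $\epsilon$, with the following property. Let $r$ be a positive integer and $a_1,\dots,a_5$ integers, and let $(X\ni x)=\frac1r(a_1,a_2,a_3,a_4,a_5)$. Suppose that 1. $\gcd(a_1,r)=\gcd(a_2,r)=\gcd(a_3,r)=1$ and $\gcd(a_4,r)=\gcd(a_5,r)$; 2. $\gcd\left(\sum_{i=1}^5a_i,\,r\right)=1$; 3. $\mathrm{mld}(X\ni x)\in[\frac{11}6+\epsilon,2)$; 4. one of the following holds: (a) $a_1+a_2+a_5\equiv0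 \pmod r$; (b) $2a_4+a_5\equiv0 \pmod r$; (c) $2a_1+a_5\equiv0 \pmod r$ and $\gcd(a_4,r)=\gcd(a_5,r)\le2$. Then $r\in\Gamma_0$. -/

import Mathlib

open scoped KaehlerDifferential

noncomputable section

namespace CyclicQuotient

section Birational

/-! Throughout this section `X = Spec A` is a normal affine complex variety of dimension `n` with
function field `F`; a point of `X` is given by its prime ideal. -/

variable (A : Type*) [CommRing A] (F : Type*) [Field F] [Algebra A F]

/-- A prime divisor over `X = Spec A`, given by its discrete valuation ring in the function
field `F`: the local ring `B_P` of a normal affine variety `Spec B`, of finite type and birational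
over `X`, at the generic point `P` of a prime divisor of `Spec B`. -/
structure PrimeDivisorOver where
  ring : ValuationSubring F
  isDVR : IsDiscreteValuationRing ring
  exists_model : ∃ (B : Subalgebra A F) (P : Ideal B), B.FG ∧ IsIntegrallyClosed B ∧
    P.IsPrime ∧ P.height = 1 ∧
    ∀ f : F, f ∈ ring ↔ ∃ b s : B, s ∉ P ∧ f = (b : F) / (s : F)

namespace PrimeDivisorOver

variable {A F}

instance (E : PrimeDivisorOver A F) : IsDiscreteValuationRing E.ring := E.isDVR

theorem algebraMap_mem (E : PrimeDivisorOver A F) (a : A) :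
    algebraMap A F a ∈ E.ring.toSubring := by
  obtain ⟨B, P, -, -, hP, -, h⟩ := E.exists_model
  exact (h _).2 ⟨algebraMap A B a, 1, fun h1 => hP.ne_top ((Ideal.eq_top_iff_one P).2 h1), by simp⟩

/-- The center of `E` on `X`, as a prime ideal of `A`. -/
def center (E : PrimeDivisorOver A F) : Ideal A :=
  (IsLocalRing.maximalIdeal E.ring).comap
    ((algebraMap A F).codRestrict E.ring.toSubring E.algebraMap_mem : A →+* E.ring)

/-- The order of a nonzero rational function along `E`. -/
def ord (E : PrimeDivisorOver A F) (f : F) : ℤ :=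
  -WithZero.log ((IsDiscreteValuationRing.maximalIdeal E.ring).valuation F f)

variable [Algebra ℂ F]

/-- The rational `n`-forms that are regular at the generic point of `E`: the image of
`⋀ⁿ Ω_{R/ℂ}` in `⋀ⁿ Ω_{F/ℂ}`, where `R` is the valuation ring of `E`. -/
def regularForms (n : ℕ) (E : PrimeDivisorOver A F) :
    Submodule E.ring.toSubring (⋀[F]^n Ω[F⁄ℂ]) :=
  Submodule.span E.ring.toSubring
    {η | ∃ g : Fin n → E.ring, η = exteriorPower.ιMulti F n fun i => KaehlerDifferential.D ℂ F (g i)}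

/-- The order along `E` of the nonzero rational `n`-form `ω` is `k`, that is, the coefficient of
`E` in the canonical divisor of `ω` is `k`. -/
def FormHasOrd {n : ℕ} (E : PrimeDivisorOver A F) (ω : ⋀[F]^n Ω[F⁄ℂ]) (k : ℤ) : Prop :=
  ∃ (η : ⋀[F]^n Ω[F⁄ℂ]) (f : F), f ≠ 0 ∧ E.regularForms n = Submodule.span E.ring.toSubring {η} ∧
    ω = f • η ∧ E.ord f = k

/-- `q` is the log discrepancy `a(E, X)` of `E` with respect to the `n`-dimensional singularity
`x ∈ X`. Here `K_X` is the divisor of a rational `n`-form `ω`, and `m K_X` is the divisor of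
`g⁻¹` near `x`, so that the log discrepancy is one plus the coefficient of `E` in the
divisor of `ω` minus its coefficient in the pullback of `K_X`. -/
def IsLogDiscrepancy (n : ℕ) (x : Ideal A) (E : PrimeDivisorOver A F) (q : ℚ) : Prop :=
  ∃ (ω : ⋀[F]^n Ω[F⁄ℂ]) (m : ℕ) (g : F), ω ≠ 0 ∧ 0 < m ∧ g ≠ 0 ∧
    (∀ D : PrimeDivisorOver A F, D.center.height = 1 → D.center ≤ x →
      ∃ k : ℤ, D.FormHasOrd ω k ∧ m * k + D.ord g = 0) ∧
    ∃ k : ℤ, E.FormHasOrd ω k ∧ q = 1 + k + (E.ord g : ℚ) / m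

end PrimeDivisorOver

end Birational

/-- The minimal log discrepancy `mld(X ∋ x)` of an `n`-dimensional normal affine variety
`X = Spec A`: the infimum of the log discrepancies of all prime divisors over `X` with
center `x`. -/
def mld (A : Type*) [CommRing A] [IsDomain A] [Algebra ℂ A] (n : ℕ) (x : Ideal A) : EReal :=
  sInf {a | ∃ (E : PrimeDivisorOver A (FractionRing A)) (q : ℚ),
    E.center = x ∧ E.IsLogDiscrepancy n x q ∧ a = ((q : ℝ) : EReal)}

/-- The automorphism `x_i ↦ ξ^{a_i} x_i` of `ℂ[x_1, …, x_d]`, with `ξ = exp (2πi/r)`. -/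
def muAction {d : ℕ} (r : ℕ) (a : Fin d → ℤ) :
    MvPolynomial (Fin d) ℂ →ₐ[ℂ] MvPolynomial (Fin d) ℂ :=
  MvPolynomial.aeval fun i =>
    MvPolynomial.C (Complex.exp (2 * Real.pi * Complex.I / r) ^ a i) * MvPolynomial.X i

/-- The coordinate ring `ℂ[x_1, …, x_d]^{μ_r}` of the cyclic quotient `(1/r)(a_1, …, a_d)`. -/
def coordRing {d : ℕ} (r : ℕ) (a : Fin d → ℤ) : Subalgebra ℂ (MvPolynomial (Fin d) ℂ) :=
  AlgHom.equalizer (muAction r a) (AlgHom.id ℂ _)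

/-- The maximal ideal of the image of the origin in the cyclic quotient. -/
def originIdeal {d : ℕ} (r : ℕ) (a : Fin d → ℤ) : Ideal (coordRing r a) :=
  RingHom.ker (MvPolynomial.constantCoeff.comp (coordRing r a).val.toRingHom)

/-- The minimal log discrepancy of the cyclic quotient singularity `(1/r)(a_1, …, a_d)`, that is,
of `ℂ^d / μ_r` at the image of the origin. -/
def cyclicMld {d : ℕ} (r : ℕ) (a : Fin d → ℤ) : EReal :=
  mld (coordRing r a) d (originIdeal r a)

end CyclicQuotient

end

/-! The minimal log discrepancy is first made combinatorial. A positive vector v congruent to k a /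
r modulo the integers defines a toric divisor over the origin of log discrepancy at most the sum of
its coordinates (`exists_isLogDiscrepancy_le`). Conversely, the orders of the x_i along any divisor
over the origin form such a vector, and its sum is at most the log discrepancy because a logarithmic
form has at most simple poles (`FormHasOrd.sum_ord_le`, `exists_sum_le_of_isLogDiscrepancy`). With
the gcd conditions, the bounds on the mld say: every k with no k a_i / r integral has ∑ {k a_i / r}
≥ 11/6 + ε, and some such k has sum less than 2.

Suppose that r is unbounded (`exists_bound`). Along an ultrafilter, the data (r_j, a_j) have a limit
lattice L of relations m with r_j ∣ m·a_j. By a uniform Kronecker theorem (`exists_forall_close`),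
the points h with m·h integral for all m in L are approximated by multiples of a_j / r_j, so these
points, which form a group K, inherit the lower bound. Since ∑ a_i is prime to r_j and r_j tends to
infinity, (1, …, 1) is not torsion modulo L. Hence some direction v orthogonal to L has s = ∑ v_i >
0, and K is stable under translation along v.

On a line x = h + t v of K consider G = ∑ {x_i} - {∑ x_i}, an integer-valued periodic step function
of t. The symmetry x ↦ -x confines ∑ {x_i} to (11/6, 19/6), so G = 2 whenever ∑ x_i lies in [1/6,
5/6] modulo 1. The function G never jumps down (`two_le_sum`). Where ∑ x_i is integral, {∑ x_i}
drops by 1, and ∑ {x_i} drops by an integer smaller than 4/3. Where ∑ x_i is not integral, multiply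
x by an integer u prime to all denominators so that the coordinate sum moves into [1/6, 5/6] modulo
1 (`exists_unit_mul_mid`). There both one-sided values of G are 2, and u does not change which
coordinates are integral, so it does not change the jump, which is therefore 0. A monotone periodic
function is constant, so G = 2 and every sum of fractional parts on the line is at least 2. But the
multiple of a_j / r_j with sum less than 2 lies in K for almost all j, a contradiction.

The constant 11/6 = 2 - 1/6 matches the worst denominator 6, whose only units are ±1. -/

open scoped KaehlerDifferential
noncomputable section
namespace CyclicQuotient

/-! ### Orders of functions along a prime divisor -/

namespace PrimeDivisorOver

section Order

variable {A : Type*} [CommRing A] {F : Type*} [Field F] [Algebra A F]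

theorem valuation_ne_zero (E : PrimeDivisorOver A F) {f : F} (hf : f ≠ 0) :
    (IsDiscreteValuationRing.maximalIdeal E.ring).valuation F f ≠ 0 :=
  (Valuation.ne_zero_iff _).2 hf

theorem ord_mul (E : PrimeDivisorOver A F) {f g : F} (hf : f ≠ 0) (hg : g ≠ 0) :
    E.ord (f * g) = E.ord f + E.ord g := by
  simp only [ord, map_mul, WithZero.log_mul (E.valuation_ne_zero hf) (E.valuation_ne_zero hg)]
  ring

theorem ord_one (E : PrimeDivisorOver A F) : E.ord 1 = 0 := by
  simp [ord]

theorem ord_inv (E : PrimeDivisorOver A F) (f : F) : E.ord f⁻¹ = -E.ord f := by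
  simp [ord, WithZero.log_inv]

theorem ord_pow (E : PrimeDivisorOver A F) (f : F) (n : ℕ) : E.ord (f ^ n) = n * E.ord f := by
  simp [ord, WithZero.log_pow]

theorem ord_zpow (E : PrimeDivisorOver A F) (f : F) (n : ℤ) : E.ord (f ^ n) = n * E.ord f := by
  simp [ord, WithZero.log_zpow]

theorem ord_prod (E : PrimeDivisorOver A F) {ι : Type*} (s : Finset ι) (f : ι → F)
    (hf : ∀ i ∈ s, f i ≠ 0) : E.ord (∏ i ∈ s, f i) = ∑ i ∈ s, E.ord (f i) := by
  classical
  induction s using Finset.induction_on with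
  | empty => simp [ord_one]
  | insert i s hi ih =>
    rw [Finset.prod_insert hi, Finset.sum_insert hi, E.ord_mul (hf i (by simp))
      (Finset.prod_ne_zero_iff.2 fun j hj => hf j (by simp [hj])),
      ih fun j hj => hf j (by simp [hj])]

theorem ord_nonneg_of_mem (E : PrimeDivisorOver A F) {f : F} (hf : f ∈ E.ring) : 0 ≤ E.ord f := by
  rcases eq_or_ne f 0 with rfl | h0
  · simp [ord]
  have h := (IsDiscreteValuationRing.maximalIdeal E.ring).valuation_le_one (K := F) ⟨f, hf⟩
  have : WithZero.log ((IsDiscreteValuationRing.maximalIdeal E.ring).valuation F f) ≤ 0 :=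
    (WithZero.log_le_iff_le_exp (E.valuation_ne_zero h0)).2 (by simpa using h)
  simpa [ord] using this

theorem ord_pos_iff (E : PrimeDivisorOver A F) {f : F} (hf : f ∈ E.ring) (h0 : f ≠ 0) :
    0 < E.ord f ↔ (⟨f, hf⟩ : E.ring) ∈ IsLocalRing.maximalIdeal E.ring := by
  have h := (IsDiscreteValuationRing.maximalIdeal E.ring).valuation_lt_one_iff_mem (K := F) ⟨f, hf⟩
  have h2 := WithZero.log_lt_iff_lt_exp (a := (0 : ℤ)) (E.valuation_ne_zero h0)
  have h3 : 0 < E.ord f ↔ WithZero.log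
      ((IsDiscreteValuationRing.maximalIdeal E.ring).valuation F f) < 0 := by simp [ord]
  rw [h3, h2, WithZero.exp_zero]
  exact h

theorem mem_of_ord_nonneg (E : PrimeDivisorOver A F) {f : F} (h : 0 ≤ E.ord f) : f ∈ E.ring := by
  rcases eq_or_ne f 0 with rfl | h0
  · exact zero_mem _
  rcases E.ring.mem_or_inv_mem f with hf | hf
  · exact hf
  · have h1 : E.ord f⁻¹ = 0 := le_antisymm (by rw [ord_inv]; omega) (E.ord_nonneg_of_mem hf)
    have h2 : IsUnit (⟨f⁻¹, hf⟩ : E.ring) := by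
      by_contra hu
      have := (E.ord_pos_iff hf (inv_ne_zero h0)).2 ((IsLocalRing.mem_maximalIdeal _).2 hu)
      omega
    obtain ⟨u, hu⟩ := h2
    have h3 : ((↑u⁻¹ : E.ring) : F) * f⁻¹ = 1 := by
      have := congrArg (Subtype.val) (Units.inv_mul u)
      rw [hu] at this
      simpa using this
    rw [mul_inv_eq_one₀ h0] at h3
    exact h3 ▸ (↑u⁻¹ : E.ring).2

theorem mem_center_iff (E : PrimeDivisorOver A F) (a : A) :
    a ∈ E.center ↔
      (⟨algebraMap A F a, E.algebraMap_mem a⟩ : E.ring) ∈ IsLocalRing.maximalIdeal E.ring :=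
  Iff.rfl

theorem center_isPrime (E : PrimeDivisorOver A F) : E.center.IsPrime :=
  Ideal.comap_isPrime _ _

theorem ord_algebraMap_pos_iff [FaithfulSMul A F] (E : PrimeDivisorOver A F) {a : A} (ha : a ≠ 0) :
    0 < E.ord (algebraMap A F a) ↔ a ∈ E.center := by
  rw [mem_center_iff, ord_pos_iff _ (E.algebraMap_mem a)]
  simpa using ha

theorem ord_algebraMap_nonneg (E : PrimeDivisorOver A F) (a : A) :
    0 ≤ E.ord (algebraMap A F a) :=
  E.ord_nonneg_of_mem (E.algebraMap_mem a)

theorem ord_algebraMap_eq_zero [FaithfulSMul A F] (E : PrimeDivisorOver A F) {a : A}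
    (ha : a ∉ E.center) : E.ord (algebraMap A F a) = 0 := by
  rcases eq_or_ne a 0 with rfl | h0
  · simp [ord]
  have := E.ord_algebraMap_nonneg a
  have := (E.ord_algebraMap_pos_iff h0).not.2 ha
  omega

theorem exists_uniformizer (E : PrimeDivisorOver A F) : ∃ t : F, t ≠ 0 ∧ E.ord t = 1 := by
  obtain ⟨t, ht⟩ := (IsDiscreteValuationRing.maximalIdeal E.ring).valuation_exists_uniformizer F
  refine ⟨t, ?_, ?_⟩
  · rintro rfl
    rw [map_zero] at ht
    exact WithZero.exp_ne_zero ht.symm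
  · simp [ord, ht]

theorem ord_eq_one_of_maximalIdeal_eq_span (E : PrimeDivisorOver A F) {f : F} (hf : f ∈ E.ring)
    (h0 : f ≠ 0) (h : IsLocalRing.maximalIdeal E.ring = Ideal.span {⟨f, hf⟩}) : E.ord f = 1 := by
  have h1 := (IsDiscreteValuationRing.maximalIdeal E.ring).intValuation_singleton
    (r := ⟨f, hf⟩) (by simpa [Subtype.ext_iff] using h0) h
  have h2 := (IsDiscreteValuationRing.maximalIdeal E.ring).valuation_of_algebraMap (K := F) ⟨f, hf⟩
  rw [h1] at h2
  change -WithZero.log ((IsDiscreteValuationRing.maximalIdeal E.ring).valuation F f) = 1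
  change (IsDiscreteValuationRing.maximalIdeal E.ring).valuation F f = _ at h2
  rw [h2]; simp

end Order

/-! ### Prime divisors from normal models, and extension across codimension two -/

section Model

variable {A : Type*} [CommRing A] {F : Type*} [Field F] [Algebra A F]

/-- The local ring of a normal noetherian model at a prime of height one is the valuation ring of a
prime divisor. -/
theorem exists_of_height_eq_one (B : Subalgebra A F) (hB : B.FG) [IsNoetherianRing B]
    [IsIntegrallyClosed B] [IsFractionRing B F] (P : Ideal B) [hP : P.IsPrime]
    (h1 : P.height = 1) : ∃ E : PrimeDivisorOver A F,
      ∀ f : F, f ∈ E.ring ↔ ∃ b s : B, s ∉ P ∧ f = (b : F) / (s : F) := by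
  have hmem : ∀ f : F, f ∈ (Localization.subalgebra.ofField F P.primeCompl
      P.primeCompl_le_nonZeroDivisors) ↔ ∃ b s : B, s ∉ P ∧ f = (b : F) / (s : F) := by
    intro f
    constructor
    · rintro ⟨b, s, hs, rfl⟩
      exact ⟨b, s, hs, by rw [div_eq_mul_inv]; rfl⟩
    · rintro ⟨b, s, hs, rfl⟩
      exact ⟨b, s, hs, by rw [div_eq_mul_inv]; rfl⟩
  let S := Localization.subalgebra.ofField F P.primeCompl P.primeCompl_le_nonZeroDivisors
  have : IsLocalization.AtPrime S P :=
    Localization.subalgebra.isLocalization_ofField F P.primeCompl P.primeCompl_le_nonZeroDivisors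
  have : IsLocalRing S := IsLocalization.AtPrime.isLocalRing S P
  have : IsNoetherianRing S := IsLocalization.isNoetherianRing P.primeCompl S inferInstance
  have : IsIntegrallyClosed S :=
    isIntegrallyClosed_of_isLocalization S P.primeCompl P.primeCompl_le_nonZeroDivisors
  have : IsFractionRing S F :=
    Localization.subalgebra.isFractionRing_ofField F P.primeCompl P.primeCompl_le_nonZeroDivisors
  -- Height one leaves the maximal ideal as the only nonzero prime. With normality this is the
  -- condition in the characterization of discrete valuation rings among noetherian local domains.
  have hdim : ∀ Q : Ideal S, Q ≠ ⊥ → Q.IsPrime → Q = IsLocalRing.maximalIdeal S := by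
    intro Q hQ hQ'
    have hm : (IsLocalRing.maximalIdeal S).height = 1 := by
      rw [← h1, ← IsLocalization.AtPrime.under_maximalIdeal S P,
        IsLocalization.height_under P.primeCompl]
    by_contra hne
    have hlt : Q < IsLocalRing.maximalIdeal S :=
      lt_of_le_of_ne (IsLocalRing.le_maximalIdeal hQ'.ne_top) hne
    have h2 := Ideal.height_strict_mono_of_isPrime hlt
    have h3 : Q.height ≠ 0 := by rwa [Ne, Ideal.height_eq_zero_iff_eq_bot]
    rw [hm] at h2
    exact h3 (Order.lt_one_iff.1 h2)
  have hval : ValuationRing S :=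
    ((tfae_of_isNoetherianRing_of_isLocalRing_of_isDomain (R := S)).out 3 1 rfl rfl).1
      (And.intro inferInstance hdim)
  have hpid : IsPrincipalIdealRing S :=
    ((tfae_of_isNoetherianRing_of_isLocalRing_of_isDomain (R := S)).out 3 0 rfl rfl).1
      (And.intro inferInstance hdim)
  let R : ValuationSubring F := ValuationSubring.ofSubring S.toSubring fun x => by
    rcases (ValuationRing.isInteger_or_isInteger S x) with ⟨y, hy⟩ | ⟨y, hy⟩
    · exact Or.inl (hy ▸ y.2)
    · exact Or.inr (hy ▸ y.2)
  have hne : ¬ IsField S := by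
    intro hf
    have hk := IsLocalization.AtPrime.ringKrullDim_eq_height P S
    rw [h1, ringKrullDim_eq_zero_of_isField hf] at hk
    exact absurd hk (by norm_cast)
  have hdvr : IsDiscreteValuationRing S :=
    { not_a_field' := fun h => hne (IsLocalRing.isField_iff_maximalIdeal_eq.2 h) }
  refine ⟨⟨R, (hdvr : IsDiscreteValuationRing S), B, P, hB, inferInstance, hP, h1, hmem⟩, hmem⟩

/-- A prime ideal of height one of a normal noetherian domain is the center of the prime divisor
given by its localization. -/
theorem exists_of_prime_height_eq_one [IsDomain A] [IsNoetherianRing A]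
    [IsIntegrallyClosed A] [IsFractionRing A F] (p : Ideal A) [hP : p.IsPrime]
    (h1 : p.height = 1) : ∃ D : PrimeDivisorOver A F,
      (∀ f : F, f ∈ D.ring ↔
        ∃ b s : A, s ∉ p ∧ f = algebraMap A F b / algebraMap A F s) ∧ D.center = p := by
  -- The model is X itself, seen as the bottom subalgebra of its function field.
  let e : A ≃+* (⊥ : Subalgebra A F) :=
    (Algebra.botEquivOfInjective (IsFractionRing.injective A F)).symm.toRingEquiv
  have he : ∀ a, ((e a : (⊥ : Subalgebra A F)) : F) = algebraMap A F a := fun a => by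
    have := (Algebra.botEquivOfInjective (IsFractionRing.injective A F)).symm.commutes a
    exact congrArg Subtype.val this
  have : IsNoetherianRing (⊥ : Subalgebra A F) := isNoetherianRing_of_ringEquiv A e
  have : IsIntegrallyClosed (⊥ : Subalgebra A F) := IsIntegrallyClosed.of_equiv e
  have : IsFractionRing (⊥ : Subalgebra A F) F := by
    refine IsFractionRing.of_field _ _ fun z => ?_
    obtain ⟨x, y, -, rfl⟩ := IsFractionRing.div_surjective A z
    exact ⟨e x, e y, by rw [← he x, ← he y]; rfl⟩
  have hpr : (p.map e).IsPrime := Ideal.map_isPrime_of_equiv e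
  obtain ⟨D, hD⟩ := exists_of_height_eq_one (⊥ : Subalgebra A F) Subalgebra.fg_bot (p.map e)
    (by rw [RingEquiv.height_map]; exact h1)
  have hmem : ∀ s : A, e s ∈ p.map e ↔ s ∈ p := fun s => by
    rw [Ideal.mem_map_of_equiv]
    exact ⟨fun ⟨x, hx, h⟩ => e.injective h ▸ hx, fun h => ⟨s, h, rfl⟩⟩
  have hD2 : ∀ f : F, f ∈ D.ring ↔
      ∃ b s : A, s ∉ p ∧ f = algebraMap A F b / algebraMap A F s := by
    intro f
    rw [hD]
    constructor
    · rintro ⟨b, s, hs, rfl⟩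
      refine ⟨e.symm b, e.symm s, ?_, by rw [← he, ← he]; simp⟩
      rwa [← hmem, e.apply_symm_apply]
    · rintro ⟨b, s, hs, rfl⟩
      exact ⟨e b, e s, by rwa [hmem], by rw [he, he]⟩
  refine ⟨D, hD2, ?_⟩
  ext a
  rw [mem_center_iff, IsLocalRing.mem_maximalIdeal, mem_nonunits_iff, not_iff_comm]
  constructor
  · intro ha
    have ha0 : algebraMap A F a ≠ 0 := by
      rw [Ne, IsFractionRing.to_map_eq_zero_iff]; rintro rfl; exact ha (zero_mem _)
    refine IsUnit.of_mul_eq_one ⟨(algebraMap A F a)⁻¹, (hD2 _).2 ⟨1, a, ha, by simp⟩⟩ ?_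
    exact Subtype.ext (mul_inv_cancel₀ ha0)
  · rintro hu ha
    obtain ⟨u, hu⟩ := hu
    obtain ⟨b, s, hs, h⟩ := (hD2 _).1 (↑u⁻¹ : D.ring).2
    have h1 : algebraMap A F a * ((↑u⁻¹ : D.ring) : F) = 1 := by
      have := congrArg Subtype.val (Units.mul_inv u)
      rw [hu] at this
      simpa using this
    have hs0 : algebraMap A F s ≠ 0 := by
      rw [Ne, IsFractionRing.to_map_eq_zero_iff]; rintro rfl; exact hs (zero_mem _)
    rw [h, mul_div_assoc', div_eq_one_iff_eq hs0, ← map_mul] at h1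
    exact hs (IsFractionRing.injective A F h1 ▸ p.mul_mem_right b ha)

/-- A prime divisor whose center has height one is determined by its center. -/
theorem mem_ring_iff_of_height_center_eq_one [IsDomain A] [IsNoetherianRing A]
    [IsIntegrallyClosed A] [IsFractionRing A F] (D : PrimeDivisorOver A F)
    (h1 : D.center.height = 1) (f : F) :
    f ∈ D.ring ↔ ∃ b s : A, s ∉ D.center ∧ f = algebraMap A F b / algebraMap A F s := by
  constructor
  · intro hf
    obtain ⟨D', hD', hc⟩ := exists_of_prime_height_eq_one (F := F) D.center
      (hP := D.center_isPrime) h1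
    rw [← hD']
    -- Otherwise the inverse of f lies in the localization with numerator in the center, so it has
    -- positive order along D, although f is regular along D.
    by_contra hf'
    have hf0 : f ≠ 0 := by rintro rfl; exact hf' (zero_mem _)
    obtain ⟨b, s, hs, h⟩ := (hD' f⁻¹).1 ((D'.ring.mem_or_inv_mem f).resolve_left hf')
    have hb : b ∈ D.center := by
      by_contra hb
      exact hf' ((hD' f).2 ⟨s, b, hb, by rw [← inv_inv f, h, inv_div]⟩)
    have hb0 : b ≠ 0 := by
      rintro rfl
      simp [hf0] at h
    have hs0 : s ≠ 0 := by rintro rfl; exact hs (zero_mem _)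
    have h2 := (D.ord_algebraMap_pos_iff hb0).2 hb
    have h3 := D.ord_algebraMap_eq_zero hs
    have h4 := D.ord_nonneg_of_mem hf
    have h5 : D.ord f⁻¹ = D.ord (algebraMap A F b) - D.ord (algebraMap A F s) := by
      rw [h, div_eq_mul_inv, ord_mul _ (by simpa using hb0) (by simpa using hs0), ord_inv]
      ring
    rw [ord_inv] at h5
    omega
  · rintro ⟨b, s, hs, rfl⟩
    have hs0 : s ≠ 0 := by rintro rfl; exact hs (zero_mem _)
    rcases eq_or_ne b 0 with rfl | hb0
    · simp
    refine D.mem_of_ord_nonneg ?_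
    rw [div_eq_mul_inv, ord_mul _ (by simpa using hb0) (by simpa using hs0), ord_inv,
      D.ord_algebraMap_eq_zero hs]
    simpa using D.ord_algebraMap_nonneg b

end Model

end PrimeDivisorOver

/-- An element of the fraction field of a normal noetherian domain that is regular at the primes of
height one contained in a prime `x` is regular at `x`. -/
theorem exists_div_of_forall_height_eq_one {A F : Type*} [CommRing A] [IsDomain A]
    [IsNoetherianRing A] [IsIntegrallyClosed A] [Field F] [Algebra A F] [IsFractionRing A F]
    (x : Ideal A) [hx : x.IsPrime] (f : F)
    (h : ∀ p : Ideal A, p.IsPrime → p.height = 1 → p ≤ x →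
      ∃ b s : A, s ∉ p ∧ f = algebraMap A F b / algebraMap A F s) :
    ∃ b s : A, s ∉ x ∧ f = algebraMap A F b / algebraMap A F s := by
  have hinj := IsFractionRing.injective A F
  -- The denominator ideal of y: all s with s y in A. If f is not regular at x, its denominator
  -- ideal lies in x.
  let den (y : F) : Ideal A := Submodule.comap (Algebra.linearMap A F)
    (Submodule.comap (LinearMap.mulRight A y) (1 : Submodule A F))
  have hden : ∀ (y : F) (s : A), s ∈ den y ↔ ∃ w : A, algebraMap A F w = algebraMap A F s * y := by
    intro y s
    simp [den, Submodule.mem_one]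
  by_contra hcon
  have hf : den f ≤ x := by
    intro s hs
    by_contra hsx
    obtain ⟨w, hw⟩ := (hden _ _).1 hs
    have hs0 : algebraMap A F s ≠ 0 := by
      rw [Ne, IsFractionRing.to_map_eq_zero_iff]; rintro rfl; exact hsx (zero_mem _)
    exact hcon ⟨w, s, hsx, by rw [hw]; field_simp⟩
  -- A maximal denominator ideal contained in x, among those of multiples of f, is prime, as for
  -- associated primes. The aim is to show that it has height one.
  let T : Set (Ideal A) := {I | I ≤ x ∧ ∃ c : A, I = den (algebraMap A F c * f)}
  obtain ⟨p, ⟨hpx, c, hpc⟩, hmax⟩ : ∃ p : Ideal A, p ∈ T ∧ ∀ I ∈ T, ¬ p < I :=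
    set_has_maximal_iff_noetherian.2
      (inferInstance : IsNoetherian A A) T ⟨den f, hf, 1, by simp⟩
  have hmax' : ∀ u : A, den (algebraMap A F u * (algebraMap A F c * f)) ≤ x →
      den (algebraMap A F u * (algebraMap A F c * f)) ≤ p := by
    intro u hu
    have hle : p ≤ den (algebraMap A F u * (algebraMap A F c * f)) := by
      intro s hs
      rw [hpc, hden] at hs
      obtain ⟨w, hw⟩ := hs
      exact (hden _ _).2 ⟨u * w, by rw [map_mul, hw]; ring⟩
    have := hmax _ ⟨hu, u * c, by rw [map_mul, mul_assoc]⟩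
    exact (hle.eq_of_not_lt this).ge
  set y := algebraMap A F c * f with hy
  have hp1 : p.IsPrime := by
    refine ⟨fun h1 => hx.ne_top (top_le_iff.1 (h1 ▸ hpx)), fun {s t} hst => ?_⟩
    by_cases hs : den (algebraMap A F s * y) ≤ x
    · right
      refine hmax' s hs ?_
      rw [hpc, hden] at hst
      obtain ⟨w, hw⟩ := hst
      exact (hden _ _).2 ⟨w, by rw [hw, map_mul]; ring⟩
    · left
      obtain ⟨u, hu, hux⟩ := SetLike.not_le_iff_exists.1 hs
      have hu2 : den (algebraMap A F u * y) ≤ x := by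
        intro w hw
        obtain ⟨z, hz⟩ := (hden _ _).1 hw
        have : w * u ∈ p := by
          rw [hpc, hden]
          exact ⟨z, by rw [hz, map_mul]; ring⟩
        exact (hx.mem_or_mem (hpx this)).resolve_right hux
      refine hmax' u hu2 ?_
      obtain ⟨w, hw⟩ := (hden _ _).1 hu
      exact (hden _ _).2 ⟨w, by rw [hw]; ring⟩
  have hp0 : p ≠ ⊥ := by
    obtain ⟨a, b, hb, hab⟩ := IsFractionRing.div_surjective A y
    have hb0 : b ≠ 0 := nonZeroDivisors.ne_zero hb
    have hb1 : algebraMap A F b ≠ 0 := by simpa using hb0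
    intro hbot
    have : b ∈ p := by
      rw [hpc, hden]
      exact ⟨a, by rw [← hab]; field_simp⟩
    rw [hbot] at this
    exact hb0 (by simpa using this)
  -- If y mapped p into itself, it would be integral over A, hence in A by normality, and its
  -- denominator ideal would be everything.
  obtain ⟨t, htp, w, hw, hwp⟩ : ∃ t ∈ p, ∃ w : A, algebraMap A F w = algebraMap A F t * y ∧
      w ∉ p := by
    by_contra! hall
    have h_int : IsIntegral A y := by
      let N : Submodule A F := Submodule.map (Algebra.linearMap A F) p
      refine isIntegral_of_smul_mem_submodule N ?_ ?_ y ?_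
      · intro hN
        obtain ⟨s, hs, hs0⟩ := Submodule.exists_mem_ne_zero_of_ne_bot hp0
        have : algebraMap A F s ∈ N := ⟨s, hs, rfl⟩
        rw [hN] at this
        exact hs0 (by simpa using this)
      · exact Submodule.FG.map _ (IsNoetherian.noetherian p)
      · rintro _ ⟨s, hs, rfl⟩
        have hs' := hs
        rw [hpc] at hs'
        obtain ⟨w, hw⟩ := (hden _ _).1 hs'
        refine ⟨w, hall s hs w hw, ?_⟩
        rw [Algebra.linearMap_apply, hw, Algebra.linearMap_apply, smul_eq_mul, mul_comm]
    obtain ⟨z, hz⟩ := IsIntegrallyClosed.isIntegral_iff.1 h_int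
    refine hp1.ne_top ((Ideal.eq_top_iff_one p).2 ?_)
    rw [hpc, hden]
    exact ⟨z, by rw [hz]; simp⟩
  -- Since w = t y is a unit at p, every s in p satisfies s w = (s y) t. So p is minimal over the
  -- ideal of t, and Krull's theorem bounds its height.
  have hmin : p ∈ (Ideal.span {t}).minimalPrimes := by
    refine ⟨⟨hp1, by simpa [Ideal.span_le] using htp⟩, ?_⟩
    rintro q ⟨hq, htq⟩ hqp s hs
    have hs' := hs
    rw [hpc] at hs'
    obtain ⟨z, hz⟩ := (hden _ _).1 hs'
    have : s * w = z * t := hinj (by rw [map_mul, map_mul, hw, hz]; ring)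
    have htq' : t ∈ q := htq (Ideal.mem_span_singleton_self t)
    have h2 : s * w ∈ q := this ▸ q.mul_mem_left z htq'
    exact (hq.mem_or_mem h2).resolve_right fun h => hwp (hqp h)
  have hht : p.height = 1 := by
    refine le_antisymm (Ideal.height_le_one_of_isPrincipal_of_mem_minimalPrimes _ p hmin) ?_
    rwa [Order.one_le_iff_ne_zero, Ne, Ideal.height_eq_zero_iff_eq_bot]
  obtain ⟨b, s, hs, hfs⟩ := h p hp1 hht hpx
  apply hs
  have hs0 : algebraMap A F s ≠ 0 := by
    rw [Ne, IsFractionRing.to_map_eq_zero_iff]; rintro rfl; exact hs (zero_mem _)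
  rw [hpc, hden]
  exact ⟨c * b, by rw [hy, hfs, map_mul]; field_simp⟩

/-! ### Determinants of top forms and unimodular completion -/

section Wedge

variable {F V : Type*} [Field F] [AddCommGroup V] [Module F V] {n : ℕ}

/-- Both sides are alternating in the rows of `M`, so it suffices to compare them on tuples of
distinct basis vectors, which are permutations of the basis. -/
theorem ιMulti_sum_smul (M : Matrix (Fin n) (Fin n) F) (u : Fin n → V) :
    exteriorPower.ιMulti F n (fun j => ∑ i, M j i • u i) = M.det • exteriorPower.ιMulti F n u := by
  let g : (Fin n → F) →ₗ[F] V := Fintype.linearCombination F u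
  let T : F →ₗ[F] ⋀[F]^n V := LinearMap.toSpanSingleton F _ (exteriorPower.ιMulti F n u)
  have h : (exteriorPower.ιMulti F n).compLinearMap g =
      T.compAlternatingMap (Matrix.detRowAlternating (n := Fin n) (R := F)) := by
    refine Module.Basis.ext_alternating (Pi.basisFun F (Fin n)) fun v hv => ?_
    let e : Equiv.Perm (Fin n) := Equiv.ofBijective v (Finite.injective_iff_bijective.1 hv)
    have h1 : (fun i => (Pi.basisFun F (Fin n)) (v i)) =
        (fun i => (1 : Matrix (Fin n) (Fin n) F) i) ∘ e := by
      funext i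
      ext j
      simp [e, Matrix.one_apply, Pi.single_apply, eq_comm]
    rw [h1, AlternatingMap.map_perm, AlternatingMap.map_perm]
    congr 1
    have h2 : (1 : Matrix (Fin n) (Fin n) F).det = 1 := Matrix.det_one
    rw [AlternatingMap.compLinearMap_apply, LinearMap.compAlternatingMap_apply]
    have h3 : Matrix.detRowAlternating (fun i => (1 : Matrix (Fin n) (Fin n) F) i) = 1 := h2
    rw [h3, LinearMap.toSpanSingleton_apply, one_smul]
    congr 1
    funext i
    simp [g, Fintype.linearCombination_apply, Matrix.one_apply]
  have h4 := congrArg (fun f => f M) h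
  exact h4

end Wedge

section Unimodular

/-- Every nonzero integer vector is a positive multiple of a column of a unimodular matrix. -/
theorem exists_unimodular {n : ℕ} (w : Fin n → ℤ) (hw : w ≠ 0) (i₀ : Fin n) :
    ∃ (U V : Matrix (Fin n) (Fin n) ℤ) (g : ℤ), V * U = 1 ∧ U * V = 1 ∧ 0 < g ∧
      ∀ j, w j = g * U j i₀ := by
  -- Smith normal form of the rank-one module spanned by w produces a basis of the lattice in which
  -- w is a multiple of one vector. That vector is then moved to position i₀ and its sign is
  -- adjusted.
  obtain ⟨k, b, bN, f, a, hs⟩ :=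
    Submodule.smithNormalForm (Pi.basisFun ℤ (Fin n)) (Submodule.span ℤ {w})
  have hk : k = 1 := by
    have h1 := (LinearEquiv.toSpanNonzeroSingleton ℤ (Fin n → ℤ) w hw).finrank_eq
    rw [Module.finrank_eq_card_basis bN] at h1
    simpa using h1.symm
  subst hk
  obtain ⟨c, hc⟩ : ∃ c : ℤ, w = c • b (f 0) := by
    have h1 := bN.sum_repr ⟨w, Submodule.mem_span_singleton_self w⟩
    have h2 := congrArg Subtype.val h1
    simp only [Finset.univ_unique, Fin.default_eq_zero, Finset.sum_singleton,
      Submodule.coe_smul, hs] at h2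
    exact ⟨_, by rw [← h2, smul_smul]⟩
  have hc0 : c ≠ 0 := by rintro rfl; simp at hc; exact hw hc
  let u : ℤˣ := if 0 < c then 1 else -1
  have hu : (u : ℤ) * c = |c| := by
    simp only [u]
    split_ifs with h
    · simp [abs_of_pos h]
    · simp [abs_of_neg (lt_of_le_of_ne (not_lt.1 h) hc0)]
  let b' := (b.reindex (Equiv.swap (f 0) i₀)).unitsSMul fun _ => u
  refine ⟨(Pi.basisFun ℤ (Fin n)).toMatrix b', b'.toMatrix (Pi.basisFun ℤ (Fin n)), |c|,
    Module.Basis.toMatrix_mul_toMatrix_flip _ _, Module.Basis.toMatrix_mul_toMatrix_flip _ _,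
    abs_pos.2 hc0, fun j => ?_⟩
  rw [hc]
  have hu2 : (u : ℤ) * u = 1 := by rw [← Units.val_mul, Int.units_mul_self, Units.val_one]
  simp only [b', Pi.smul_apply, smul_eq_mul, Module.Basis.toMatrix_apply, Pi.basisFun_repr,
    Module.Basis.unitsSMul_apply, Module.Basis.reindex_apply, Equiv.symm_swap,
    Equiv.swap_apply_right, Units.smul_def]
  rw [← hu]
  linear_combination (-(c * b (f 0) j)) * hu2

end Unimodular

/-! ### Orders of differential forms and the logarithmic pole bound -/

namespace PrimeDivisorOver

variable {A : Type*} [CommRing A] {F : Type*} [Field F] [Algebra A F] [Algebra ℂ F] {n : ℕ}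

/-- The functions in the valuation ring of `E` whose differential is a combination of the
differentials of `t` with coefficients in the valuation ring. -/
def coordSubring (E : PrimeDivisorOver A F) (t : Fin n → F) : Subring F where
  carrier := {g | g ∈ E.ring ∧ KaehlerDifferential.D ℂ F g ∈
    Submodule.span E.ring.toSubring (Set.range fun i => KaehlerDifferential.D ℂ F (t i))}
  mul_mem' := by
    rintro a b ⟨ha, ha'⟩ ⟨hb, hb'⟩
    refine ⟨mul_mem ha hb, ?_⟩
    rw [Derivation.leibniz]
    exact add_mem (Submodule.smul_mem _ (⟨a, ha⟩ : E.ring.toSubring) hb')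
      (Submodule.smul_mem _ (⟨b, hb⟩ : E.ring.toSubring) ha')
  one_mem' := ⟨one_mem _, by simp⟩
  add_mem' := by
    rintro a b ⟨ha, ha'⟩ ⟨hb, hb'⟩
    exact ⟨add_mem ha hb, by rw [map_add]; exact add_mem ha' hb'⟩
  zero_mem' := ⟨zero_mem _, by simp⟩
  neg_mem' := by
    rintro a ⟨ha, ha'⟩
    exact ⟨neg_mem ha, by rw [map_neg]; exact neg_mem ha'⟩

theorem mem_coordSubring_self (E : PrimeDivisorOver A F) (t : Fin n → F) {i : Fin n}
    (hi : t i ∈ E.ring) : t i ∈ E.coordSubring t :=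
  ⟨hi, Submodule.subset_span ⟨i, rfl⟩⟩

theorem algebraMap_mem_coordSubring [Algebra ℂ A] [IsScalarTower ℂ A F]
    (E : PrimeDivisorOver A F) (t : Fin n → F) (c : ℂ) :
    algebraMap ℂ F c ∈ E.coordSubring t := by
  refine ⟨?_, by simp⟩
  rw [IsScalarTower.algebraMap_apply ℂ A F]
  exact E.algebraMap_mem _

theorem inv_mem_coordSubring (E : PrimeDivisorOver A F) (t : Fin n → F) {g : F}
    (hg : g ∈ E.coordSubring t) (hg' : g⁻¹ ∈ E.ring) : g⁻¹ ∈ E.coordSubring t := by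
  refine ⟨hg', ?_⟩
  rw [Derivation.leibniz_inv]
  exact Submodule.smul_mem _ (⟨-g⁻¹ ^ 2, neg_mem (pow_mem hg' 2)⟩ : E.ring.toSubring) hg.2

/-- The differentials of n elements of the valuation ring expand in the d(t i) by a matrix over that
ring, so their wedge is a multiple by the determinant, again in the ring. -/
theorem regularForms_eq_span (E : PrimeDivisorOver A F) (t : Fin n → F) (ht : ∀ i, t i ∈ E.ring)
    (h : ∀ g ∈ E.ring, g ∈ E.coordSubring t) :
    E.regularForms n = Submodule.span E.ring.toSubring
      {exteriorPower.ιMulti F n fun i => KaehlerDifferential.D ℂ F (t i)} := by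
  apply le_antisymm
  · refine Submodule.span_le.2 ?_
    rintro _ ⟨g, rfl⟩
    have h2 : ∀ j, ∃ c : Fin n → E.ring.toSubring,
        ∑ i, c i • KaehlerDifferential.D ℂ F (t i) = KaehlerDifferential.D ℂ F (g j) := fun j =>
      Submodule.mem_span_range_iff_exists_fun _ |>.1 (h _ (g j).2).2
    choose c hc using h2
    let M : Matrix (Fin n) (Fin n) E.ring.toSubring := Matrix.of c
    have h3 : (fun j => KaehlerDifferential.D ℂ F (g j : F)) = fun j =>
        ∑ i, (M.map (E.ring.toSubring.subtype)) j i • KaehlerDifferential.D ℂ F (t i) := by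
      funext j
      rw [← hc j]
      rfl
    rw [h3, ιMulti_sum_smul, ← RingHom.mapMatrix_apply, ← RingHom.map_det]
    exact Submodule.smul_mem _ M.det (Submodule.mem_span_singleton_self _)
  · rw [Submodule.span_singleton_le_iff_mem]
    exact Submodule.subset_span ⟨fun i => ⟨t i, ht i⟩, rfl⟩

/-- By the quotient rule, it is enough to check that the numerators and unit denominators of a
presentation lie in the coordinate subring. -/
theorem mem_coordSubring_of_fractions (E : PrimeDivisorOver A F) (t : Fin n → F)
    (h : ∀ g ∈ E.ring, ∃ b s : F, b ∈ E.coordSubring t ∧ s ∈ E.coordSubring t ∧ s⁻¹ ∈ E.ring ∧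
      g = b / s) : ∀ g ∈ E.ring, g ∈ E.coordSubring t := by
  intro g hg
  obtain ⟨b, s, hb, hs, hs', rfl⟩ := h g hg
  rw [div_eq_mul_inv]
  exact mul_mem hb (E.inv_mem_coordSubring t hs hs')

/-- Two generators of the module of regular forms differ by a unit of the valuation ring. This makes
the order of a nonzero form well defined and additive under scaling. -/
theorem FormHasOrd.eq_add {E : PrimeDivisorOver A F} {ω ω₁ : ⋀[F]^n Ω[F⁄ℂ]} {k k₁ : ℤ} {h : F}
    (hω : E.FormHasOrd ω k) (hω₁ : E.FormHasOrd ω₁ k₁) (h0 : ω ≠ 0) (hh : ω = h • ω₁) :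
    k = E.ord h + k₁ := by
  obtain ⟨η, f, hf, hs, rfl, rfl⟩ := hω
  obtain ⟨η₁, f₁, hf₁, hs₁, rfl, rfl⟩ := hω₁
  have hη : η ≠ 0 := by rintro rfl; simp at h0
  have hh0 : h ≠ 0 := by rintro rfl; simp at hh; exact h0 (by simpa using hh)
  rw [hs] at hs₁
  obtain ⟨u, hu⟩ := Submodule.mem_span_singleton.1
    (hs₁ ▸ Submodule.mem_span_singleton_self η)
  obtain ⟨u', hu'⟩ := Submodule.mem_span_singleton.1
    (hs₁ ▸ Submodule.mem_span_singleton_self η₁)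
  have e1 : (u : F) • η₁ = η := hu
  have e2 : (u' : F) • η = η₁ := hu'
  have huu : (u : F) * u' = 1 := by
    refine smul_left_injective F hη ?_
    change ((u : F) * u') • η = (1 : F) • η
    rw [mul_smul, e2, e1, one_smul]
  have hu0 : (u : F) ≠ 0 := left_ne_zero_of_mul_eq_one huu
  have hu0' : (u' : F) ≠ 0 := right_ne_zero_of_mul_eq_one huu
  have hordu : E.ord u = 0 := by
    have h1 := E.ord_nonneg_of_mem u.2
    have h2 := E.ord_nonneg_of_mem u'.2
    have h3 := E.ord_mul hu0 hu0'
    rw [huu, ord_one] at h3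
    omega
  have hη₁ : η₁ ≠ 0 := by rintro rfl; exact hη (by rw [← e1, smul_zero])
  have : f * u = h * f₁ := by
    refine smul_left_injective F hη₁ ?_
    change (f * u) • η₁ = (h * f₁) • η₁
    rw [mul_smul, mul_smul, e1, hh]
  have h5 := congrArg E.ord this
  rw [ord_mul _ hf hu0, ord_mul _ hh0 hf₁, hordu] at h5
  omega

end PrimeDivisorOver

section LogForm

variable {F : Type*} [Field F] [Algebra ℂ F] {n : ℕ}

theorem D_zpow (y : F) (hy : y ≠ 0) (k : ℤ) :
    KaehlerDifferential.D ℂ F (y ^ k) = ((k : F) * y ^ k * y⁻¹) • KaehlerDifferential.D ℂ F y := by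
  rw [Derivation.leibniz_zpow, zpow_sub_one₀ hy, ← Int.cast_smul_eq_zsmul F, smul_smul, mul_assoc]

theorem D_prod_zpow (y : Fin n → F) (hy : ∀ i, y i ≠ 0) (k : Fin n → ℤ) :
    KaehlerDifferential.D ℂ F (∏ i, y i ^ k i) =
      ∑ i, ((∏ i, y i ^ k i) * (k i * (y i)⁻¹)) • KaehlerDifferential.D ℂ F (y i) := by
  have h : ∀ s : Finset (Fin n), KaehlerDifferential.D ℂ F (∏ i ∈ s, y i ^ k i) =
      ∑ i ∈ s, ((∏ i ∈ s, y i ^ k i) * (k i * (y i)⁻¹)) • KaehlerDifferential.D ℂ F (y i) := by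
    intro s
    induction s using Finset.induction_on with
    | empty => simp
    | insert i s hi ih =>
      rw [Finset.prod_insert hi, Finset.sum_insert hi, Derivation.leibniz, ih, D_zpow _ (hy i),
        Finset.smul_sum, add_comm]
      congr 1
      · rw [smul_smul]; congr 1; ring
      · refine Finset.sum_congr rfl fun j _ => ?_
        rw [smul_smul]; congr 1; ring
  exact h Finset.univ

/-- Logarithmic differentials linearize monomials: dlog z = U dlog y, so the wedges of the dlog's
differ by det U. -/
theorem ιMulti_D_prod_zpow (z y : Fin n → F) (hy : ∀ i, y i ≠ 0) (U : Matrix (Fin n) (Fin n) ℤ)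
    (hz : ∀ j, z j = ∏ i, y i ^ U j i) :
    exteriorPower.ιMulti F n (fun j => KaehlerDifferential.D ℂ F (z j)) =
      ((∏ j, z j) * (∏ i, y i)⁻¹ * (U.det : F)) •
        exteriorPower.ιMulti F n (fun i => KaehlerDifferential.D ℂ F (y i)) := by
  have h1 : (fun j => KaehlerDifferential.D ℂ F (z j)) = fun j =>
      ∑ i, (Matrix.of fun j i => z j * (Matrix.of fun j i => (y i)⁻¹ *
        (U.map (Int.castRingHom F)) j i) j i) j i • KaehlerDifferential.D ℂ F (y i) := by
    funext j
    rw [hz j, D_prod_zpow y hy]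
    refine Finset.sum_congr rfl fun i _ => ?_
    congr 1
    simp [hz j, mul_comm]
  rw [h1, ιMulti_sum_smul, Matrix.det_mul_column, Matrix.det_mul_row, ← RingHom.mapMatrix_apply,
    ← RingHom.map_det, Finset.prod_inv_distrib, mul_assoc]
  rfl

end LogForm

section Monomial

variable {F : Type*} [Field F] {n : ℕ}

theorem prod_zpow_matrix_mul (y : Fin n → F) (hy : ∀ i, y i ≠ 0) (U V : Matrix (Fin n) (Fin n) ℤ)
    (j : Fin n) : ∏ i, (∏ k, y k ^ U i k) ^ V j i = ∏ k, y k ^ (V * U) j k := by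
  simp only [← Finset.prod_zpow, ← zpow_mul, Matrix.mul_apply]
  rw [Finset.prod_comm]
  refine Finset.prod_congr rfl fun k _ => ?_
  simp only [mul_comm (U _ _)]
  induction (Finset.univ : Finset (Fin n)) using Finset.induction_on with
  | empty => simp
  | insert i s hi ih => rw [Finset.prod_insert hi, Finset.sum_insert hi, zpow_add₀ (hy k), ih]

theorem prod_zpow_one (y : Fin n → F) (j : Fin n) :
    ∏ k, y k ^ (1 : Matrix (Fin n) (Fin n) ℤ) j k = y j := by
  rw [Finset.prod_eq_single j]
  · simp
  · intro k _ hk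
    simp [Matrix.one_apply_ne hk.symm]
  · simp

end Monomial

namespace PrimeDivisorOver

variable {A : Type*} [CommRing A] {F : Type*} [Field F] [Algebra A F] {n : ℕ}

theorem ord_prod_zpow (E : PrimeDivisorOver A F) (z : Fin n → F) (hz : ∀ i, z i ≠ 0)
    (k : Fin n → ℤ) : E.ord (∏ i, z i ^ k i) = ∑ i, k i * E.ord (z i) := by
  rw [E.ord_prod _ _ fun i _ => zpow_ne_zero _ (hz i)]
  simp [ord_zpow]

/-- If the vector of orders of the `z i` is `g` times a column of a unimodular matrix, then
the monomials in the `z i` given by the inverse matrix have orders `g, 0, …, 0`. -/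
theorem ord_prod_zpow_inverse (E : PrimeDivisorOver A F) (z : Fin n → F) (hz : ∀ i, z i ≠ 0)
    {U V : Matrix (Fin n) (Fin n) ℤ} (hVU : V * U = 1) {g : ℤ} {i₀ : Fin n}
    (hg : ∀ j, E.ord (z j) = g * U j i₀) (i : Fin n) :
    E.ord (∏ j, z j ^ V i j) = if i = i₀ then g else 0 := by
  rw [E.ord_prod_zpow z hz]
  have h : ∑ j, V i j * E.ord (z j) = g * (V * U) i i₀ := by
    rw [Matrix.mul_apply, Finset.mul_sum]
    refine Finset.sum_congr rfl fun j _ => ?_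
    rw [hg]; ring
  rw [h, hVU, Matrix.one_apply]
  split_ifs <;> simp

variable [Algebra ℂ F]

/-- A logarithmic form has at most a simple pole along every prime divisor. -/
theorem FormHasOrd.sum_ord_le (E : PrimeDivisorOver A F) (z : Fin n → F) (hz : ∀ i, z i ≠ 0)
    (i₀ : Fin n) (hpos : E.ord (z i₀) ≠ 0) {k : ℤ}
    (h0 : exteriorPower.ιMulti F n (fun i => KaehlerDifferential.D ℂ F (z i)) ≠ 0)
    (h : E.FormHasOrd (exteriorPower.ιMulti F n fun i => KaehlerDifferential.D ℂ F (z i)) k) :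
    ∑ i, E.ord (z i) - 1 ≤ k := by
  -- A unimodular monomial change concentrates the orders: one coordinate y i₀ has order g, the
  -- others are units along E.
  obtain ⟨U, V, g, hVU, hUV, hg0, hg⟩ := exists_unimodular (fun j => E.ord (z j))
    (fun h => hpos (congrFun h i₀)) i₀
  obtain ⟨η, f, hf, hs, hη, rfl⟩ := h
  obtain ⟨t, ht0, ht⟩ := E.exists_uniformizer
  let y : Fin n → F := fun i => ∏ j, z j ^ V i j
  have hy0 : ∀ i, y i ≠ 0 := fun i => Finset.prod_ne_zero_iff.2 fun j _ => zpow_ne_zero _ (hz j)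
  have hordy : ∀ i, E.ord (y i) = if i = i₀ then g else 0 := E.ord_prod_zpow_inverse z hz hVU hg
  have hzy : ∀ j, z j = ∏ i, y i ^ U j i := fun j => by
    rw [prod_zpow_matrix_mul z hz, hUV, prod_zpow_one]
  -- `y i₀ = t ^ g * u` with `u` a unit, so `dy i₀` is `t ^ (g - 1)` times a regular form.
  have hty : ∀ i, y i ∈ E.ring := fun i => E.mem_of_ord_nonneg (by
    rw [hordy]; split_ifs <;> omega)
  let u : F := y i₀ * t ^ (-g)
  have hu : u ∈ E.ring := E.mem_of_ord_nonneg (by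
    rw [ord_mul _ (hy0 _) (zpow_ne_zero _ ht0), ord_zpow, ht, hordy]; simp)
  have ht' : t ∈ E.ring := E.mem_of_ord_nonneg (by omega)
  have hyu : y i₀ = u * t ^ g := by
    simp only [u]; rw [mul_assoc, ← zpow_add₀ ht0]; simp
  have hdy : KaehlerDifferential.D ℂ F (y i₀) = t ^ (g - 1) •
      (((g : F) * u) • KaehlerDifferential.D ℂ F t + t • KaehlerDifferential.D ℂ F u) := by
    rw [hyu, Derivation.leibniz, D_zpow _ ht0, smul_add, smul_smul, smul_smul, smul_smul,
      zpow_sub_one₀ ht0]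
    congr 2
    · ring
    · field_simp
  have hdr : ∀ c : Fin n → F, (∀ i, c i ∈ E.ring) →
      exteriorPower.ιMulti F n (fun i => KaehlerDifferential.D ℂ F (c i)) ∈ E.regularForms n :=
    fun c hc => Submodule.subset_span ⟨fun i => ⟨c i, hc i⟩, rfl⟩
  obtain ⟨θ, hθ, hθ'⟩ : ∃ θ ∈ E.regularForms n,
      exteriorPower.ιMulti F n (fun i => KaehlerDifferential.D ℂ F (y i)) = t ^ (g - 1) • θ := by
    let d : Fin n → Ω[F⁄ℂ] := fun i => KaehlerDifferential.D ℂ F (y i)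
    have e1 : d = Function.update d i₀ (KaehlerDifferential.D ℂ F (y i₀)) := by
      simp [d]
    have hup : ∀ x : F, Function.update d i₀ (KaehlerDifferential.D ℂ F x) =
        fun i => KaehlerDifferential.D ℂ F (Function.update y i₀ x i) := by
      intro x
      funext i
      by_cases hi : i = i₀
      · subst hi; simp
      · simp [hi, d]
    have hmem : ∀ x ∈ E.ring, exteriorPower.ιMulti F n
        (Function.update d i₀ (KaehlerDifferential.D ℂ F x)) ∈ E.regularForms n := by
      intro x hx
      rw [hup]
      refine hdr _ fun i => ?_
      by_cases hi : i = i₀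
      · subst hi; simpa using hx
      · simpa [hi] using hty i
    refine ⟨((g : F) * u) • exteriorPower.ιMulti F n
        (Function.update d i₀ (KaehlerDifferential.D ℂ F t)) +
      t • exteriorPower.ιMulti F n (Function.update d i₀ (KaehlerDifferential.D ℂ F u)), ?_, ?_⟩
    · exact add_mem
        (Submodule.smul_mem _ (⟨(g : F) * u, mul_mem (intCast_mem _ g) hu⟩ : E.ring.toSubring)
          (hmem t ht'))
        (Submodule.smul_mem _ (⟨t, ht'⟩ : E.ring.toSubring) (hmem u hu))
    · change exteriorPower.ιMulti F n d = _
      rw [e1, hdy, AlternatingMap.map_update_smul, AlternatingMap.map_update_add,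
        AlternatingMap.map_update_smul, AlternatingMap.map_update_smul]
      simp
  rw [hs] at hθ
  obtain ⟨c, hc⟩ := Submodule.mem_span_singleton.1 hθ
  have hc' : (c : F) • η = θ := hc
  -- The coefficient has order ∑ ord z - g + (g - 1) + ord c with c regular. The g cancels and
  -- leaves the bound.
  have hmain : f • η = ((∏ j, z j) * (∏ i, y i)⁻¹ * (U.det : F) * t ^ (g - 1) * c) • η := by
    rw [← hη, ιMulti_D_prod_zpow z y hy0 U hzy, hθ', ← hc', smul_smul, smul_smul]
  have hη0 : η ≠ 0 := by rintro rfl; rw [hη] at h0; simp at h0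
  have hf' : f = (∏ j, z j) * (∏ i, y i)⁻¹ * (U.det : F) * t ^ (g - 1) * c :=
    smul_left_injective F hη0 hmain
  have hz0 : (∏ j, z j) ≠ 0 := Finset.prod_ne_zero_iff.2 fun j _ => hz j
  have hyy0 : (∏ j, y j) ≠ 0 := Finset.prod_ne_zero_iff.2 fun j _ => hy0 j
  have hdet : IsUnit U.det := by
    have := congrArg Matrix.det hUV
    rw [Matrix.det_mul, Matrix.det_one] at this
    exact IsUnit.of_mul_eq_one _ this
  have hc0 : (c : F) ≠ 0 := by rintro h; rw [h, mul_zero] at hf'; exact hf hf'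
  have hdet0 : (U.det : F) ≠ 0 := by
    rcases Int.isUnit_iff.1 hdet with h | h <;> rw [h] <;> simp
  have horddet : E.ord (U.det : F) = 0 := by
    have h2 : (U.det : F) * (U.det : F) = 1 := by
      rcases Int.isUnit_iff.1 hdet with h | h <;> rw [h] <;> simp
    have h3 := E.ord_mul hdet0 hdet0
    rw [h2, ord_one] at h3
    omega
  have h1 := E.ord_nonneg_of_mem c.2
  have hsum : E.ord (∏ i, y i) = g := by
    rw [E.ord_prod _ _ fun i _ => hy0 i]
    simp [hordy]
  have htz : t ^ (g - 1) ≠ 0 := zpow_ne_zero _ ht0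
  rw [hf', E.ord_mul (by positivity) hc0, E.ord_mul (by positivity) htz,
    E.ord_mul (by positivity) hdet0, E.ord_mul hz0 (inv_ne_zero hyy0), ord_inv, hsum, ord_zpow, ht,
    horddet, E.ord_prod _ _ fun i _ => hz i]
  omega

end PrimeDivisorOver

/-! ### The ring of invariants -/

section CoordRing

open MvPolynomial

variable {d r : ℕ} {a : Fin d → ℤ}

theorem muAction_monomial (r : ℕ) (a : Fin d → ℤ) (m : Fin d →₀ ℕ) (c : ℂ) :
    muAction r a (monomial m c) =
      C (Complex.exp (2 * Real.pi * Complex.I / r) ^ (∑ i, a i * m i)) * monomial m c := by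
  set ξ := Complex.exp (2 * Real.pi * Complex.I / r) with hξ
  have hξ0 : ξ ≠ 0 := Complex.exp_ne_zero _
  rw [muAction, aeval_monomial, Finsupp.prod_fintype _ _ (by simp)]
  simp only [mul_pow, Finset.prod_mul_distrib, ← map_pow, ← map_prod]
  have h1 : ∏ i, (ξ ^ a i) ^ m i = ξ ^ (∑ i, a i * m i) := by
    induction (Finset.univ : Finset (Fin d)) using Finset.induction_on with
    | empty => simp
    | insert i s hi ih =>
      rw [Finset.prod_insert hi, Finset.sum_insert hi, zpow_add₀ hξ0, ih, zpow_mul, zpow_natCast]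
  rw [h1, monomial_eq (s := m) (a := c), Finsupp.prod_fintype _ _ (by simp)]
  simp only [algebraMap_eq]
  ring

theorem coeff_muAction (r : ℕ) (a : Fin d → ℤ) (m : Fin d →₀ ℕ) (f : MvPolynomial (Fin d) ℂ) :
    coeff m (muAction r a f) =
      Complex.exp (2 * Real.pi * Complex.I / r) ^ (∑ i, a i * m i) * coeff m f := by
  classical
  induction f using MvPolynomial.induction_on' with
  | monomial n c =>
    rw [muAction_monomial, coeff_C_mul, coeff_monomial]
    split_ifs with h
    · rw [h]
    · simp
  | add p q hp hq => rw [map_add, coeff_add, coeff_add, hp, hq, mul_add]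

/-- Monomials are eigenvectors of the action and ξ is a primitive r-th root of unity, so invariance
can be tested monomial by monomial. -/
theorem mem_coordRing_iff (hr : r ≠ 0) {f : MvPolynomial (Fin d) ℂ} :
    f ∈ coordRing r a ↔ ∀ m ∈ f.support, (r : ℤ) ∣ ∑ i, a i * m i := by
  have hξ := Complex.isPrimitiveRoot_exp r hr
  rw [coordRing, AlgHom.mem_equalizer, AlgHom.id_apply, MvPolynomial.ext_iff]
  refine forall_congr' fun m => ?_
  rw [coeff_muAction, mem_support_iff, ← hξ.zpow_eq_one_iff_dvd]
  constructor
  · intro h h0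
    exact mul_right_cancel₀ h0 (by rw [h, one_mul])
  · intro h
    by_cases h0 : coeff m f = 0
    · simp [h0]
    · rw [h h0, one_mul]

theorem monomial_mem_coordRing (hr : r ≠ 0) {m : Fin d →₀ ℕ} (hm : (r : ℤ) ∣ ∑ i, a i * m i)
    (c : ℂ) : monomial m c ∈ coordRing r a := by
  classical
  rw [mem_coordRing_iff hr]
  intro m' hm'
  have := support_monomial_subset hm'
  rw [Finset.mem_singleton] at this
  rwa [this]

theorem mem_coordRing_of_mul_mem {s g : MvPolynomial (Fin d) ℂ} (hs : s ∈ coordRing r a)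
    (hs0 : s ≠ 0) (h : s * g ∈ coordRing r a) : g ∈ coordRing r a := by
  rw [coordRing, AlgHom.mem_equalizer, AlgHom.id_apply] at *
  rw [map_mul, hs] at h
  exact mul_left_cancel₀ hs0 h

theorem X_pow_mem_coordRing (hr : r ≠ 0) (i : Fin d) :
    (X i ^ r : MvPolynomial (Fin d) ℂ) ∈ coordRing r a := by
  rw [X_pow_eq_monomial]
  refine monomial_mem_coordRing hr ?_ 1
  rw [Finset.sum_eq_single i]
  · simp
  · intro j _ hj
    simp [hj.symm]
  · simp

theorem isIntegral_coordRing (hr : r ≠ 0) :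
    Algebra.IsIntegral (coordRing r a) (MvPolynomial (Fin d) ℂ) := by
  refine ⟨fun f => ?_⟩
  have hC : ∀ c : ℂ, IsIntegral (coordRing r a) (C c : MvPolynomial (Fin d) ℂ) := fun c =>
    isIntegral_algebraMap (x := algebraMap ℂ (coordRing r a) c)
  induction f using MvPolynomial.induction_on with
  | C c => exact hC c
  | add p q hp hq => exact hp.add hq
  | mul_X p i hp =>
    refine hp.mul (IsIntegral.of_pow (Nat.pos_of_ne_zero hr) ?_)
    exact isIntegral_algebraMap (x := (⟨X i ^ r, X_pow_mem_coordRing hr i⟩ : coordRing r a))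

/-- Artin–Tate: the polynomial ring is of finite type over ℂ and finite over the invariants, since
each variable has invariant r-th power. -/
theorem isNoetherianRing_coordRing (hr : r ≠ 0) : IsNoetherianRing (coordRing r a) := by
  have h1 : Algebra.FiniteType (coordRing r a) (MvPolynomial (Fin d) ℂ) :=
    Algebra.FiniteType.of_restrictScalars_finiteType ℂ _ _
  have h2 := isIntegral_coordRing (a := a) hr
  have h3 : Module.Finite (coordRing r a) (MvPolynomial (Fin d) ℂ) := Algebra.IsIntegral.finite
  have h4 : (⊤ : Subalgebra ℂ (coordRing r a)).FG :=
    fg_of_fg_of_fg ℂ (coordRing r a) (MvPolynomial (Fin d) ℂ) Algebra.FiniteType.out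
      Module.Finite.fg_top Subtype.val_injective
  have : Algebra.FiniteType ℂ (coordRing r a) := ⟨h4⟩
  exact Algebra.FiniteType.isNoetherianRing ℂ _

/-- An integral fraction of invariants is a polynomial, because the polynomial ring is normal. A
polynomial that is a quotient of invariants is invariant. -/
theorem isIntegrallyClosed_coordRing : IsIntegrallyClosed (coordRing r a) := by
  rw [isIntegrallyClosed_iff (FractionRing (coordRing r a))]
  intro x hx
  let φ : FractionRing (coordRing r a) →+* FractionRing (MvPolynomial (Fin d) ℂ) :=
    IsFractionRing.map (A := coordRing r a) (B := MvPolynomial (Fin d) ℂ)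
      (j := (coordRing r a).val.toRingHom) Subtype.val_injective
  have hφ : ∀ b : coordRing r a, φ (algebraMap _ _ b) =
      algebraMap (MvPolynomial (Fin d) ℂ) _ (b : MvPolynomial (Fin d) ℂ) := fun b =>
    IsLocalization.map_eq _ b
  obtain ⟨b, s, hs, rfl⟩ := IsFractionRing.div_surjective (coordRing r a) x
  have hs0 : (s : MvPolynomial (Fin d) ℂ) ≠ 0 := by
    simpa using nonZeroDivisors.ne_zero hs
  have h_int : IsIntegral (MvPolynomial (Fin d) ℂ)
      (φ (algebraMap (coordRing r a) (FractionRing (coordRing r a)) b /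
        algebraMap (coordRing r a) (FractionRing (coordRing r a)) s)) := by
    obtain ⟨p, hp, hpx⟩ := hx
    refine ⟨p.map (coordRing r a).val.toRingHom, hp.map _, ?_⟩
    rw [Polynomial.eval₂_map]
    have : (algebraMap (MvPolynomial (Fin d) ℂ) (FractionRing (MvPolynomial (Fin d) ℂ))).comp
        (coordRing r a).val.toRingHom = φ.comp (algebraMap _ _) := by
      ext1 b
      exact (hφ b).symm
    rw [this, ← Polynomial.hom_eval₂, hpx, map_zero]
  rw [map_div₀, hφ, hφ] at h_int
  obtain ⟨g, hg⟩ := IsIntegrallyClosed.isIntegral_iff.1 h_int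
  rw [eq_div_iff (by simpa using hs0), ← map_mul] at hg
  have hg' : g * s = b := IsFractionRing.injective _ _ hg
  have hmem : g ∈ coordRing r a :=
    mem_coordRing_of_mul_mem s.2 hs0 (by rw [mul_comm, hg']; exact b.2)
  refine ⟨⟨g, hmem⟩, ?_⟩
  rw [eq_div_iff (IsLocalization.to_map_ne_zero_of_mem_nonZeroDivisors _ le_rfl hs), ← map_mul]
  exact congrArg _ (Subtype.ext hg')

theorem originIdeal_isMaximal : (originIdeal r a).IsMaximal := by
  refine RingHom.ker_isMaximal_of_surjective _ fun c => ⟨algebraMap ℂ _ c, ?_⟩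
  exact constantCoeff_C _ c

theorem mem_originIdeal_iff (f : coordRing r a) :
    f ∈ originIdeal r a ↔ constantCoeff (f : MvPolynomial (Fin d) ℂ) = 0 :=
  Iff.rfl

/-- The coordinate ring is spanned by the invariant monomials. -/
theorem coordRing_induction (hr : r ≠ 0) {S : Type*} [AddCommMonoid S]
    (φ : coordRing r a →+ S) (N : AddSubmonoid S) (f : coordRing r a)
    (h : ∀ (m : Fin d →₀ ℕ) (hm : (r : ℤ) ∣ ∑ i, a i * m i),
      m ∈ (f : MvPolynomial (Fin d) ℂ).support → ∀ c : ℂ,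
      φ ⟨monomial m c, monomial_mem_coordRing hr hm c⟩ ∈ N) : φ f ∈ N := by
  have hf := (mem_coordRing_iff hr).1 f.2
  let g : {m // m ∈ (f : MvPolynomial (Fin d) ℂ).support} → coordRing r a := fun m =>
    ⟨monomial m.1 (coeff m.1 (f : MvPolynomial (Fin d) ℂ)),
      monomial_mem_coordRing hr (hf m.1 m.2) _⟩
  have hsum : f = ∑ m, g m := by
    apply Subtype.ext
    rw [AddSubmonoidClass.coe_finsetSum]
    simp only [g]
    rw [Finset.univ_eq_attach, Finset.sum_attach _ fun m =>
      monomial m (coeff m (f : MvPolynomial (Fin d) ℂ))]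
    exact (f : MvPolynomial (Fin d) ℂ).as_sum
  rw [hsum, map_sum]
  exact sum_mem fun m _ => h m.1 (hf m.1 m.2) m.2 _

end CoordRing

/-! ### Toric coordinates on the quotient -/

open MvPolynomial

/-- Toric coordinates `z i = x i * x i₀ ^ e i` on a cyclic quotient, for an index `i₀` whose weight
is prime to `r`. -/
structure ToricCoordinates {d : ℕ} (r : ℕ) (a : Fin d → ℤ) (i₀ : Fin d) where
  e : Fin d → ℕ
  e_self : e i₀ + 1 = r
  dvd : ∀ i, (r : ℤ) ∣ a i + e i * a i₀
  isCoprime : IsCoprime (r : ℤ) (a i₀)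
  z : Fin d → coordRing r a
  coe_z : ∀ i, (z i : MvPolynomial (Fin d) ℂ) = X i * X i₀ ^ e i

namespace ToricCoordinates

variable {d r : ℕ} {a : Fin d → ℤ} {i₀ : Fin d}

/-- Since a i₀ is invertible modulo r, the congruence for each exponent is solvable. At i₀ the
exponent is set to r - 1, rather than a smaller residue, so that z i₀ = x i₀ ^ r. -/
theorem nonempty (hr : r ≠ 0) (h : IsCoprime (r : ℤ) (a i₀)) :
    Nonempty (ToricCoordinates r a i₀) := by
  classical
  have h1 : ∀ i, ∃ e : ℕ, (r : ℤ) ∣ a i + e * a i₀ := by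
    intro i
    obtain ⟨u, v, huv⟩ := h
    refine ⟨((-(v * a i)) % r).toNat, ?_⟩
    rw [Int.toNat_of_nonneg (Int.emod_nonneg _ (by exact_mod_cast hr))]
    have h2 := Int.emod_add_mul_ediv (-(v * a i)) r
    refine ⟨u * a i - (-(v * a i)) / r * a i₀, ?_⟩
    linear_combination a i₀ * h2 - a i * huv
  choose e' he' using h1
  let e : Fin d → ℕ := fun i => if i = i₀ then r - 1 else e' i
  have he1 : e i₀ + 1 = r := by simp only [e, if_true]; omega
  have he : ∀ i, (r : ℤ) ∣ a i + e i * a i₀ := by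
    intro i
    by_cases hi : i = i₀
    · subst hi
      have : (e i : ℤ) = r - 1 := by rw [← he1]; push_cast; ring
      exact ⟨a i, by rw [this]; ring⟩
    · simpa [e, hi] using he' i
  have hz : ∀ i, (X i * X i₀ ^ e i : MvPolynomial (Fin d) ℂ) ∈ coordRing r a := by
    intro i
    have h2 : (X i * X i₀ ^ e i : MvPolynomial (Fin d) ℂ) =
        monomial (Finsupp.single i 1 + Finsupp.single i₀ (e i)) 1 := by
      rw [X_pow_eq_monomial, X, monomial_mul, one_mul]
    rw [h2]
    refine monomial_mem_coordRing hr ?_ 1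
    have h3 : ∑ j, a j * (((Finsupp.single i 1 + Finsupp.single i₀ (e i) : Fin d →₀ ℕ) j : ℕ) : ℤ)
        = a i + e i * a i₀ := by
      simp [Finsupp.single_apply, mul_add, Finset.sum_add_distrib, mul_comm]
    rw [h3]
    exact he i
  exact ⟨⟨e, he1, he, h, fun i => ⟨_, hz i⟩, fun _ => rfl⟩⟩

variable (c : ToricCoordinates r a i₀)

include c in
theorem r_ne_zero : r ≠ 0 := by
  have := c.e_self
  omega

theorem coe_z_self : (c.z i₀ : MvPolynomial (Fin d) ℂ) = X i₀ ^ r := by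
  rw [c.coe_z, ← pow_succ', c.e_self]

theorem z_ne_zero (i : Fin d) : c.z i ≠ 0 := by
  intro h
  have := congrArg Subtype.val h
  rw [c.coe_z] at this
  exact mul_ne_zero (X_ne_zero i) (pow_ne_zero _ (X_ne_zero i₀)) this

/-- The invariant function `x i ^ r`. -/
def xPow (i : Fin d) : coordRing r a := ⟨X i ^ r, X_pow_mem_coordRing c.r_ne_zero i⟩

theorem xPow_ne_zero (i : Fin d) : c.xPow i ≠ 0 := by
  intro h
  exact pow_ne_zero r (X_ne_zero i) (congrArg Subtype.val h)

theorem z_pow (i : Fin d) : c.z i ^ r = c.xPow i * c.z i₀ ^ c.e i := by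
  apply Subtype.ext
  push_cast
  rw [c.coe_z, c.coe_z_self, xPow]
  ring

/-- Multiplying by the unit a i₀ turns the sum into minus the weight of the monomial. The quotient
by r is the power of z i₀ to be divided out in `algebraMap_monomial`. -/
theorem dvd_sum_e (m : Fin d →₀ ℕ) (hm : (r : ℤ) ∣ ∑ i, a i * m i) :
    (r : ℤ) ∣ ∑ i, (c.e i : ℤ) * m i := by
  refine c.isCoprime.dvd_of_dvd_mul_left ?_
  have h1 : (r : ℤ) ∣ ∑ i, (a i + c.e i * a i₀) * m i :=
    Finset.dvd_sum fun i _ => (c.dvd i).mul_right _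
  have h2 : a i₀ * ∑ i, (c.e i : ℤ) * m i =
      ∑ i, (a i + c.e i * a i₀) * m i - ∑ i, a i * m i := by
    rw [Finset.mul_sum, ← Finset.sum_sub_distrib]
    exact Finset.sum_congr rfl fun i _ => by ring
  rw [h2]
  exact dvd_sub h1 hm

section Field

variable (F : Type*) [Field F] [Algebra (coordRing r a) F]

/-- The coordinates as rational functions. -/
def zF (i : Fin d) : F := algebraMap (coordRing r a) F (c.z i)

variable [IsFractionRing (coordRing r a) F]

theorem zF_ne_zero (i : Fin d) : c.zF F i ≠ 0 := by
  rw [zF, Ne, IsFractionRing.to_map_eq_zero_iff]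
  exact c.z_ne_zero i

/-- The exponents of the invariant monomial `x ^ m` in terms of the coordinates `z`. -/
theorem algebraMap_monomial (m : Fin d →₀ ℕ) (hm : (r : ℤ) ∣ ∑ i, a i * m i) :
    ∃ l : ℤ, ∑ i, (c.e i : ℤ) * m i = r * l ∧ 0 ≤ l ∧
      algebraMap (coordRing r a) F ⟨monomial m 1, monomial_mem_coordRing c.r_ne_zero hm 1⟩ =
        ∏ i, c.zF F i ^ ((m i : ℤ) - if i = i₀ then l else 0) := by
  have hr : (0 : ℤ) < r := by exact_mod_cast Nat.pos_of_ne_zero c.r_ne_zero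
  obtain ⟨l, hl⟩ := c.dvd_sum_e m hm
  have hl0 : 0 ≤ l := by
    have : 0 ≤ (r : ℤ) * l := hl ▸ Finset.sum_nonneg fun i _ => by positivity
    exact nonneg_of_mul_nonneg_right this hr
  lift l to ℕ using hl0
  refine ⟨l, hl, by positivity, ?_⟩
  have hl' : ∑ i, c.e i * m i = r * l := by exact_mod_cast hl
  have key : (⟨monomial m 1, monomial_mem_coordRing c.r_ne_zero hm 1⟩ : coordRing r a) *
      c.z i₀ ^ l = ∏ i, c.z i ^ m i := by
    apply Subtype.ext
    push_cast
    rw [c.coe_z_self, ← pow_mul, ← hl', monomial_eq, Finsupp.prod_fintype _ _ (by simp),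
      ← Finset.prod_pow_eq_pow_sum, map_one, one_mul, ← Finset.prod_mul_distrib]
    refine Finset.prod_congr rfl fun i _ => ?_
    rw [c.coe_z, mul_pow, ← pow_mul]
  have key2 := congrArg (algebraMap (coordRing r a) F) key
  rw [map_mul, map_pow, map_prod] at key2
  have h3 : ∏ i, c.zF F i ^ ((m i : ℤ) - if i = i₀ then (l : ℤ) else 0) =
      (∏ i, c.zF F i ^ m i) / c.zF F i₀ ^ l := by
    simp only [zpow_sub₀ (c.zF_ne_zero F _), Finset.prod_div_distrib, zpow_natCast]
    congr 1
    rw [Finset.prod_eq_single i₀]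
    · simp
    · intro j _ hj
      simp [hj]
    · simp
  rw [h3, eq_div_iff (pow_ne_zero _ (c.zF_ne_zero F _))]
  simpa [zF] using key2

variable [Algebra ℂ F] [IsScalarTower ℂ (coordRing r a) F]

omit [IsFractionRing (coordRing r a) F] in
include c in
/-- A subring of the function field containing the constants and the invariant monomials contains
the coordinate ring. -/
theorem algebraMap_mem_subring (R : Subring F) (hC : ∀ t : ℂ, algebraMap ℂ F t ∈ R)
    (h : ∀ (m : Fin d →₀ ℕ) (hm : (r : ℤ) ∣ ∑ i, a i * m i), algebraMap (coordRing r a) F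
      ⟨monomial m 1, monomial_mem_coordRing c.r_ne_zero hm 1⟩ ∈ R) (f : coordRing r a) :
    algebraMap (coordRing r a) F f ∈ R := by
  refine coordRing_induction c.r_ne_zero (algebraMap (coordRing r a) F : _ →+ F)
    R.toAddSubgroup.toAddSubmonoid f fun m hm _ t => ?_
  have h1 : (⟨monomial m t, monomial_mem_coordRing c.r_ne_zero hm t⟩ : coordRing r a) =
      algebraMap ℂ (coordRing r a) t *
        ⟨monomial m 1, monomial_mem_coordRing c.r_ne_zero hm 1⟩ := by
    apply Subtype.ext
    change _ = C t * monomial m 1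
    rw [C_mul_monomial, mul_one]
  change algebraMap (coordRing r a) F _ ∈ R
  rw [h1, map_mul, ← IsScalarTower.algebraMap_apply]
  exact mul_mem (hC t) (h m hm)

end Field

end ToricCoordinates

/-! ### Monomial coordinates adapted to a divisor, and the order of the coordinate form -/

namespace PrimeDivisorOver

variable {A : Type*} [CommRing A] {F : Type*} [Field F] [Algebra A F] [Algebra ℂ F] {n : ℕ}

theorem zpow_mem_coordSubring (E : PrimeDivisorOver A F) (t : Fin n → F) {i : Fin n}
    (hi : E.ord (t i) = 0) (k : ℤ) : t i ^ k ∈ E.coordSubring t := by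
  have h1 : t i ∈ E.coordSubring t := E.mem_coordSubring_self t (E.mem_of_ord_nonneg hi.ge)
  have h2 : (t i)⁻¹ ∈ E.coordSubring t :=
    E.inv_mem_coordSubring t h1 (E.mem_of_ord_nonneg (by rw [ord_inv, hi, neg_zero]))
  obtain ⟨k, rfl | rfl⟩ := k.eq_nat_or_neg
  · rw [zpow_natCast]
    exact pow_mem h1 k
  · rw [zpow_neg, zpow_natCast, ← inv_pow]
    exact pow_mem h2 k

/-- A monomial in the `z i` that is regular along `E` lies in the coordinate subring of the
monomials `y` given by a unimodular matrix adapted to `E`. -/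
theorem prod_zpow_mem_coordSubring (E : PrimeDivisorOver A F) (z : Fin n → F)
    (hz : ∀ i, z i ≠ 0) {U V : Matrix (Fin n) (Fin n) ℤ} (hVU : V * U = 1) (hUV : U * V = 1)
    {g : ℤ} (hg0 : 0 < g) {i₀ : Fin n} (hg : ∀ j, E.ord (z j) = g * U j i₀) (k : Fin n → ℤ)
    (hk : 0 ≤ E.ord (∏ j, z j ^ k j)) :
    ∏ j, z j ^ k j ∈ E.coordSubring fun i => ∏ j, z j ^ V i j := by
  set y : Fin n → F := fun i => ∏ j, z j ^ V i j with hy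
  have hy0 : ∀ i, y i ≠ 0 := fun i => Finset.prod_ne_zero_iff.2 fun j _ => zpow_ne_zero _ (hz j)
  have hordy : ∀ i, E.ord (y i) = if i = i₀ then g else 0 := E.ord_prod_zpow_inverse z hz hVU hg
  have hzy : ∀ j, z j = ∏ i, y i ^ U j i := fun j => by
    rw [prod_zpow_matrix_mul z hz, hUV, prod_zpow_one]
  have h1 : ∏ j, z j ^ k j = ∏ i, y i ^ ((Matrix.of fun _ : Fin n => k) * U) i₀ i := by
    rw [← prod_zpow_matrix_mul y hy0]
    exact Finset.prod_congr rfl fun j _ => by rw [← hzy]; rfl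
  set κ := ((Matrix.of fun _ : Fin n => k) * U) i₀
  rw [h1, E.ord_prod_zpow y hy0] at hk
  simp only [hordy, mul_ite, mul_zero, Finset.sum_ite_eq', Finset.mem_univ, if_true] at hk
  have hk0 : 0 ≤ κ i₀ := nonneg_of_mul_nonneg_left hk hg0
  rw [h1]
  refine prod_mem fun i _ => ?_
  by_cases hi : i = i₀
  · subst hi
    lift κ i to ℕ using hk0 with q
    rw [zpow_natCast]
    refine pow_mem (E.mem_coordSubring_self y (E.mem_of_ord_nonneg ?_)) q
    rw [hordy, if_pos rfl]
    exact hg0.le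
  · exact E.zpow_mem_coordSubring y (by rw [hordy, if_neg hi]) _

theorem formHasOrd_of_coordSubring (E : PrimeDivisorOver A F) (z : Fin n → F)
    (hz : ∀ i, z i ≠ 0) {U V : Matrix (Fin n) (Fin n) ℤ} (hVU : V * U = 1) (hUV : U * V = 1)
    {g : ℤ} (hg0 : 0 < g) {i₀ : Fin n} (hg : ∀ j, E.ord (z j) = g * U j i₀)
    (h : ∀ f ∈ E.ring, f ∈ E.coordSubring fun i => ∏ j, z j ^ V i j) :
    E.FormHasOrd (exteriorPower.ιMulti F n fun i => KaehlerDifferential.D ℂ F (z i))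
      (∑ i, E.ord (z i) - g) := by
  set y : Fin n → F := fun i => ∏ j, z j ^ V i j with hy
  have hy0 : ∀ i, y i ≠ 0 := fun i => Finset.prod_ne_zero_iff.2 fun j _ => zpow_ne_zero _ (hz j)
  have hordy : ∀ i, E.ord (y i) = if i = i₀ then g else 0 := E.ord_prod_zpow_inverse z hz hVU hg
  have hzy : ∀ j, z j = ∏ i, y i ^ U j i := fun j => by
    rw [prod_zpow_matrix_mul z hz, hUV, prod_zpow_one]
  have hdet : IsUnit U.det := by
    have := congrArg Matrix.det hUV
    rw [Matrix.det_mul, Matrix.det_one] at this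
    exact IsUnit.of_mul_eq_one _ this
  have hdet0 : (U.det : F) ≠ 0 := by
    rcases Int.isUnit_iff.1 hdet with h | h <;> rw [h] <;> simp
  have horddet : E.ord (U.det : F) = 0 := by
    have h2 : (U.det : F) * (U.det : F) = 1 := by
      rcases Int.isUnit_iff.1 hdet with h | h <;> rw [h] <;> simp
    have h3 := E.ord_mul hdet0 hdet0
    rw [h2, ord_one] at h3
    omega
  have hz0 : (∏ j, z j) ≠ 0 := Finset.prod_ne_zero_iff.2 fun j _ => hz j
  have hyy0 : (∏ j, y j) ≠ 0 := Finset.prod_ne_zero_iff.2 fun j _ => hy0 j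
  refine ⟨exteriorPower.ιMulti F n fun i => KaehlerDifferential.D ℂ F (y i),
    (∏ j, z j) * (∏ i, y i)⁻¹ * (U.det : F), by positivity,
    E.regularForms_eq_span y (fun i => E.mem_of_ord_nonneg ?_) h,
    ιMulti_D_prod_zpow z y hy0 U hzy, ?_⟩
  · rw [hordy]; split_ifs <;> omega
  · rw [E.ord_mul (by positivity) hdet0, E.ord_mul hz0 (inv_ne_zero hyy0), ord_inv, horddet,
      E.ord_prod _ _ fun i _ => hz i, E.ord_prod _ _ fun i _ => hy0 i]
    simp only [hordy, Finset.sum_ite_eq', Finset.mem_univ, if_true]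
    ring

end PrimeDivisorOver

namespace ToricCoordinates

open MvPolynomial

variable {d r : ℕ} {a : Fin d → ℤ} {i₀ : Fin d} (c : ToricCoordinates r a i₀)
  {F : Type*} [Field F] [Algebra (coordRing r a) F] [IsFractionRing (coordRing r a) F]

section Order

variable (E : PrimeDivisorOver (coordRing r a) F)

/-- The variable x i is not a function on the quotient, but ord (x i ^ r) / r serves as its order.
This relation translates between these rational orders and the integral orders of the z i. -/
theorem ord_xPow (i : Fin d) :
    r * E.ord (c.zF F i) = E.ord (algebraMap _ F (c.xPow i)) + c.e i * E.ord (c.zF F i₀) := by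
  have h := congrArg (algebraMap (coordRing r a) F) (c.z_pow i)
  rw [map_mul, map_pow, map_pow] at h
  change c.zF F i ^ r = _ * c.zF F i₀ ^ c.e i at h
  have hx : algebraMap (coordRing r a) F (c.xPow i) ≠ 0 := by
    rw [Ne, IsFractionRing.to_map_eq_zero_iff]
    exact c.xPow_ne_zero i
  have h2 := congrArg E.ord h
  rwa [E.ord_mul hx (pow_ne_zero _ (c.zF_ne_zero F i₀)), E.ord_pow, E.ord_pow] at h2

/-- If a prime of height one contains `z i₀`, it is the ideal of functions vanishing on
the image of the hyperplane `x i₀ = 0`. -/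
theorem xPow_notMem_of_height_eq_one (p : Ideal (coordRing r a)) [hp : p.IsPrime]
    (h1 : p.height = 1) (hz : c.z i₀ ∈ p) {j : Fin d} (hj : j ≠ i₀) : c.xPow j ∉ p := by
  have := isNoetherianRing_coordRing (a := a) c.r_ne_zero
  let q : Ideal (coordRing r a) :=
    (Ideal.span {(X i₀ : MvPolynomial (Fin d) ℂ)}).comap (coordRing r a).val.toRingHom
  have hX : (Ideal.span {(X i₀ : MvPolynomial (Fin d) ℂ)}).IsPrime :=
    (Ideal.span_singleton_prime (X_ne_zero i₀)).2 X_prime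
  have hq : q.IsPrime := Ideal.comap_isPrime _ _
  have hmem : ∀ f : coordRing r a, f ∈ q ↔ (X i₀ : MvPolynomial (Fin d) ℂ) ∣ f := fun f =>
    Ideal.mem_span_singleton
  -- If x i₀ divides an invariant f with quotient f', then f ^ r is z i₀ times the invariant f' ^ r,
  -- hence in p. Comparing heights then gives q = p.
  have hqp : q ≤ p := by
    intro f hf
    obtain ⟨f', hf'⟩ := (hmem f).1 hf
    have h2 : (f' ^ r : MvPolynomial (Fin d) ℂ) ∈ coordRing r a := by
      refine mem_coordRing_of_mul_mem (c.z i₀).2 (by simpa using c.z_ne_zero i₀) ?_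
      rw [c.coe_z_self, ← mul_pow, ← hf']
      exact pow_mem f.2 r
    refine hp.mem_of_pow_mem r ?_
    have h3 : f ^ r = c.z i₀ * ⟨f' ^ r, h2⟩ := by
      apply Subtype.ext
      push_cast
      rw [c.coe_z_self, ← mul_pow, ← hf']
    rw [h3]
    exact p.mul_mem_right _ hz
  have hq0 : q ≠ ⊥ := by
    intro h
    have : c.z i₀ ∈ q := (hmem _).2 (by
      rw [c.coe_z_self]; exact dvd_pow_self _ c.r_ne_zero)
    rw [h, Ideal.mem_bot] at this
    exact c.z_ne_zero i₀ this
  have hqp' : q = p := by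
    by_contra hne
    have h2 := Ideal.height_strict_mono_of_isPrime (lt_of_le_of_ne hqp hne)
    rw [h1, Order.lt_one_iff, Ideal.height_eq_zero_iff_eq_bot] at h2
    exact hq0 h2
  rw [← hqp', hmem]
  intro h
  have h2 := (X_prime (R := ℂ) (i := i₀)).dvd_of_dvd_pow (h : X i₀ ∣ X j ^ r)
  rw [X_dvd_X] at h2
  exact hj h2.symm

end Order

variable [Algebra ℂ F] [IsScalarTower ℂ (coordRing r a) F]

variable (F) in
/-- The form `dz_1 ∧ … ∧ dz_d`. -/
def form : ⋀[F]^d Ω[F⁄ℂ] :=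
  exteriorPower.ιMulti F d fun i => KaehlerDifferential.D ℂ F (c.zF F i)

/-- The order of `dz_1 ∧ … ∧ dz_d` along the prime divisors of the quotient, when some weight other
than that of `i₀` is prime to `r`. -/
theorem exists_formHasOrd_of_height_eq_one {i₁ : Fin d} (hi : i₁ ≠ i₀)
    (hcop : IsCoprime (r : ℤ) (a i₁)) (D : PrimeDivisorOver (coordRing r a) F)
    (h1 : D.center.height = 1) :
    ∃ k : ℤ, D.FormHasOrd (c.form F) k ∧ r * k = (∑ i, (c.e i : ℤ)) * D.ord (c.zF F i₀) := by
  have := isNoetherianRing_coordRing (a := a) c.r_ne_zero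
  have := isIntegrallyClosed_coordRing (r := r) (a := a)
  have : FaithfulSMul (coordRing r a) F := IsFractionRing.instFaithfulSMul _ _
  have hprime := D.center_isPrime
  have hring := D.mem_ring_iff_of_height_center_eq_one h1
  have hz0 := c.zF_ne_zero F
  have hfrac : ∀ t : Fin d → F, (∀ f, algebraMap (coordRing r a) F f ∈ D.coordSubring t) →
      ∀ f ∈ D.ring, f ∈ D.coordSubring t := by
    intro t ht
    refine D.mem_coordSubring_of_fractions t fun f hf => ?_
    obtain ⟨b, s, hs, rfl⟩ := (hring f).1 hf
    refine ⟨_, _, ht b, ht s, D.mem_of_ord_nonneg ?_, rfl⟩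
    rw [D.ord_inv, D.ord_algebraMap_eq_zero hs, neg_zero]
  -- Either D is the image of the hyperplane x i₀ = 0, or z i₀ is a unit along D.
  by_cases hz : c.z i₀ ∈ D.center
  · have hx : ∀ j, j ≠ i₀ → r * D.ord (c.zF F j) = c.e j * D.ord (c.zF F i₀) := by
      intro j hj
      rw [c.ord_xPow D j, D.ord_algebraMap_eq_zero
        (c.xPow_notMem_of_height_eq_one D.center h1 hz hj), zero_add]
    have hpos : 0 < D.ord (c.zF F i₀) := (D.ord_algebraMap_pos_iff (c.z_ne_zero i₀)).2 hz
    obtain ⟨U, V, g, hVU, hUV, hg0, hg⟩ := exists_unimodular (fun j => D.ord (c.zF F j))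
      (fun h => hpos.ne' (congrFun h i₀)) i₀
    have hg' : ∀ j, D.ord (c.zF F j) = g * U j i₀ := hg
    have hr : (0 : ℤ) < r := by exact_mod_cast Nat.pos_of_ne_zero c.r_ne_zero
    have hU : ∀ j, j ≠ i₀ → r * U j i₀ = c.e j * U i₀ i₀ := by
      intro j hj
      have := hx j hj
      rw [hg', hg'] at this
      exact mul_left_cancel₀ hg0.ne' (by linear_combination this)
    have hcop' : IsCoprime (r : ℤ) (c.e i₁) := by
      have h2 : IsCoprime (r : ℤ) (c.e i₁ * a i₀) := by
        obtain ⟨q, hq⟩ := c.dvd i₁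
        have : (c.e i₁ * a i₀ : ℤ) = -a i₁ + r * q := by linear_combination hq
        rw [this]
        exact (hcop.neg_right).add_mul_left_right q
      exact h2.of_mul_right_left
    -- The second weight prime to r enters here: it rules out ramification along x i₀ = 0.
    obtain ⟨q, hq⟩ : (r : ℤ) ∣ U i₀ i₀ :=
      hcop'.dvd_of_dvd_mul_left ⟨U i₁ i₀, (hU i₁ hi).symm⟩
    have hq0 : 0 < q := by
      rw [hg', hq] at hpos
      have h3 := pos_of_mul_pos_right hpos hg0.le
      exact pos_of_mul_pos_right h3 hr.le
    have hdvd : ∀ j, q ∣ U j i₀ := by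
      intro j
      by_cases hj : j = i₀
      · rw [hj, hq]; exact dvd_mul_left _ _
      · have := hU j hj
        rw [hq] at this
        exact ⟨c.e j, mul_left_cancel₀ hr.ne' (by linear_combination this)⟩
    -- q divides a whole column of a unimodular matrix, so it is 1 and z i₀ has order exactly r g.
    have hq1 : q = 1 := by
      have h3 : (V * U) i₀ i₀ = 1 := by rw [hVU]; simp
      rw [Matrix.mul_apply] at h3
      have h4 : q ∣ 1 := h3 ▸ Finset.dvd_sum fun j _ => (hdvd j).mul_left _
      exact Int.eq_one_of_dvd_one hq0.le h4
    refine ⟨_, D.formHasOrd_of_coordSubring (c.zF F) hz0 hVU hUV hg0 hg' (hfrac _ ?_), ?_⟩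
    · refine c.algebraMap_mem_subring F _ (D.algebraMap_mem_coordSubring _) fun m hm => ?_
      obtain ⟨l, -, -, h⟩ := c.algebraMap_monomial F m hm
      rw [h]
      refine D.prod_zpow_mem_coordSubring _ hz0 hVU hUV hg0 hg' _ ?_
      rw [← h]
      exact D.ord_algebraMap_nonneg _
    · have h5 : ∀ j, r * D.ord (c.zF F j) =
          c.e j * D.ord (c.zF F i₀) + if j = i₀ then r * g else 0 := by
        intro j
        by_cases hj : j = i₀
        · have h6 : (c.e i₀ : ℤ) = r - 1 := by
            have := c.e_self
            omega
          rw [hj, if_pos rfl, h6, hg', hq, hq1]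
          ring
        · rw [if_neg hj, add_zero, hx j hj]
      rw [mul_sub, Finset.mul_sum, Finset.sum_congr rfl fun j _ => h5 j, Finset.sum_add_distrib,
        ← Finset.sum_mul]
      simp
  · have hord0 : D.ord (c.zF F i₀) = 0 := D.ord_algebraMap_eq_zero hz
    have hmem : ∀ i, c.zF F i ∈ D.ring := fun i => D.algebraMap_mem _
    refine ⟨0, ⟨_, 1, one_ne_zero, D.regularForms_eq_span (c.zF F) hmem (hfrac _ ?_),
      by rw [one_smul, form], D.ord_one⟩, by rw [hord0]; ring⟩
    -- Only z i₀ can occur with negative exponent in an invariant monomial, and here it is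
    -- invertible, so the z i themselves serve as coordinates.
    refine c.algebraMap_mem_subring F _ (D.algebraMap_mem_coordSubring _) fun m hm => ?_
    obtain ⟨l, -, hl, h⟩ := c.algebraMap_monomial F m hm
    rw [h]
    refine prod_mem fun i _ => ?_
    by_cases hi : i = i₀
    · rw [hi]
      exact D.zpow_mem_coordSubring _ hord0 _
    · rw [if_neg hi, sub_zero, zpow_natCast]
      exact pow_mem (D.mem_coordSubring_self _ (hmem i)) _

/-- The coordinate form spans the rational forms of top degree. -/
theorem exists_eq_smul_form (ω : ⋀[F]^d Ω[F⁄ℂ]) : ∃ h : F, ω = h • c.form F := by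
  let N : Submodule F (Ω[F⁄ℂ]) :=
    Submodule.span F (Set.range fun i => KaehlerDifferential.D ℂ F (c.zF F i))
  -- The functions whose differential lies in the span of the dz i are closed under inverses and
  -- contain the coordinate ring, hence fill the function field.
  let R : Subring F :=
    { carrier := {g | KaehlerDifferential.D ℂ F g ∈ N}
      mul_mem' := fun {x y} hx hy => by
        change KaehlerDifferential.D ℂ F (x * y) ∈ N
        rw [Derivation.leibniz]
        exact add_mem (N.smul_mem _ hy) (N.smul_mem _ hx)
      one_mem' := by simp
      add_mem' := fun {x y} hx hy => by
        change KaehlerDifferential.D ℂ F (x + y) ∈ N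
        rw [map_add]
        exact add_mem hx hy
      zero_mem' := by simp
      neg_mem' := fun {x} hx => by
        change KaehlerDifferential.D ℂ F (-x) ∈ N
        rw [map_neg]
        exact neg_mem hx }
  have hinv : ∀ g ∈ R, g⁻¹ ∈ R := fun g hg => by
    change KaehlerDifferential.D ℂ F g⁻¹ ∈ N
    rw [Derivation.leibniz_inv]
    exact N.smul_mem _ hg
  have hzR : ∀ i (k : ℤ), c.zF F i ^ k ∈ R := fun i k => by
    have h1 : c.zF F i ∈ R := Submodule.subset_span ⟨i, rfl⟩
    obtain ⟨k, rfl | rfl⟩ := k.eq_nat_or_neg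
    · rw [zpow_natCast]
      exact pow_mem h1 k
    · rw [zpow_neg, zpow_natCast]
      exact hinv _ (pow_mem h1 k)
  have hA : ∀ f, algebraMap (coordRing r a) F f ∈ R := by
    refine c.algebraMap_mem_subring F R (fun t => ?_) fun m hm => ?_
    · change KaehlerDifferential.D ℂ F _ ∈ N
      simp
    · obtain ⟨l, -, -, h⟩ := c.algebraMap_monomial F m hm
      rw [h]
      exact prod_mem fun i _ => hzR i _
  have hR : ∀ f : F, KaehlerDifferential.D ℂ F f ∈ N := by
    intro f
    obtain ⟨b, s, -, rfl⟩ := IsFractionRing.div_surjective (coordRing r a) f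
    change _ ∈ R
    rw [div_eq_mul_inv]
    exact mul_mem (hA b) (hinv _ (hA s))
  have hN : N = ⊤ := by
    rw [eq_top_iff, ← KaehlerDifferential.span_range_derivation, Submodule.span_le]
    rintro _ ⟨f, rfl⟩
    exact hR f
  have hω : ω ∈ Submodule.span F {c.form F} := by
    have h1 : (⊤ : Submodule F (⋀[F]^d Ω[F⁄ℂ])) ≤ Submodule.span F {c.form F} := by
      rw [← exteriorPower.ιMulti_span, Submodule.span_le]
      rintro _ ⟨v, rfl⟩
      have h2 : ∀ j, ∃ M : Fin d → F, ∑ i, M i • KaehlerDifferential.D ℂ F (c.zF F i) = v j :=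
        fun j => (Submodule.mem_span_range_iff_exists_fun F).1 (hN.ge Submodule.mem_top)
      choose M hM using h2
      have h3 : v = fun j => ∑ i, (Matrix.of M) j i • KaehlerDifferential.D ℂ F (c.zF F i) :=
        funext fun j => (hM j).symm
      rw [h3, ιMulti_sum_smul]
      exact Submodule.smul_mem _ _ (Submodule.mem_span_singleton_self _)
    exact h1 Submodule.mem_top
  obtain ⟨h, hh⟩ := Submodule.mem_span_singleton.1 hω
  exact ⟨h, hh.symm⟩

end ToricCoordinates

/-! ### Independence of Laurent monomials and nonvanishing of the coordinate form -/

namespace ToricCoordinates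

open MvPolynomial

variable {d r : ℕ} {a : Fin d → ℤ} {i₀ : Fin d} (c : ToricCoordinates r a i₀)
  {F : Type*} [Field F] [Algebra (coordRing r a) F] [IsFractionRing (coordRing r a) F]
  [Algebra ℂ F] [IsScalarTower ℂ (coordRing r a) F]

/-- The exponents in the variables `x` of a monomial in the coordinates `z`. -/
def xExponent (m : Fin d →₀ ℕ) : Fin d →₀ ℕ :=
  m + Finsupp.single i₀ (∑ i, c.e i * m i)

theorem xExponent_injective : Function.Injective c.xExponent := by
  intro m n h
  have h0 : ∀ i, m i + (if i = i₀ then ∑ j, c.e j * m j else 0) =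
      n i + (if i = i₀ then ∑ j, c.e j * n j else 0) := by
    intro i
    have := DFunLike.congr_fun h i
    simpa [xExponent, Finsupp.single_apply, eq_comm] using this
  have h1 : ∀ i, i ≠ i₀ → m i = n i := fun i hi => by simpa [hi] using h0 i
  have h2 := h0 i₀
  simp only [if_true] at h2
  rw [← Finset.add_sum_erase _ _ (Finset.mem_univ i₀),
    ← Finset.add_sum_erase (s := Finset.univ) (f := fun j => c.e j * n j) (Finset.mem_univ i₀),
    Finset.sum_congr rfl fun j hj => by rw [h1 j (Finset.ne_of_mem_erase hj)]] at h2
  have h3 : m i₀ + c.e i₀ * m i₀ = n i₀ + c.e i₀ * n i₀ := by omega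
  have h4 : (1 + c.e i₀) * m i₀ = (1 + c.e i₀) * n i₀ := by linarith
  ext i
  by_cases hi : i = i₀
  · rw [hi]
    exact Nat.eq_of_mul_eq_mul_left (by omega) h4
  · exact h1 i hi

theorem prod_coe_z_pow (m : Fin d →₀ ℕ) :
    ∏ i, (c.z i : MvPolynomial (Fin d) ℂ) ^ m i = monomial (c.xExponent m) 1 := by
  have h : monomial (c.xExponent m) (1 : ℂ) =
      monomial m 1 * X i₀ ^ (∑ i, c.e i * m i) := by
    rw [xExponent, X_pow_eq_monomial, monomial_mul, one_mul]
  rw [h, monomial_eq, Finsupp.prod_fintype _ _ (by simp), ← Finset.prod_pow_eq_pow_sum, map_one,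
    one_mul, ← Finset.prod_mul_distrib]
  exact Finset.prod_congr rfl fun i _ => by rw [c.coe_z, mul_pow, ← pow_mul]

variable (F) in
/-- The Laurent monomials in the coordinates are linearly independent. -/
theorem linearIndependent_prod_zpow :
    LinearIndependent ℂ fun k : Fin d → ℤ => ∏ i, c.zF F i ^ k i := by
  rw [linearIndependent_iff']
  intro s g hg
  -- A common power of all z i clears the negative exponents, so that the relation becomes one
  -- between distinct polynomial monomials in x.
  obtain ⟨N, hN⟩ : ∃ N : ℕ, ∀ k ∈ s, ∀ i, 0 ≤ k i + N := by
    refine ⟨∑ k ∈ s, ∑ i, (k i).natAbs, fun k hk i => ?_⟩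
    have h1 : (k i).natAbs ≤ ∑ i, (k i).natAbs :=
      Finset.single_le_sum (f := fun i => (k i).natAbs) (fun _ _ => Nat.zero_le _)
        (Finset.mem_univ i)
    have h2 : ∑ i, (k i).natAbs ≤ ∑ k ∈ s, ∑ i, (k i).natAbs :=
      Finset.single_le_sum (f := fun k : Fin d → ℤ => ∑ i, (k i).natAbs)
        (fun _ _ => Nat.zero_le _) hk
    omega
  let T : (Fin d → ℤ) → (Fin d →₀ ℕ) := fun k =>
    Finsupp.equivFunOnFinite.symm fun i => (k i + N).toNat
  have hT : ∀ k i, T k i = (k i + N).toNat := fun k i => rfl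
  have hsum : ∑ k ∈ s, g k • (monomial (c.xExponent (T k)) (1 : ℂ)) = 0 := by
    have h1 : ∑ k ∈ s, g k • ∏ i, c.z i ^ T k i = 0 := by
      refine IsFractionRing.injective (coordRing r a) F ?_
      rw [map_sum, map_zero, ← mul_zero (∏ i, c.zF F i ^ (N : ℤ)), ← hg, Finset.mul_sum]
      refine Finset.sum_congr rfl fun k hk => ?_
      rw [Algebra.smul_def, map_mul, ← IsScalarTower.algebraMap_apply, ← Algebra.smul_def, map_prod,
        mul_smul_comm]
      congr 1
      rw [← Finset.prod_mul_distrib]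
      refine Finset.prod_congr rfl fun i _ => ?_
      rw [← zpow_add₀ (c.zF_ne_zero F i), map_pow, hT, ← zpow_natCast,
        Int.toNat_of_nonneg (hN k hk i), add_comm]
      rfl
    have h2 := congrArg Subtype.val h1
    simpa [prod_coe_z_pow] using h2
  intro k hk
  have h3 := congrArg (coeff (c.xExponent (T k))) hsum
  rw [coeff_sum, Finset.sum_eq_single k] at h3
  · simpa using h3
  · intro k' hk' hne
    rw [coeff_smul, coeff_monomial, if_neg, smul_zero]
    intro h
    refine hne (funext fun i => ?_)
    have h4 := DFunLike.congr_fun (c.xExponent_injective h) i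
    rw [hT, hT] at h4
    have h5 := hN k hk i
    have h6 := hN k' hk' i
    omega
  · exact fun h => absurd hk h

section Change

variable {V U : Matrix (Fin d) (Fin d) ℤ}

/-- Since V has a right inverse, distinct monomials in the new coordinates are distinct Laurent
monomials in z, and these are independent. -/
theorem aeval_prod_zpow_injective (hVU : V * U = 1) :
    Function.Injective (aeval (R := ℂ) fun i => ∏ j, c.zF F j ^ V i j) := by
  have hli : LinearIndependent ℂ fun m : Fin d →₀ ℕ =>
      ∏ j, c.zF F j ^ (∑ i, (m i : ℤ) * V i j) := by
    refine (c.linearIndependent_prod_zpow F).comp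
      (fun (m : Fin d →₀ ℕ) j => ∑ i, (m i : ℤ) * V i j) fun m n h => ?_
    ext i
    have h1 : ∀ m : Fin d →₀ ℕ, Matrix.vecMul (fun i => (m i : ℤ)) V =
        fun j => ∑ i, (m i : ℤ) * V i j := fun m => by
      ext j; simp [Matrix.vecMul, dotProduct]
    have h2 : Matrix.vecMul (fun i => (m i : ℤ)) V = Matrix.vecMul (fun i => (n i : ℤ)) V := by
      rw [h1, h1]; exact h
    have h3 := congrArg (fun x => Matrix.vecMul x U) h2
    simp only [Matrix.vecMul_vecMul, hVU, Matrix.vecMul_one] at h3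
    exact_mod_cast congrFun h3 i
  rw [injective_iff_map_eq_zero]
  intro p hp
  have h1 : aeval (R := ℂ) (fun i => ∏ j, c.zF F j ^ V i j) p =
      ∑ m ∈ p.support, coeff m p • ∏ j, c.zF F j ^ (∑ i, (m i : ℤ) * V i j) := by
    rw [aeval_def, eval₂_eq']
    refine Finset.sum_congr rfl fun m _ => ?_
    rw [Algebra.smul_def]
    congr 1
    simp only [← Finset.prod_pow]
    rw [Finset.prod_comm]
    refine Finset.prod_congr rfl fun j _ => ?_
    have h2 : ∀ s : Finset (Fin d), ∏ i ∈ s, (c.zF F j ^ V i j) ^ m i =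
        c.zF F j ^ (∑ i ∈ s, (m i : ℤ) * V i j) := by
      intro s
      induction s using Finset.induction_on with
      | empty => simp
      | insert i s hi ih =>
        rw [Finset.prod_insert hi, Finset.sum_insert hi, zpow_add₀ (c.zF_ne_zero F j), ih,
          mul_comm (m i : ℤ), zpow_mul, zpow_natCast]
    exact h2 _
  rw [h1] at hp
  have h2 := linearIndependent_iff'.1 hli p.support (fun m => coeff m p) hp
  ext m
  by_cases hm : m ∈ p.support
  · rw [h2 m hm, coeff_zero]
  · rw [notMem_support_iff.1 hm, coeff_zero]

/-- U V = 1 recovers the z i as monomials in the new coordinates, which therefore also generate the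
function field. -/
theorem exists_eq_aeval_div (hUV : U * V = 1) (f : F) : ∃ p q : MvPolynomial (Fin d) ℂ,
    f = aeval (fun i => ∏ j, c.zF F j ^ V i j) p / aeval (fun i => ∏ j, c.zF F j ^ V i j) q := by
  set y : Fin d → F := fun i => ∏ j, c.zF F j ^ V i j with hy
  rw [← IntermediateField.mem_adjoin_range_iff]
  have hzy : ∀ j, c.zF F j = ∏ i, y i ^ U j i := fun j => by
    rw [prod_zpow_matrix_mul _ (c.zF_ne_zero F), hUV, prod_zpow_one]
  have hyL : ∀ i, y i ∈ IntermediateField.adjoin ℂ (Set.range y) := fun i =>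
    IntermediateField.subset_adjoin _ _ ⟨i, rfl⟩
  have hzL : ∀ j, c.zF F j ∈ IntermediateField.adjoin ℂ (Set.range y) := fun j => by
    rw [hzy j]
    exact prod_mem fun i _ => zpow_mem (hyL i) _
  have hA : ∀ f, algebraMap (coordRing r a) F f ∈ IntermediateField.adjoin ℂ (Set.range y) := by
    refine c.algebraMap_mem_subring F
      (IntermediateField.adjoin ℂ (Set.range y)).toSubring
      (fun t => (IntermediateField.adjoin ℂ (Set.range y)).algebraMap_mem t)
      fun m hm => ?_
    obtain ⟨l, -, -, h⟩ := c.algebraMap_monomial F m hm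
    rw [h]
    exact prod_mem fun i _ => zpow_mem (hzL i) _
  obtain ⟨b, s, -, rfl⟩ := IsFractionRing.div_surjective (coordRing r a) f
  exact div_mem (hA b) (hA s)

end Change

variable (F) in
-- The function field is the fraction field of a polynomial ring in the z i. The dz i are thus a
-- basis of the differentials, and the determinant in that basis detects their wedge.
theorem form_ne_zero : c.form F ≠ 0 := by
  let y : Fin d → F := fun i => ∏ j, c.zF F j ^ (1 : Matrix (Fin d) (Fin d) ℤ) i j
  have hy : y = c.zF F := funext fun i => prod_zpow_one _ i
  let : Algebra (MvPolynomial (Fin d) ℂ) F := (aeval y).toRingHom.toAlgebra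
  have hmap : ∀ p, algebraMap (MvPolynomial (Fin d) ℂ) F p = aeval y p := fun _ => rfl
  have : IsScalarTower ℂ (MvPolynomial (Fin d) ℂ) F :=
    IsScalarTower.of_algebraMap_eq fun t => ((aeval y).commutes t).symm
  have : FaithfulSMul (MvPolynomial (Fin d) ℂ) F :=
    (faithfulSMul_iff_algebraMap_injective _ _).2 (c.aeval_prod_zpow_injective (mul_one 1))
  have : IsFractionRing (MvPolynomial (Fin d) ℂ) F :=
    IsFractionRing.of_field _ _ fun f => by
      obtain ⟨p, q, h⟩ := c.exists_eq_aeval_div (mul_one 1) f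
      exact ⟨p, q, h⟩
  let b : Module.Basis (Fin d) F (Ω[F⁄ℂ]) :=
    (KaehlerDifferential.mvPolynomialBasis ℂ (Fin d)).ofIsLocalizedModule F
      (nonZeroDivisors (MvPolynomial (Fin d) ℂ))
      (KaehlerDifferential.map ℂ ℂ (MvPolynomial (Fin d) ℂ) F)
  have hb : ∀ i, b i = KaehlerDifferential.D ℂ F (c.zF F i) := by
    intro i
    simp only [b, Module.Basis.ofIsLocalizedModule_apply,
      KaehlerDifferential.mvPolynomialBasis_apply, KaehlerDifferential.map_D, hmap, aeval_X, hy]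
  intro h
  have h1 := congrArg (exteriorPower.alternatingMapLinearEquiv b.det) h
  have h2 : (fun i => KaehlerDifferential.D ℂ F (c.zF F i)) = b := funext fun i => (hb i).symm
  rw [form, h2, exteriorPower.alternatingMapLinearEquiv_apply_ιMulti, b.det_self, map_zero] at h1
  exact one_ne_zero h1

end ToricCoordinates

open MvPolynomial

/-! ### The boundary divisor of a smooth toric chart -/

section Chart

variable {F : Type*} [Field F] [Algebra ℂ F] {d : ℕ}

/-- The ring of regular functions on the toric chart with coordinates `y` in which `y k` is
invertible for `k ≠ i₀`. -/
def chartRing (y : Fin d → F) (i₀ : Fin d) : Subalgebra ℂ F :=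
  Algebra.adjoin ℂ (Set.range y ∪ (fun k => (y k)⁻¹) '' {k | k ≠ i₀})

/-- The product of the invertible coordinates. -/
def chartUnit (i₀ : Fin d) : MvPolynomial (Fin d) ℂ := ∏ k ∈ Finset.univ.erase i₀, X k

variable {y : Fin d → F} {i₀ : Fin d}

theorem self_mem_chartRing (k : Fin d) : y k ∈ chartRing y i₀ :=
  Algebra.subset_adjoin (Or.inl ⟨k, rfl⟩)

theorem inv_mem_chartRing {k : Fin d} (hk : k ≠ i₀) : (y k)⁻¹ ∈ chartRing y i₀ :=
  Algebra.subset_adjoin (Or.inr ⟨k, hk, rfl⟩)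

theorem zpow_mem_chartRing {k : Fin d} (hk : k ≠ i₀) (n : ℤ) : y k ^ n ∈ chartRing y i₀ := by
  obtain ⟨n, rfl | rfl⟩ := n.eq_nat_or_neg
  · rw [zpow_natCast]
    exact pow_mem (self_mem_chartRing k) n
  · rw [zpow_neg, zpow_natCast, ← inv_pow]
    exact pow_mem (inv_mem_chartRing hk) n

theorem aeval_mem_chartRing (p : MvPolynomial (Fin d) ℂ) : aeval y p ∈ chartRing y i₀ := by
  have h : aeval y p ∈ (aeval (R := ℂ) y).range := ⟨p, rfl⟩
  rw [← Algebra.adjoin_range_eq_range_aeval] at h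
  exact Algebra.adjoin_mono Set.subset_union_left h

theorem mem_chartRing_iff (hy : ∀ i, y i ≠ 0) (f : F) :
    f ∈ chartRing y i₀ ↔ ∃ (p : MvPolynomial (Fin d) ℂ) (n : ℕ),
      f = aeval y p * (aeval y (chartUnit i₀ ^ n))⁻¹ := by
  have hu0 : aeval y (chartUnit i₀) ≠ 0 := by
    rw [chartUnit, map_prod]
    simp [Finset.prod_ne_zero_iff, hy]
  constructor
  · intro hf
    induction hf using Algebra.adjoin_induction with
    | mem x hx =>
      rcases hx with ⟨k, rfl⟩ | ⟨k, hk, rfl⟩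
      · exact ⟨X k, 0, by simp⟩
      · refine ⟨∏ j ∈ (Finset.univ.erase i₀).erase k, X j, 1, ?_⟩
        have h1 : chartUnit i₀ = X k * ∏ j ∈ (Finset.univ.erase i₀).erase k, X j :=
          (Finset.mul_prod_erase _ _ (by simpa using hk)).symm
        have h2 : aeval y (∏ j ∈ (Finset.univ.erase i₀).erase k,
            (X j : MvPolynomial (Fin d) ℂ)) ≠ 0 := by
          rw [map_prod]
          simp [Finset.prod_ne_zero_iff, hy]
        rw [pow_one, h1, map_mul, aeval_X, mul_inv, mul_comm (y k)⁻¹, mul_inv_cancel_left₀ h2]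
    | algebraMap t => exact ⟨C t, 0, by simp⟩
    | add f g _ _ hf hg =>
      obtain ⟨p, n, rfl⟩ := hf
      obtain ⟨q, m, rfl⟩ := hg
      refine ⟨p * chartUnit i₀ ^ m + q * chartUnit i₀ ^ n, n + m, ?_⟩
      simp only [map_add, map_mul, map_pow, pow_add]
      field_simp
    | mul f g _ _ hf hg =>
      obtain ⟨p, n, rfl⟩ := hf
      obtain ⟨q, m, rfl⟩ := hg
      refine ⟨p * q, n + m, ?_⟩
      simp only [map_mul, map_pow, pow_add]
      field_simp
  · rintro ⟨p, n, rfl⟩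
    refine mul_mem (aeval_mem_chartRing p) ?_
    rw [map_pow, ← inv_pow, chartUnit, map_prod, ← Finset.prod_inv_distrib]
    refine pow_mem (prod_mem fun k hk => ?_) n
    rw [aeval_X]
    exact inv_mem_chartRing (Finset.ne_of_mem_erase hk)

theorem not_X_dvd_chartUnit_pow (i₀ : Fin d) (n : ℕ) :
    ¬ (X i₀ : MvPolynomial (Fin d) ℂ) ∣ chartUnit i₀ ^ n := by
  intro h
  have h1 := (X_prime (R := ℂ) (i := i₀)).dvd_of_dvd_pow h
  obtain ⟨k, hk, h2⟩ := (X_prime (R := ℂ) (i := i₀)).exists_mem_finset_dvd h1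
  rw [X_dvd_X] at h2
  exact Finset.ne_of_mem_erase hk h2.symm

/-- The divisor `y i₀ = 0` of a toric chart. -/
theorem exists_primeDivisorOver_chart {A : Type*} [CommRing A] [IsDomain A] [Algebra A F]
    [IsFractionRing A F] [Algebra ℂ A] [IsScalarTower ℂ A F] (hy : ∀ i, y i ≠ 0)
    (hinj : Function.Injective (aeval (R := ℂ) y))
    (hfr : ∀ f : F, ∃ p q : MvPolynomial (Fin d) ℂ, f = aeval y p / aeval y q)
    (hA : ∀ f : A, algebraMap A F f ∈ chartRing y i₀) :
    ∃ E : PrimeDivisorOver A F, (∀ i, E.ord (y i) = if i = i₀ then 1 else 0) ∧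
      ∀ f ∈ E.ring, f ∈ E.coordSubring y := by
  let : Algebra (MvPolynomial (Fin d) ℂ) F := (aeval y).toRingHom.toAlgebra
  have hmap : ∀ p, algebraMap (MvPolynomial (Fin d) ℂ) F p = aeval y p := fun _ => rfl
  have : FaithfulSMul (MvPolynomial (Fin d) ℂ) F :=
    (faithfulSMul_iff_algebraMap_injective _ _).2 hinj
  have : IsFractionRing (MvPolynomial (Fin d) ℂ) F :=
    IsFractionRing.of_field _ _ fun f => by
      obtain ⟨p, q, h⟩ := hfr f
      exact ⟨p, q, h⟩
  have hu0 : chartUnit i₀ ≠ 0 := Finset.prod_ne_zero_iff.2 fun k _ => X_ne_zero k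
  have hle : Submonoid.powers (chartUnit i₀) ≤ nonZeroDivisors (MvPolynomial (Fin d) ℂ) :=
    powers_le_nonZeroDivisors_of_noZeroDivisors hu0
  let S := Localization.subalgebra.ofField F (Submonoid.powers (chartUnit i₀)) hle
  have hS : ∀ f : F, f ∈ S ↔ f ∈ chartRing y i₀ := by
    intro f
    rw [mem_chartRing_iff hy]
    constructor
    · rintro ⟨p, _, ⟨n, rfl⟩, h⟩
      exact ⟨p, n, h⟩
    · rintro ⟨p, n, h⟩
      exact ⟨p, _, ⟨n, rfl⟩, h⟩
  -- The chart ring is a subalgebra over ℂ, while a model must be an algebra over the coordinate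
  -- ring of X; `hA` makes it one.
  let B : Subalgebra A F := { (chartRing y i₀).toSubring with algebraMap_mem' := hA }
  have hB : ∀ f : F, f ∈ B ↔ f ∈ chartRing y i₀ := fun f => Iff.rfl
  let e : S ≃+* B :=
    { toFun := fun f => ⟨f.1, (hS _).1 f.2⟩
      invFun := fun f => ⟨f.1, (hS _).2 f.2⟩
      left_inv := fun _ => rfl
      right_inv := fun _ => rfl
      map_mul' := fun _ _ => rfl
      map_add' := fun _ _ => rfl }
  have hSloc : IsLocalization (Submonoid.powers (chartUnit i₀)) S :=
    Localization.subalgebra.isLocalization_ofField F _ hle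
  have : IsNoetherianRing S :=
    IsLocalization.isNoetherianRing (Submonoid.powers (chartUnit i₀)) S inferInstance
  have : IsIntegrallyClosed S := isIntegrallyClosed_of_isLocalization S _ hle
  have : IsNoetherianRing B := isNoetherianRing_of_ringEquiv S e
  have : IsIntegrallyClosed B := IsIntegrallyClosed.of_equiv e
  have hFG : B.FG := by
    have h1 : B = Algebra.adjoin A (Set.range y ∪ (fun k => (y k)⁻¹) '' {k | k ≠ i₀}) := by
      apply le_antisymm
      · intro f hf
        have h2 : chartRing y i₀ ≤ (Algebra.adjoin A (Set.range y ∪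
            (fun k => (y k)⁻¹) '' {k | k ≠ i₀})).restrictScalars ℂ :=
          Algebra.adjoin_le Algebra.subset_adjoin
        exact h2 hf
      · exact Algebra.adjoin_le (Algebra.subset_adjoin (R := ℂ))
    rw [h1]
    exact Subalgebra.fg_def.2 ⟨_, (Set.finite_range y).union ((Set.toFinite _).image _), rfl⟩
  let t : B := ⟨y i₀, self_mem_chartRing i₀⟩
  have ht0 : t ≠ 0 := fun h => hy i₀ (congrArg Subtype.val h)
  -- Divisibility by y i₀ on the chart can be read off the numerator, as the denominators are prime
  -- to X i₀. Hence y i₀ is a prime element.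
  have hdvd : ∀ (p : MvPolynomial (Fin d) ℂ) (n : ℕ) (b : B),
      (b : F) = aeval y p * (aeval y (chartUnit i₀ ^ n))⁻¹ → (t ∣ b ↔ X i₀ ∣ p) := by
    intro p n b hb
    have hun : ∀ n, aeval y (chartUnit i₀ ^ n) ≠ 0 := fun n h =>
      pow_ne_zero n hu0 (hinj (by rw [h, map_zero]))
    constructor
    · rintro ⟨b', rfl⟩
      obtain ⟨p', n', hb'⟩ := (mem_chartRing_iff hy _).1 b'.2
      have h1 : p * chartUnit i₀ ^ n' = X i₀ * p' * chartUnit i₀ ^ n := by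
        apply hinj
        have h2 : y i₀ * (b' : F) = aeval y p * (aeval y (chartUnit i₀ ^ n))⁻¹ := hb
        rw [hb'] at h2
        simp only [map_mul, aeval_X]
        have h3 := hun n
        have h4 := hun n'
        field_simp at h2
        linear_combination -h2
      have h2 : X i₀ ∣ p * chartUnit i₀ ^ n' := h1 ▸ ⟨_, mul_assoc _ _ _⟩
      exact (X_prime.dvd_or_dvd h2).resolve_right (not_X_dvd_chartUnit_pow i₀ n')
    · rintro ⟨p', rfl⟩
      refine ⟨⟨aeval y p' * (aeval y (chartUnit i₀ ^ n))⁻¹,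
        (mem_chartRing_iff hy _).2 ⟨p', n, rfl⟩⟩, Subtype.ext ?_⟩
      rw [hb, map_mul, aeval_X, mul_assoc]
      rfl
  have htu : ¬ IsUnit t := by
    rw [isUnit_iff_dvd_one, hdvd 1 0 1 (by simp)]
    exact fun h => X_prime.not_isUnit (isUnit_iff_dvd_one.2 h)
  have htp : Prime t := by
    refine ⟨ht0, htu, fun b b' h => ?_⟩
    obtain ⟨p, n, hb⟩ := (mem_chartRing_iff hy _).1 b.2
    obtain ⟨p', n', hb'⟩ := (mem_chartRing_iff hy _).1 b'.2
    rw [hdvd p n b hb, hdvd p' n' b' hb']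
    refine X_prime.dvd_or_dvd ((hdvd (p * p') (n + n') (b * b') ?_).1 h)
    change (b : F) * b' = _
    rw [hb, hb', pow_add, map_mul, map_mul, mul_inv]
    ring
  have hPp : (Ideal.span {t}).IsPrime := (Ideal.span_singleton_prime ht0).2 htp
  obtain ⟨E, hE⟩ := PrimeDivisorOver.exists_of_height_eq_one B hFG (Ideal.span {t})
    (Ideal.height_span_singleton_eq_one_of_mem_nonZeroDivisors
      (mem_nonZeroDivisors_of_ne_zero ht0) htu)
  have hBE : ∀ f ∈ B, f ∈ E.ring := fun f hf =>
    (hE f).2 ⟨⟨f, hf⟩, 1, fun h => hPp.ne_top ((Ideal.eq_top_iff_one _).2 h), by simp⟩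
  have hinv : ∀ s : B, s ∉ Ideal.span {t} → (s : F)⁻¹ ∈ E.ring := fun s hs =>
    (hE _).2 ⟨1, s, hs, by simp⟩
  have hord0 : ∀ k, k ≠ i₀ → E.ord (y k) = 0 := by
    intro k hk
    have h1 := E.ord_nonneg_of_mem (hBE _ ((hB _).2 (self_mem_chartRing k)))
    have h2 := E.ord_nonneg_of_mem (hBE _ ((hB _).2 (inv_mem_chartRing hk)))
    rw [E.ord_inv] at h2
    omega
  have hti : y i₀ ∈ E.ring := hBE _ t.2
  have hord1 : E.ord (y i₀) = 1 := by
    refine E.ord_eq_one_of_maximalIdeal_eq_span hti (hy i₀) (le_antisymm ?_ ?_)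
    · intro f hf
      obtain ⟨b, s, hs, h⟩ := (hE f).1 f.2
      have hb : b ∈ Ideal.span {t} := by
        by_contra hb
        rw [IsLocalRing.mem_maximalIdeal, mem_nonunits_iff] at hf
        have hs0 : (s : F) ≠ 0 := fun h0 => hs (by
          rw [show s = 0 from Subtype.ext h0]; exact zero_mem _)
        have hb0 : (b : F) ≠ 0 := fun h0 => hb (by
          rw [show b = 0 from Subtype.ext h0]; exact zero_mem _)
        refine hf (IsUnit.of_mul_eq_one ⟨(s : F) / b, (hE _).2 ⟨s, b, hb, rfl⟩⟩ (Subtype.ext ?_))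
        change (f : F) * (s / b) = 1
        rw [h]
        field_simp
      obtain ⟨b', rfl⟩ := Ideal.mem_span_singleton.1 hb
      refine Ideal.mem_span_singleton.2 ⟨⟨(b' : F) / s, (hE _).2 ⟨b', s, hs, rfl⟩⟩,
        Subtype.ext ?_⟩
      rw [h]
      exact mul_div_assoc _ _ _
    · rw [Ideal.span_singleton_le_iff_mem, IsLocalRing.mem_maximalIdeal, mem_nonunits_iff]
      rintro ⟨u, hu⟩
      obtain ⟨b, s, hs, h⟩ := (hE _).1 (↑u⁻¹ : E.ring).2
      have h1 : y i₀ * ((↑u⁻¹ : E.ring) : F) = 1 := by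
        have := congrArg Subtype.val (Units.mul_inv u)
        rw [hu] at this
        simpa using this
      have hs0 : (s : F) ≠ 0 := fun h0 => hs (by
        rw [show s = 0 from Subtype.ext h0]; exact zero_mem _)
      rw [h, mul_div_assoc', div_eq_one_iff_eq hs0] at h1
      exact hs (Ideal.mem_span_singleton.2 ⟨b, (Subtype.ext h1).symm⟩)
  have hBc : ∀ f ∈ B, f ∈ E.coordSubring y := by
    intro f hf
    have hle : chartRing y i₀ ≤ { E.coordSubring y with
        algebraMap_mem' := E.algebraMap_mem_coordSubring y } := by
      refine Algebra.adjoin_le ?_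
      rintro _ (⟨k, rfl⟩ | ⟨k, hk, rfl⟩)
      · exact E.mem_coordSubring_self y (hBE _ ((hB _).2 (self_mem_chartRing k)))
      · exact E.inv_mem_coordSubring y
          (E.mem_coordSubring_self y (hBE _ ((hB _).2 (self_mem_chartRing k))))
          (hBE _ ((hB _).2 (inv_mem_chartRing hk)))
    exact hle hf
  refine ⟨E, fun i => ?_, E.mem_coordSubring_of_fractions y fun f hf => ?_⟩
  · split_ifs with hi
    · rw [hi, hord1]
    · exact hord0 i hi
  · obtain ⟨b, s, hs, rfl⟩ := (hE f).1 hf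
    exact ⟨b, s, hBc _ b.2, hBc _ s.2, hinv s hs, rfl⟩

end Chart

open MvPolynomial

namespace PrimeDivisorOver

variable {A : Type*} [CommRing A] {F : Type*} [Field F] [Algebra A F] [Algebra ℂ F] {n : ℕ}

theorem FormHasOrd.of_smul {E : PrimeDivisorOver A F} {ω : ⋀[F]^n Ω[F⁄ℂ]} {k : ℤ} {h : F}
    (h0 : h ≠ 0) (hω : E.FormHasOrd (h • ω) k) : E.FormHasOrd ω (k - E.ord h) := by
  obtain ⟨η, f, hf, hs, he, rfl⟩ := hω
  refine ⟨η, h⁻¹ * f, mul_ne_zero (inv_ne_zero h0) hf, hs, ?_, ?_⟩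
  · rw [mul_smul, ← he, smul_smul, inv_mul_cancel₀ h0, one_smul]
  · rw [E.ord_mul (inv_ne_zero h0) hf, E.ord_inv]
    ring

end PrimeDivisorOver

/-! ### Log discrepancies over the origin versus lattice vectors -/

namespace ToricCoordinates

variable {d r : ℕ} {a : Fin d → ℤ} {i₀ : Fin d} (c : ToricCoordinates r a i₀)
  {F : Type*} [Field F] [Algebra (coordRing r a) F] [IsFractionRing (coordRing r a) F]
  [Algebra ℂ F] [IsScalarTower ℂ (coordRing r a) F]

/-- A positive weight vector in the lattice of the quotient gives a prime divisor over the origin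
whose log discrepancy is at most the sum of the weights. -/
theorem exists_isLogDiscrepancy_le {i₁ : Fin d} (hi : i₁ ≠ i₀) (hcop : IsCoprime (r : ℤ) (a i₁))
    (v : Fin d → ℚ) (hv : ∀ i, 0 < v i) (w : Fin d → ℤ)
    (hw : ∀ i, (w i : ℚ) = v i + c.e i * v i₀) :
    ∃ (E : PrimeDivisorOver (coordRing r a) F) (q : ℚ), E.center = originIdeal r a ∧
      E.IsLogDiscrepancy d (originIdeal r a) q ∧ q ≤ ∑ i, v i := by
  have : FaithfulSMul (coordRing r a) F := IsFractionRing.instFaithfulSMul _ _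
  have hr : (0 : ℚ) < r := by exact_mod_cast Nat.pos_of_ne_zero c.r_ne_zero
  have he : (c.e i₀ : ℚ) + 1 = r := by exact_mod_cast c.e_self
  have hw0 : (w i₀ : ℚ) = r * v i₀ := by rw [hw, ← he]; ring
  have hwne : w ≠ 0 := by
    intro h
    have h1 : (0 : ℚ) < w i₀ := by rw [hw0]; exact mul_pos hr (hv _)
    rw [h] at h1
    simp at h1
  -- w holds the weights of the z i. Dividing by g makes this vector primitive, and the divisor of
  -- the resulting chart has the column of U as its orders.
  obtain ⟨U, V, g, hVU, hUV, hg0, hg⟩ := exists_unimodular w hwne i₀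
  have hz0 := c.zF_ne_zero F
  set y : Fin d → F := fun i => ∏ j, c.zF F j ^ V i j with hy
  have hy0 : ∀ i, y i ≠ 0 := fun i => Finset.prod_ne_zero_iff.2 fun j _ => zpow_ne_zero _ (hz0 j)
  have hzy : ∀ j, c.zF F j = ∏ i, y i ^ U j i := fun j => by
    rw [prod_zpow_matrix_mul _ hz0, hUV, prod_zpow_one]
  -- An invariant monomial has order ∑ m i v i / g along the new divisor. Nonnegativity makes it
  -- regular on the chart, and positivity for m ≠ 0 puts the center at the origin.
  have hmono : ∀ (m : Fin d →₀ ℕ) (hm : (r : ℤ) ∣ ∑ i, a i * m i), ∃ κ : Fin d → ℤ,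
      algebraMap (coordRing r a) F ⟨monomial m 1, monomial_mem_coordRing c.r_ne_zero hm 1⟩ =
        ∏ i, y i ^ κ i ∧ (g * κ i₀ : ℚ) = ∑ i, m i * v i := by
    intro m hm
    obtain ⟨l, hl, -, h⟩ := c.algebraMap_monomial F m hm
    let k : Fin d → ℤ := fun i => (m i : ℤ) - if i = i₀ then l else 0
    refine ⟨((Matrix.of fun _ : Fin d => k) * U) i₀, ?_, ?_⟩
    · rw [← prod_zpow_matrix_mul y hy0, h]
      exact Finset.prod_congr rfl fun j _ => by rw [← hzy]; rfl
    · have h1 : (g * ((Matrix.of fun _ : Fin d => k) * U) i₀ i₀ : ℤ) = ∑ i, k i * w i := by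
        rw [Matrix.mul_apply, Finset.mul_sum]
        exact Finset.sum_congr rfl fun j _ => by rw [hg j, Matrix.of_apply]; ring
      have h2 : ((g * ((Matrix.of fun _ : Fin d => k) * U) i₀ i₀ : ℤ) : ℚ) =
          ((∑ i, k i * w i : ℤ) : ℚ) := by rw [h1]
      have h3 : ∑ i, (c.e i : ℚ) * m i = r * l := by exact_mod_cast hl
      push_cast at h2
      rw [h2]
      have h4 : ∑ i, (k i : ℚ) * w i = ∑ i, (m i : ℚ) * w i - l * w i₀ := by
        have : ∀ i, (k i : ℚ) * w i = m i * w i - if i = i₀ then l * w i₀ else 0 := by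
          intro i
          simp only [k]
          split_ifs with hi
          · rw [hi]; push_cast; ring
          · push_cast; ring
        simp [this, Finset.sum_sub_distrib]
      have h5 : ∑ i, (m i : ℚ) * w i = ∑ i, m i * v i + (∑ i, (c.e i : ℚ) * m i) * v i₀ := by
        rw [Finset.sum_mul, ← Finset.sum_add_distrib]
        exact Finset.sum_congr rfl fun i _ => by rw [hw]; ring
      rw [h4, h5, h3, hw0]
      ring
  have hgQ : (0 : ℚ) < g := by exact_mod_cast hg0
  have hκ : ∀ (m : Fin d →₀ ℕ) (κ : ℤ), (g * κ : ℚ) = ∑ i, m i * v i → 0 ≤ κ := by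
    intro m κ h
    have h1 : (0 : ℚ) ≤ g * κ := h ▸ Finset.sum_nonneg fun i _ =>
      mul_nonneg (Nat.cast_nonneg _) (hv i).le
    exact_mod_cast nonneg_of_mul_nonneg_right h1 hgQ
  obtain ⟨E, hordy, hcs⟩ := exists_primeDivisorOver_chart (A := coordRing r a) (i₀ := i₀) hy0
    (c.aeval_prod_zpow_injective hVU) (c.exists_eq_aeval_div hUV) (by
      refine c.algebraMap_mem_subring F (chartRing y i₀).toSubring
        (fun t => (chartRing y i₀).algebraMap_mem t) fun m hm => ?_
      obtain ⟨κ, h1, h2⟩ := hmono m hm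
      rw [h1]
      refine prod_mem fun i _ => ?_
      by_cases hi : i = i₀
      · rw [hi]
        lift κ i₀ to ℕ using hκ m _ h2 with q
        rw [zpow_natCast]
        exact pow_mem (self_mem_chartRing i₀) q
      · exact zpow_mem_chartRing hi _)
  have hordz : ∀ j, E.ord (c.zF F j) = 1 * U j i₀ := by
    intro j
    rw [hzy j, E.ord_prod_zpow y hy0]
    simp [hordy]
  have hcenter : E.center = originIdeal r a := by
    refine ((originIdeal_isMaximal).eq_of_le E.center_isPrime.ne_top fun f hf => ?_).symm
    refine coordRing_induction c.r_ne_zero (AddMonoidHom.id _)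
      E.center.toAddSubmonoid f fun m hm hms t => ?_
    have h1 : (⟨monomial m t, monomial_mem_coordRing c.r_ne_zero hm t⟩ : coordRing r a) =
        algebraMap ℂ (coordRing r a) t *
          ⟨monomial m 1, monomial_mem_coordRing c.r_ne_zero hm 1⟩ := by
      apply Subtype.ext
      change _ = C t * monomial m 1
      rw [C_mul_monomial, mul_one]
    change (⟨monomial m t, _⟩ : coordRing r a) ∈ E.center
    rw [h1]
    refine E.center.mul_mem_left _ ?_
    rw [← E.ord_algebraMap_pos_iff]
    · obtain ⟨κ, h2, h3⟩ := hmono m hm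
      have hm0 : m ≠ 0 := by
        rintro rfl
        exact (mem_support_iff.1 hms) ((mem_originIdeal_iff f).1 hf)
      obtain ⟨j, hj⟩ := Finsupp.ne_iff.1 hm0
      have h4 : (0 : ℚ) < g * κ i₀ := by
        rw [h3]
        refine Finset.sum_pos' (fun i _ => mul_nonneg (Nat.cast_nonneg _) (hv i).le)
          ⟨j, Finset.mem_univ j, mul_pos ?_ (hv j)⟩
        exact_mod_cast Nat.pos_of_ne_zero hj
      have h5 : 0 < κ i₀ := by exact_mod_cast pos_of_mul_pos_right h4 hgQ.le
      rw [h2, E.ord_prod_zpow y hy0]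
      simpa [hordy] using h5
    · intro h
      have := congrArg Subtype.val h
      simp at this
  have hform := E.formHasOrd_of_coordSubring (c.zF F) hz0 hVU hUV one_pos hordz hcs
  -- r times the divisor of dz_1 ∧ … ∧ dz_d is that of z i₀ to the power ∑ e i. The log discrepancy
  -- is then ∑ v / g, where g may exceed 1.
  refine ⟨E, (∑ i, v i) / g, hcenter, ⟨c.form F, r, c.zF F i₀ ^ (-∑ i, (c.e i : ℤ)),
    c.form_ne_zero F, Nat.pos_of_ne_zero c.r_ne_zero, zpow_ne_zero _ (hz0 _), ?_, _, hform, ?_⟩, ?_⟩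
  · intro D hD _
    obtain ⟨k, hk, hk'⟩ := c.exists_formHasOrd_of_height_eq_one hi hcop D hD
    exact ⟨k, hk, by rw [D.ord_zpow, hk']; ring⟩
  · have hU : ∀ j, (g * U j i₀ : ℚ) = v j + c.e j * v i₀ := fun j => by
      rw [← hw j, hg j]; push_cast; ring
    have hU0 : (g * U i₀ i₀ : ℚ) = r * v i₀ := by rw [hU, ← he]; ring
    have hsum : (g : ℚ) * ∑ j, (U j i₀ : ℚ) = ∑ j, v j + (∑ j, (c.e j : ℚ)) * v i₀ := by
      rw [Finset.mul_sum, Finset.sum_mul, ← Finset.sum_add_distrib]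
      exact Finset.sum_congr rfl fun j _ => hU j
    simp only [E.ord_zpow, hordz, one_mul]
    push_cast
    field_simp
    linear_combination -(r : ℚ) * hsum + (∑ j, (c.e j : ℚ)) * hU0
  · refine div_le_self (Finset.sum_nonneg fun i _ => (hv i).le) ?_
    exact_mod_cast hg0

include c in
/-- Log discrepancies over the origin are bounded below by the sum of the coordinates of a positive
vector in the lattice of the quotient. -/
theorem exists_sum_le_of_isLogDiscrepancy {i₁ : Fin d} (hi : i₁ ≠ i₀)
    (hcop : IsCoprime (r : ℤ) (a i₁)) (E : PrimeDivisorOver (coordRing r a) F) (q : ℚ)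
    (hE : E.center = originIdeal r a) (hq : E.IsLogDiscrepancy d (originIdeal r a) q) :
    ∃ (v : Fin d → ℚ) (k : ℤ), (∀ i, 0 < v i) ∧ (∀ i, ∃ n : ℤ, v i = k * a i / r + n) ∧
      ∑ i, v i ≤ q := by
  have := isNoetherianRing_coordRing (a := a) c.r_ne_zero
  have := isIntegrallyClosed_coordRing (r := r) (a := a)
  have : FaithfulSMul (coordRing r a) F := IsFractionRing.instFaithfulSMul _ _
  have := (originIdeal_isMaximal (r := r) (a := a)).isPrime
  have hr0 : r ≠ 0 := c.r_ne_zero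
  have hr : (0 : ℚ) < r := by exact_mod_cast Nat.pos_of_ne_zero c.r_ne_zero
  have hz0 := c.zF_ne_zero F
  obtain ⟨ω, m, g, hω, hm, hg, hD, k, hk, rfl⟩ := hq
  obtain ⟨h, rfl⟩ := c.exists_eq_smul_form ω
  have hh : h ≠ 0 := by rintro rfl; simp at hω
  set δ : ℕ := ∑ i, c.e i with hδ
  -- Ψ compares the given trivialization of a multiple of K_X with the toric one. It has order zero
  -- along the prime divisors through the origin, so by normality it is a unit there and has order
  -- zero along E.
  let Ψ : F := h ^ (m * r) * g ^ r * c.zF F i₀ ^ (m * δ)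
  have hΨ0 : Ψ ≠ 0 :=
    mul_ne_zero (mul_ne_zero (pow_ne_zero _ hh) (pow_ne_zero _ hg)) (pow_ne_zero _ (hz0 _))
  have hΨ : ∀ D : PrimeDivisorOver (coordRing r a) F, D.ord Ψ =
      m * r * D.ord h + r * D.ord g + m * δ * D.ord (c.zF F i₀) := by
    intro D
    rw [D.ord_mul (mul_ne_zero (pow_ne_zero _ hh) (pow_ne_zero _ hg)) (pow_ne_zero _ (hz0 _)),
      D.ord_mul (pow_ne_zero _ hh) (pow_ne_zero _ hg), D.ord_pow, D.ord_pow, D.ord_pow]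
    push_cast
    ring
  have hord : ∀ D : PrimeDivisorOver (coordRing r a) F, D.center.height = 1 →
      D.center ≤ originIdeal r a → D.ord Ψ = 0 := by
    intro D hD1 hDx
    obtain ⟨k, hk, hk'⟩ := hD D hD1 hDx
    obtain ⟨k₁, hk₁, hk₁'⟩ := c.exists_formHasOrd_of_height_eq_one hi hcop D hD1
    have h1 := hk.eq_add hk₁ hω rfl
    have h2 : (∑ i, (c.e i : ℤ)) = δ := by rw [hδ]; push_cast; rfl
    rw [h2] at hk₁'
    rw [hΨ]
    linear_combination (r : ℤ) * hk' - (m * r : ℤ) * h1 - (m : ℤ) * hk₁'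
  have hreg : ∀ f : F, (∀ D : PrimeDivisorOver (coordRing r a) F, D.center.height = 1 →
      D.center ≤ originIdeal r a → 0 ≤ D.ord f) → 0 ≤ E.ord f := by
    intro f hf
    obtain ⟨b, s, hs, rfl⟩ := exists_div_of_forall_height_eq_one (originIdeal r a) f (by
      intro p hp hp1 hpx
      obtain ⟨D, hDr, hDp⟩ := PrimeDivisorOver.exists_of_prime_height_eq_one (F := F) p hp1
      rw [← hDr]
      exact D.mem_of_ord_nonneg (hf D (hDp ▸ hp1) (hDp ▸ hpx)))
    rcases eq_or_ne b 0 with rfl | hb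
    · simp [PrimeDivisorOver.ord]
    · have hs0 : s ≠ 0 := by rintro rfl; exact hs (zero_mem _)
      rw [← hE] at hs
      rw [div_eq_mul_inv, E.ord_mul
        (by rw [Ne, IsFractionRing.to_map_eq_zero_iff]; exact hb)
        (inv_ne_zero (by rw [Ne, IsFractionRing.to_map_eq_zero_iff]; exact hs0)),
        E.ord_inv, E.ord_algebraMap_eq_zero hs, neg_zero, add_zero]
      exact E.ord_algebraMap_nonneg b
  have hEΨ : E.ord Ψ = 0 := by
    have h1 := hreg Ψ fun D h1 h2 => (hord D h1 h2).ge
    have h2 := hreg Ψ⁻¹ fun D h1 h2 => by rw [D.ord_inv, hord D h1 h2, neg_zero]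
    rw [E.ord_inv] at h2
    omega
  have hpos : ∀ f : coordRing r a, f ≠ 0 → f ∈ originIdeal r a →
      0 < E.ord (algebraMap _ F f) := fun f hf0 hf =>
    (E.ord_algebraMap_pos_iff hf0).2 (hE ▸ hf)
  have hx : ∀ i, 0 < E.ord (algebraMap _ F (c.xPow i)) := fun i =>
    hpos _ (c.xPow_ne_zero i) (by
      rw [mem_originIdeal_iff]
      change constantCoeff (X i ^ r) = 0
      rw [map_pow, constantCoeff_X, zero_pow hr0])
  have hzpos : 0 < E.ord (c.zF F i₀) := hpos _ (c.z_ne_zero i₀) (by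
      rw [mem_originIdeal_iff, c.coe_z_self, map_pow, constantCoeff_X, zero_pow hr0])
  have hle := PrimeDivisorOver.FormHasOrd.sum_ord_le E (c.zF F) hz0 i₀ hzpos.ne'
    (c.form_ne_zero F) (hk.of_smul hh)
  obtain ⟨u, b, hb⟩ := c.isCoprime
  set κ := E.ord (c.zF F i₀) with hκ
  -- The coordinates are the rational orders of the x i. As b inverts a i₀ modulo r, the multiplier
  -- κ b is forced by the coordinate i₀.
  refine ⟨fun i => E.ord (algebraMap _ F (c.xPow i)) / r, κ * b,
    fun i => div_pos (by exact_mod_cast hx i) hr, fun i => ?_, ?_⟩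
  · obtain ⟨l, hl⟩ := c.dvd i
    refine ⟨E.ord (c.zF F i) - κ * b * l - κ * u * c.e i, ?_⟩
    have h1 : (r : ℚ) * E.ord (c.zF F i) =
        E.ord (algebraMap _ F (c.xPow i)) + c.e i * κ := by exact_mod_cast c.ord_xPow E i
    have hl' : (a i : ℚ) + c.e i * a i₀ = r * l := by exact_mod_cast hl
    have hb' : (u : ℚ) * r + b * a i₀ = 1 := by exact_mod_cast hb
    push_cast
    field_simp
    linear_combination -h1 - (κ * b : ℚ) * hl' + (κ * c.e i : ℚ) * hb'
  · have h1 : ∀ i, (E.ord (algebraMap _ F (c.xPow i)) : ℚ) / r =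
        E.ord (c.zF F i) - c.e i * κ / r := by
      intro i
      have h1 : (r : ℚ) * E.ord (c.zF F i) =
        E.ord (algebraMap _ F (c.xPow i)) + c.e i * κ := by exact_mod_cast c.ord_xPow E i
      field_simp
      linear_combination -h1
    rw [hΨ, ← hκ] at hEΨ
    have h2 : (m * r * E.ord h + r * E.ord g + m * δ * κ : ℚ) = 0 := by exact_mod_cast hEΨ
    have h3 : (∑ i, (E.ord (c.zF F i) : ℚ)) - 1 ≤ k - E.ord h := by exact_mod_cast hle
    have hm' : (0 : ℚ) < m := by exact_mod_cast hm
    have h4 : (E.ord h : ℚ) + E.ord g / m + δ * κ / r = 0 := by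
      field_simp
      linear_combination h2
    have h5 : ∑ i, (c.e i : ℚ) * κ / r = δ * κ / r := by
      rw [hδ]; push_cast; rw [Finset.sum_mul, Finset.sum_div]
    simp only [h1, Finset.sum_sub_distrib, h5]
    linarith

end ToricCoordinates

/-- The minimal log discrepancy is at most the sum of the fractional parts of `k a_i / r`. -/
theorem cyclicMld_le {d r : ℕ} {a : Fin d → ℤ} (hr : r ≠ 0) {i₀ i₁ : Fin d} (hi : i₁ ≠ i₀)
    (h₀ : IsCoprime (r : ℤ) (a i₀)) (h₁ : IsCoprime (r : ℤ) (a i₁)) (k : ℤ)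
    (hk : ∀ i, ¬ (r : ℤ) ∣ k * a i) :
    cyclicMld r a ≤ (((∑ i, Int.fract ((k * a i : ℚ) / r) : ℚ) : ℝ) : EReal) := by
  obtain ⟨c⟩ := ToricCoordinates.nonempty hr h₀
  have hr' : (r : ℚ) ≠ 0 := by exact_mod_cast hr
  have hdvd : ∀ i, ∃ n : ℤ, (a i : ℚ) + c.e i * a i₀ = r * n := fun i => by
    obtain ⟨n, hn⟩ := c.dvd i
    exact ⟨n, by exact_mod_cast hn⟩
  choose n hn using hdvd
  have hpos : ∀ i, 0 < Int.fract ((k * a i : ℚ) / r) := by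
    intro i
    refine lt_of_le_of_ne (Int.fract_nonneg _) fun h => hk i ?_
    obtain ⟨l, hl⟩ := Int.fract_eq_zero_iff.1 h.symm
    refine ⟨l, ?_⟩
    rw [eq_div_iff hr'] at hl
    have : (k * a i : ℚ) = r * l := by rw [← hl]; ring
    exact_mod_cast this
  obtain ⟨E, q, hE, hq, hle⟩ := c.exists_isLogDiscrepancy_le
    (F := FractionRing (coordRing r a)) hi h₁ (fun i => Int.fract ((k * a i : ℚ) / r)) hpos
    (fun i => k * n i - ⌊(k * a i : ℚ) / r⌋ - c.e i * ⌊(k * a i₀ : ℚ) / r⌋)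
    (fun i => by
      simp only [Int.fract]
      push_cast
      have := hn i
      field_simp
      linear_combination -(k : ℚ) * this)
  have h : cyclicMld r a ≤ ((q : ℝ) : EReal) := sInf_le ⟨E, q, hE, hq, rfl⟩
  refine h.trans ?_
  exact_mod_cast hle

/-- If the minimal log discrepancy is less than `b`, then so is the sum of the coordinates of some
positive vector in the lattice of the quotient. -/
theorem exists_of_cyclicMld_lt {d r : ℕ} {a : Fin d → ℤ} (hr : r ≠ 0) {i₀ i₁ : Fin d}
    (hi : i₁ ≠ i₀) (h₀ : IsCoprime (r : ℤ) (a i₀)) (h₁ : IsCoprime (r : ℤ) (a i₁)) {b : ℝ}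
    (hb : cyclicMld r a < (b : EReal)) :
    ∃ (v : Fin d → ℚ) (k : ℤ), (∀ i, 0 < v i) ∧ (∀ i, ∃ n : ℤ, v i = k * a i / r + n) ∧
      ((∑ i, v i : ℚ) : ℝ) < b := by
  obtain ⟨c⟩ := ToricCoordinates.nonempty hr h₀
  obtain ⟨_, ⟨E, q, hE, hq, rfl⟩, hlt⟩ := sInf_lt_iff.1 hb
  obtain ⟨v, k, h1, h2, h3⟩ := c.exists_sum_le_of_isLogDiscrepancy hi h₁ E q hE hq
  refine ⟨v, k, h1, h2, lt_of_le_of_lt ?_ (EReal.coe_lt_coe_iff.1 hlt)⟩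
  exact_mod_cast h3

/-! ### One-sided limits of fractional parts -/

section DirectedFract

/-- The limit of the fractional part at `x` from the right if `0 ≤ n`, from the left
if `n < 0`. -/
def directedFract (n : ℤ) (x : ℚ) : ℚ := if 0 ≤ n then Int.fract x else 1 - Int.fract (-x)

theorem directedFract_of_nonneg {n : ℤ} (hn : 0 ≤ n) (x : ℚ) : directedFract n x = Int.fract x :=
  if_pos hn

theorem directedFract_of_neg {n : ℤ} (hn : n < 0) (x : ℚ) :
    directedFract n x = 1 - Int.fract (-x) :=
  if_neg (not_le.2 hn)

theorem directedFract_nonneg (n : ℤ) (x : ℚ) : 0 ≤ directedFract n x := by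
  unfold directedFract
  split_ifs
  · exact Int.fract_nonneg x
  · linarith [Int.fract_lt_one (-x)]

theorem exists_directedFract_eq (n : ℤ) (x : ℚ) : ∃ m : ℤ, directedFract n x = x + m := by
  unfold directedFract
  split_ifs
  · exact ⟨-⌊x⌋, by rw [Int.fract]; push_cast; ring⟩
  · exact ⟨1 + ⌊-x⌋, by rw [Int.fract]; push_cast; ring⟩

theorem directedFract_add_intCast (n : ℤ) (x : ℚ) (m : ℤ) :
    directedFract n (x + m) = directedFract n x := by
  unfold directedFract
  have : -(x + m) = -x + ((-m : ℤ) : ℚ) := by push_cast; ring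
  rw [Int.fract_add_intCast, this, Int.fract_add_intCast]

theorem directedFract_of_notInt {x : ℚ} (hx : ∀ m : ℤ, x ≠ m) (n : ℤ) :
    directedFract n x = Int.fract x := by
  unfold directedFract
  split_ifs
  · rfl
  · rw [Int.fract_neg]
    · ring
    · intro h
      obtain ⟨m, hm⟩ := Int.fract_eq_zero_iff.1 h
      exact hx m hm.symm

/-- The hypothesis excludes the one exception, an integer with direction 0, where the two sides are
0 and 1. -/
theorem directedFract_neg {n : ℤ} {x : ℚ} (h : n = 0 → ∀ m : ℤ, x ≠ m) :
    directedFract n (-x) = 1 - directedFract (-n) x := by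
  rcases lt_trichotomy n 0 with hn | rfl | hn
  · rw [directedFract_of_neg hn, directedFract_of_nonneg (by omega), neg_neg]
  · have h' := h rfl
    rw [neg_zero, directedFract_of_nonneg le_rfl, directedFract_of_nonneg le_rfl, Int.fract_neg]
    intro h0
    obtain ⟨m, hm⟩ := Int.fract_eq_zero_iff.1 h0
    exact h' m hm.symm
  · rw [directedFract_of_neg (by omega : -n < 0), directedFract_of_nonneg hn.le]
    ring

/-- This is the jump of the fractional part at an integer. It depends only on the sign of the
direction, so it survives multiplication of the point by an integer. -/
theorem directedFract_intCast (n m : ℤ) : directedFract (-n) m - directedFract n m = n.sign := by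
  unfold directedFract
  have : (-(m : ℚ)) = ((-m : ℤ) : ℚ) := by push_cast; ring
  rw [this, Int.fract_intCast, Int.fract_intCast]
  rcases lt_trichotomy n 0 with hn | rfl | hn
  · rw [if_pos (by omega), if_neg (by omega), Int.sign_eq_neg_one_of_neg hn]; norm_num
  · simp
  · rw [if_neg (by omega), if_pos hn.le, Int.sign_eq_one_of_pos hn]; norm_num

/-- The directed fractional part in terms of its characterization. -/
theorem one_sub_fract_neg_eq {x y : ℚ} {m : ℤ} (h : y = x + m) (h0 : 0 < y) (h1 : y ≤ 1) :
    1 - Int.fract (-x) = y := by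
  have : Int.fract (-x) = 1 - y := by
    rw [Int.fract_eq_iff]
    exact ⟨by linarith, by linarith, m - 1, by rw [h]; push_cast; ring⟩
  rw [this]; ring

/-- Moving by one step of a sufficiently fine grid does not cross an integer. -/
theorem directedFract_neg_add_div {v n N : ℤ} (hn : 0 < n) (hN : n = N * v) {x : ℚ}
    (hx : ∃ j : ℤ, x * N = j) :
    directedFract (-v) (x + v / n) = directedFract v x + v / n := by
  obtain ⟨j, hj⟩ := hx
  have hnQ : (0 : ℚ) < n := by exact_mod_cast hn
  have hv0 : v ≠ 0 := by rintro rfl; simp at hN; omega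
  have hN0 : N ≠ 0 := by rintro rfl; simp at hN; omega
  have hNQ : (N : ℚ) ≠ 0 := by exact_mod_cast hN0
  have hvQ : (v : ℚ) ≠ 0 := by exact_mod_cast hv0
  -- One step is 1 / N with x in (1 / N) ℤ, so no integer lies strictly between the endpoints. N has
  -- the sign of v.
  have hvn : (v : ℚ) / n = 1 / N := by rw [hN]; push_cast; field_simp
  rw [hvn]
  rcases lt_or_gt_of_ne hv0 with hv | hv
  · have hNneg : N < 0 := by
      by_contra h
      have := mul_nonpos_of_nonneg_of_nonpos (not_lt.1 h) hv.le
      omega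
    have hNQ' : (N : ℚ) < 0 := by exact_mod_cast hNneg
    rw [directedFract_of_nonneg (by omega), directedFract_of_neg hv]
    set y := 1 - Int.fract (-x) with hy
    have hy0 : 0 < y := by linarith [Int.fract_lt_one (-x)]
    have hy1 : y ≤ 1 := by linarith [Int.fract_nonneg (-x)]
    obtain ⟨m, hm⟩ : ∃ m : ℤ, y = x + m :=
      ⟨1 + ⌊-x⌋, by rw [hy, Int.fract]; push_cast; ring⟩
    have hyN : y * N = (j + m * N : ℤ) := by rw [hm]; push_cast; linear_combination hj
    have h1 : y * N ≤ -1 := by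
      have : y * N < 0 := mul_neg_of_pos_of_neg hy0 hNQ'
      rw [hyN] at this ⊢
      have h2 : j + m * N < 0 := by exact_mod_cast this
      exact_mod_cast (by omega : j + m * N ≤ -1)
    rw [Int.fract_eq_iff]
    refine ⟨?_, ?_, -m, by rw [hm]; push_cast; ring⟩
    · have h3 : y + 1 / N = (y * N + 1) / N := by field_simp
      rw [h3]
      exact div_nonneg_of_nonpos (by linarith) hNQ'.le
    · have : 1 / (N : ℚ) < 0 := one_div_neg.2 hNQ'
      linarith
  · have hNpos : 0 < N := by
      by_contra h
      have := mul_nonpos_of_nonpos_of_nonneg (not_lt.1 h) hv.le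
      omega
    have hNQ' : (0 : ℚ) < N := by exact_mod_cast hNpos
    rw [directedFract_of_neg (by omega : -v < 0), directedFract_of_nonneg hv.le]
    have hy0 := Int.fract_nonneg x
    have hy1 := Int.fract_lt_one x
    refine one_sub_fract_neg_eq (m := -⌊x⌋) (by rw [Int.fract]; push_cast; ring) ?_ ?_
    · have : 0 < 1 / (N : ℚ) := one_div_pos.2 hNQ'
      linarith
    · have hyN : Int.fract x * N = (j - ⌊x⌋ * N : ℤ) := by
        rw [Int.fract]; push_cast; linear_combination hj
      have h1 : Int.fract x * N ≤ N - 1 := by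
        have : Int.fract x * N < N := by
          calc Int.fract x * N < 1 * N := mul_lt_mul_of_pos_right hy1 hNQ'
            _ = N := one_mul _
        rw [hyN] at this ⊢
        have h2 : j - ⌊x⌋ * N < N := by exact_mod_cast this
        exact_mod_cast (by omega : j - ⌊x⌋ * N ≤ N - 1)
      have h3 : Int.fract x + 1 / N = (Int.fract x * N + 1) / N := by field_simp
      rw [h3, div_le_one hNQ']
      linarith

end DirectedFract

/-! ### Moving a rational number to the middle of the unit interval -/

section Units

/-- Take y next to q / 2: (q - 1) / 2 for odd q, q / 2 - 1 when 4 ∣ q, q / 2 - 2 when q ≡ 2 modulo 4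
and q > 2. The extreme case is q = 6, whose units are 1 and 5; this is the origin of the 1/6 in the
theorem. -/
theorem exists_coprime_mid {q : ℕ} (hq : 2 ≤ q) :
    ∃ y : ℕ, Nat.Coprime y q ∧ q ≤ 6 * y ∧ 6 * y ≤ 5 * q := by
  have key : ∀ y : ℕ, ∀ t : ℕ, (∀ g : ℕ, g ∣ y → g ∣ q → g ∣ t) → (t = 1 ∨ t = 2 ∧ Odd y
      ∨ t = 4 ∧ Odd y) → Nat.Coprime y q := by
    intro y t h ht
    have h1 := h _ (Nat.gcd_dvd_left y q) (Nat.gcd_dvd_right y q)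
    rcases ht with rfl | ⟨rfl, ho⟩ | ⟨rfl, ho⟩
    · exact Nat.dvd_one.1 h1
    · exact Nat.Coprime.eq_one_of_dvd (Nat.Coprime.coprime_dvd_left (Nat.gcd_dvd_left y q)
        ho.coprime_two_right) h1
    · exact Nat.Coprime.eq_one_of_dvd (Nat.Coprime.coprime_dvd_left (Nat.gcd_dvd_left y q)
        (Nat.Coprime.pow_right 2 ho.coprime_two_right)) h1
  have h4 : q % 4 = 0 ∨ q % 4 = 1 ∨ q % 4 = 2 ∨ q % 4 = 3 := by omega
  rcases h4 with h | h | h | h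
  · obtain ⟨m, rfl⟩ : ∃ m, q = 4 * (m + 1) := ⟨q / 4 - 1, by omega⟩
    refine ⟨2 * m + 1, key _ 2 (fun g h1 h2 => ?_) (Or.inr (Or.inl ⟨rfl, by simp⟩)), by omega,
      by omega⟩
    have := Nat.dvd_sub h2 (h1.mul_left 2)
    rwa [show 4 * (m + 1) - 2 * (2 * m + 1) = 2 by omega] at this
  · obtain ⟨m, rfl⟩ : ∃ m, q = 2 * m + 1 := ⟨q / 2, by omega⟩
    refine ⟨m, key _ 1 (fun g h1 h2 => ?_) (Or.inl rfl), by omega, by omega⟩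
    have := Nat.dvd_sub h2 (h1.mul_left 2)
    rwa [show 2 * m + 1 - 2 * m = 1 by omega] at this
  · by_cases h2 : q = 2
    · exact ⟨1, by simp, by omega, by omega⟩
    obtain ⟨m, rfl⟩ : ∃ m, q = 4 * (m + 1) + 2 := ⟨q / 4 - 1, by omega⟩
    refine ⟨2 * m + 1, key _ 4 (fun g h1 h2 => ?_) (Or.inr (Or.inr ⟨rfl, by simp⟩)), by omega,
      by omega⟩
    have := Nat.dvd_sub h2 (h1.mul_left 2)
    rwa [show 4 * (m + 1) + 2 - 2 * (2 * m + 1) = 4 by omega] at this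
  · obtain ⟨m, rfl⟩ : ∃ m, q = 2 * m + 1 := ⟨q / 2, by omega⟩
    refine ⟨m, key _ 1 (fun g h1 h2 => ?_) (Or.inl rfl), by omega, by omega⟩
    have := Nat.dvd_sub h2 (h1.mul_left 2)
    rwa [show 2 * m + 1 - 2 * m = 1 by omega] at this

/-- A nonintegral rational number can be multiplied into the middle of the unit interval
by an integer prime to a given common denominator. -/
theorem exists_unit_mul_mid {x : ℚ} (hx : ∀ m : ℤ, x ≠ m) {D : ℕ} (hD : 0 < D)
    (hDx : ∃ j : ℤ, D * x = j) :
    ∃ u m : ℤ, IsCoprime u (D : ℤ) ∧ 1 / 6 ≤ u * x + m ∧ u * x + m ≤ 5 / 6 := by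
  have hq2 : 2 ≤ x.den := by
    have h1 : x.den ≠ 1 := fun h => hx x.num ((Rat.den_eq_one_iff x).1 h).symm
    have := x.pos
    omega
  obtain ⟨y, hy, hy1, hy2⟩ := exists_coprime_mid hq2
  have hdvd : x.den ∣ D := by
    obtain ⟨j, hj⟩ := hDx
    have h1 : (D : ℚ) * x.num = j * x.den := by
      rw [← hj]
      conv_rhs => rw [mul_assoc, Rat.mul_den_eq_num]
    have h2 : (D : ℤ) * x.num = j * x.den := by exact_mod_cast h1
    have h3 : (x.den : ℤ) ∣ D := by
      have hc : IsCoprime (x.den : ℤ) x.num := by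
        rw [isCoprime_comm, Int.isCoprime_iff_gcd_eq_one]
        exact x.reduced
      exact hc.dvd_of_dvd_mul_right ⟨j, by rw [h2]; ring⟩
    exact_mod_cast h3
  have hcop : IsCoprime x.num (x.den : ℤ) := by
    rw [Int.isCoprime_iff_gcd_eq_one]
    exact x.reduced
  have : NeZero D := ⟨hD.ne'⟩
  let up : (ZMod x.den)ˣ := ((ZMod.coe_int_isUnit_iff_isCoprime x.num x.den).2 hcop.symm).unit
  let uy : (ZMod x.den)ˣ := ZMod.unitOfCoprime y hy
  -- Units modulo the denominator of x lift to units modulo D, so u can be prime to D and still send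
  -- x to y / den x modulo 1.
  obtain ⟨u, hu⟩ := ZMod.unitsMap_surjective hdvd (uy * up⁻¹)
  have hu1 : IsCoprime ((u : ZMod D).val : ℤ) (D : ℤ) :=
    Nat.isCoprime_iff_coprime.2 (ZMod.val_coe_unit_coprime u)
  have hu2 : (((u : ZMod D).val : ℤ) * x.num : ZMod x.den) = (y : ℤ) := by
    have h1 : ((((u : ZMod D).val : ℕ) : ZMod x.den)) = ((uy * up⁻¹ : (ZMod x.den)ˣ)) := by
      rw [← hu, ZMod.unitsMap_def, Units.coe_map]
      simp
    have h2 : ((up : (ZMod x.den)ˣ) : ZMod x.den) = x.num := rfl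
    push_cast
    rw [h1, ← h2, ← Units.val_mul, inv_mul_cancel_right]
    rfl
  have hu3 : ((((u : ZMod D).val : ℤ) * x.num : ℤ) : ZMod x.den) = ((y : ℤ) : ZMod x.den) := by
    rw [← hu2]; push_cast; rfl
  rw [ZMod.intCast_eq_intCast_iff_dvd_sub] at hu3
  obtain ⟨m, hm⟩ := hu3
  refine ⟨(u : ZMod D).val, m, hu1, ?_⟩
  have hden : (0 : ℚ) < x.den := by exact_mod_cast x.pos
  have h1 : (((u : ZMod D).val : ℤ) : ℚ) * x + m = y / x.den := by
    have hm' : (y : ℚ) - ((u : ZMod D).val : ℤ) * x.num = x.den * m := by exact_mod_cast hm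
    rw [eq_div_iff hden.ne', add_mul, mul_assoc, Rat.mul_den_eq_num]
    linear_combination -hm'
  rw [h1]
  have h2 : (x.den : ℚ) ≤ 6 * y := by exact_mod_cast hy1
  have h3 : (6 * y : ℚ) ≤ 5 * x.den := by exact_mod_cast hy2
  constructor
  · rw [le_div_iff₀ hden]; linarith
  · rw [div_le_iff₀ hden]; linarith

end Units

/-! ### Sums of fractional parts along a line -/

section Line

variable {v : Fin 5 → ℤ} {K : (Fin 5 → ℚ) → Prop}

/-- The bounds that hold for the directed sums of fractional parts of the points of a group `K`
of rational points: points whose coordinates in the directions fixed by `v` are not integral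
have directed sums greater than `11 / 6`. -/
structure HasLargeSums (v : Fin 5 → ℤ) (K : (Fin 5 → ℚ) → Prop) : Prop where
  add_smul : ∀ h, K h → ∀ q : ℚ, K fun i => h i + q * v i
  zsmul : ∀ h, K h → ∀ u : ℤ, K fun i => u * h i
  lt_sum : ∀ h, K h → (∀ i, v i = 0 → ∀ m : ℤ, h i ≠ m) →
    11 / 6 < ∑ i, directedFract (v i) (h i)
  lt_sum_neg : ∀ h, K h → (∀ i, v i = 0 → ∀ m : ℤ, h i ≠ m) →
    11 / 6 < ∑ i, directedFract (-v i) (h i)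

namespace HasLargeSums

variable (H : HasLargeSums v K) {h : Fin 5 → ℚ} (hK : K h)
  (hv : ∀ i, v i = 0 → ∀ m : ℤ, h i ≠ m)

include H hK hv

/-- The lower bound at -h gives this upper bound: negation reverses directions and replaces each
term by its complement to 1, and 5 - 11/6 = 19/6. -/
theorem sum_neg_lt : ∑ i, directedFract (-v i) (h i) < 19 / 6 := by
  have h1 := H.lt_sum _ (H.zsmul h hK (-1)) (fun i hi m hm => hv i hi (-m) (by
    push_cast at hm ⊢; linarith))
  have h2 : ∀ i, directedFract (v i) (((-1 : ℤ) : ℚ) * h i) = 1 - directedFract (-v i) (h i) := by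
    intro i
    rw [← directedFract_neg (hv i)]
    congr 1
    push_cast; ring
  simp only [h2, Finset.sum_sub_distrib] at h1
  simp at h1
  linarith

theorem sum_lt : ∑ i, directedFract (v i) (h i) < 19 / 6 := by
  have h1 := H.lt_sum_neg _ (H.zsmul h hK (-1)) (fun i hi m hm => hv i hi (-m) (by
    push_cast at hm ⊢; linarith))
  have h2 : ∀ i, directedFract (-v i) (((-1 : ℤ) : ℚ) * h i) = 1 - directedFract (v i) (h i) := by
    intro i
    have := directedFract_neg (n := -v i) (x := h i) fun hi => hv i (by omega)
    rw [neg_neg] at this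
    rw [← this]
    congr 1
    push_cast; ring
  simp only [h2, Finset.sum_sub_distrib] at h1
  simp at h1
  linarith

omit H hK hv in
theorem exists_sum_directedFract_eq (n : Fin 5 → ℤ) (h : Fin 5 → ℚ) :
    ∃ m : ℤ, ∑ i, directedFract (n i) (h i) = ∑ i, h i + m := by
  choose m hm using fun i => exists_directedFract_eq (n i) (h i)
  refine ⟨∑ i, m i, ?_⟩
  push_cast
  rw [← Finset.sum_add_distrib]
  exact Finset.sum_congr rfl fun i _ => hm i

omit H hK hv in
-- S and y differ by an integer, which lies strictly between 11/6 - 5/6 = 1 and 19/6 - 1/6 = 3. Here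
-- the constant 11/6 is just large enough.
theorem eq_two_add {S σ y : ℚ} {m n : ℤ} (hS : S = σ + m) (hy : y = σ + n) (h1 : 11 / 6 < S)
    (h2 : S < 19 / 6) (h3 : 1 / 6 ≤ y) (h4 : y ≤ 5 / 6) : S = 2 + y := by
  have h5 : S = y + (m - n : ℤ) := by rw [hS, hy]; push_cast; ring
  have h6 : (1 : ℚ) < (m - n : ℤ) := by linarith
  have h7 : ((m - n : ℤ) : ℚ) < 3 := by linarith
  have h8 : m - n = 2 := by
    have h6' : 1 < m - n := by exact_mod_cast h6
    have h7' : m - n < 3 := by exact_mod_cast h7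
    omega
  rw [h5, h8]; push_cast; ring

theorem sum_eq_of_mid {y : ℚ} {n : ℤ} (hy : y = ∑ i, h i + n) (h3 : 1 / 6 ≤ y) (h4 : y ≤ 5 / 6) :
    ∑ i, directedFract (v i) (h i) = 2 + y := by
  obtain ⟨m, hm⟩ := exists_sum_directedFract_eq v h
  exact eq_two_add hm hy (H.lt_sum h hK hv) (H.sum_lt hK hv) h3 h4

theorem sum_neg_eq_of_mid {y : ℚ} {n : ℤ} (hy : y = ∑ i, h i + n) (h3 : 1 / 6 ≤ y)
    (h4 : y ≤ 5 / 6) : ∑ i, directedFract (-v i) (h i) = 2 + y := by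
  obtain ⟨m, hm⟩ := exists_sum_directedFract_eq (fun i => -v i) h
  exact eq_two_add hm hy (H.lt_sum_neg h hK hv) (H.sum_neg_lt hK hv) h3 h4

/-- The two directed sums agree at points with nonintegral coordinate sum. -/
theorem sum_neg_eq_sum {D : ℕ} (hD : 0 < D) (hDh : ∀ i, ∃ j : ℤ, D * h i = j)
    (hσ : ∀ m : ℤ, ∑ i, h i ≠ m) :
    ∑ i, directedFract (-v i) (h i) = ∑ i, directedFract (v i) (h i) := by
  choose j hj using hDh
  -- At u h the coordinate sum is in the middle, so both directed sums equal the same 2 + y. As u is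
  -- prime to D, it preserves which coordinates are integral and hence every term of the difference.
  obtain ⟨u, m, hu, h1, h2⟩ := exists_unit_mul_mid hσ hD
    ⟨∑ i, j i, by rw [Finset.mul_sum]; push_cast; exact Finset.sum_congr rfl fun i _ => hj i⟩
  have h_int : ∀ i, (∃ l : ℤ, u * h i = l) → ∃ l : ℤ, h i = l := by
    rintro i ⟨l, hl⟩
    obtain ⟨x, y, hxy⟩ := hu
    refine ⟨x * l + y * j i, ?_⟩
    have hxy' : (x * u + y * D : ℚ) = 1 := by exact_mod_cast hxy
    push_cast
    linear_combination x * hl + y * hj i - h i * hxy'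
  have hv' : ∀ i, v i = 0 → ∀ m : ℤ, (u * h i : ℚ) ≠ m := fun i hi m hm => by
    obtain ⟨l, hl⟩ := h_int i ⟨m, hm⟩
    exact hv i hi l hl
  have e : (u * ∑ i, h i + m : ℚ) = ∑ i, u * h i + m := by rw [Finset.mul_sum]
  have hKu := H.zsmul h hK u
  have key : ∑ i, directedFract (-v i) (u * h i) = ∑ i, directedFract (v i) (u * h i) := by
    rw [H.sum_eq_of_mid hKu hv' e h1 h2, H.sum_neg_eq_of_mid hKu hv' e h1 h2]
  have hterm : ∀ i, directedFract (-v i) (u * h i) - directedFract (v i) (u * h i) =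
      directedFract (-v i) (h i) - directedFract (v i) (h i) := by
    intro i
    by_cases hi : ∃ l : ℤ, h i = l
    · obtain ⟨l, hl⟩ := hi
      have : (u * l : ℚ) = ((u * l : ℤ) : ℚ) := by push_cast; rfl
      rw [hl, this, directedFract_intCast, directedFract_intCast]
    · have h3 : ∀ l : ℤ, (u * h i : ℚ) ≠ l := fun l hl => hi (h_int i ⟨l, hl⟩)
      have h4 : ∀ l : ℤ, h i ≠ l := fun l hl => hi ⟨l, hl⟩
      rw [directedFract_of_notInt h3, directedFract_of_notInt h3, directedFract_of_notInt h4,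
        directedFract_of_notInt h4]
      ring
  have h5 : ∑ i, (directedFract (-v i) (h i) - directedFract (v i) (h i)) = 0 := by
    rw [← Finset.sum_congr rfl fun i _ => hterm i, Finset.sum_sub_distrib, key, sub_self]
  rw [Finset.sum_sub_distrib] at h5
  linarith

/-- The difference is an integer smaller than 19/6 - 11/6 = 4/3. -/
theorem sum_neg_sub_sum_le_one :
    ∑ i, directedFract (-v i) (h i) - ∑ i, directedFract (v i) (h i) ≤ 1 := by
  obtain ⟨m, hm⟩ := exists_sum_directedFract_eq v h
  obtain ⟨n, hn⟩ := exists_sum_directedFract_eq (fun i => -v i) h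
  have h1 := H.lt_sum h hK hv
  have h2 := H.sum_neg_lt hK hv
  have h3 : ∑ i, directedFract (-v i) (h i) - ∑ i, directedFract (v i) (h i) = (n - m : ℤ) := by
    rw [hm, hn]; push_cast; ring
  rw [h3]
  have h4 : ((n - m : ℤ) : ℚ) < 2 := by rw [← h3]; linarith
  have h5 : n - m < 2 := by exact_mod_cast h4
  exact_mod_cast (by omega : n - m ≤ 1)

/-- If the direction `v` has positive sum, every directed sum is at least two. -/
theorem two_le_sum (hs : 0 < ∑ i, v i) : 2 ≤ ∑ i, directedFract (v i) (h i) := by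
  set s := ∑ i, v i with hs_def
  obtain ⟨D, hD, hDh⟩ : ∃ D : ℕ, 0 < D ∧ ∀ i, ∃ j : ℤ, D * h i = j := by
    refine ⟨∏ i, (h i).den, Finset.prod_pos fun i _ => (h i).pos, fun i => ?_⟩
    obtain ⟨t, ht⟩ := Finset.dvd_prod_of_mem (fun i => (h i).den) (Finset.mem_univ i)
    refine ⟨t * (h i).num, ?_⟩
    rw [ht]
    push_cast
    rw [← Rat.mul_den_eq_num]
    ring
  choose j hj using hDh
  let T : ℤ := ∏ i, if v i = 0 then 1 else |v i|
  have hT : 0 < T := Finset.prod_pos fun i _ => by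
    split_ifs with hi
    · exact one_pos
    · exact abs_pos.2 hi
  have hTv : ∀ i, v i ≠ 0 → v i ∣ T := fun i hi => by
    have := Finset.dvd_prod_of_mem (fun i => if v i = 0 then (1 : ℤ) else |v i|)
      (Finset.mem_univ i)
    simp only [if_neg hi, abs_dvd] at this
    exact this
  have hD' : (0 : ℤ) < D := by exact_mod_cast hD
  -- The grid of step 1 / n contains every t at which some moving coordinate or the coordinate sum
  -- is integral. The factor 2 also puts a point with coordinate sum 1/2 on it.
  let n : ℤ := 2 * D * T * s
  have hn : 0 < n := by positivity
  have hnQ : (0 : ℚ) < n := by exact_mod_cast hn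
  let σ : ℚ := ∑ i, h i
  let x : ℤ → Fin 5 → ℚ := fun w i => h i + (w / n : ℚ) * v i
  have hx : ∀ w, K (x w) := fun w => H.add_smul h hK _
  have hxv : ∀ w i, v i = 0 → ∀ m : ℤ, x w i ≠ m := fun w i hi m => by
    simp only [x, hi, Int.cast_zero, mul_zero, add_zero]
    exact hv i hi m
  have hxσ : ∀ w, ∑ i, x w i = σ + (w / n : ℚ) * s := fun w => by
    simp only [x, Finset.sum_add_distrib, ← Finset.mul_sum, σ, hs_def]
    push_cast
    rfl
  have hxD : ∀ w i, ∃ l : ℤ, ((D * n.toNat : ℕ) : ℚ) * x w i = l := by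
    intro w i
    refine ⟨j i * n + D * w * v i, ?_⟩
    have hnn : ((n.toNat : ℕ) : ℚ) = n := by
      have := Int.toNat_of_nonneg hn.le
      exact_mod_cast this
    simp only [x]
    push_cast
    rw [hnn]
    field_simp
    linear_combination (n : ℚ) * hj i
  -- `Gp` and `Gm` are the right and left limits at t = w / n of ∑ {x_i} - {∑ x_i}.
  let Gp : ℤ → ℚ := fun w => ∑ i, directedFract (v i) (x w i) - directedFract s (∑ i, x w i)
  let Gm : ℤ → ℚ := fun w => ∑ i, directedFract (-v i) (x w i) - directedFract (-s) (∑ i, x w i)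
  -- Between consecutive grid points nothing crosses an integer, and the linear parts cancel because
  -- s is the sum of the v i.
  have hstep : ∀ w, Gm (w + 1) = Gp w := by
    intro w
    have e1 : ∀ i, directedFract (-v i) (x (w + 1) i) = directedFract (v i) (x w i) + v i / n := by
      intro i
      have e2 : x (w + 1) i = x w i + v i / n := by
        simp only [x]; push_cast; field_simp; ring
      rw [e2]
      by_cases hi : v i = 0
      · simp [hi]
      obtain ⟨t, ht⟩ := hTv i hi
      refine directedFract_neg_add_div (N := 2 * D * t * s) hn ?_ ⟨2 * j i * t * s + w, ?_⟩
      · simp only [n, ht]; ring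
      · have hni : (n : ℚ) = 2 * D * t * s * v i := by
          simp only [n, ht]; push_cast; ring
        simp only [x]
        push_cast
        have e3 : (w : ℚ) / n * v i * (2 * D * t * s) = w := by
          rw [div_mul_eq_mul_div, div_mul_eq_mul_div, div_eq_iff hnQ.ne', hni]; ring
        linear_combination e3 + (2 * t * s : ℚ) * hj i
    have e4 : directedFract (-s) (∑ i, x (w + 1) i) =
        directedFract s (∑ i, x w i) + s / n := by
      have e2 : ∑ i, x (w + 1) i = ∑ i, x w i + s / n := by
        rw [hxσ, hxσ]; push_cast; field_simp; ring
      rw [e2]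
      refine directedFract_neg_add_div (N := 2 * D * T) hn rfl ⟨2 * (∑ i, j i) * T + w, ?_⟩
      rw [hxσ]
      have hni : (n : ℚ) = 2 * D * T * s := by simp only [n]; push_cast; ring
      have e3 : (w : ℚ) / n * s * (2 * D * T) = w := by
        rw [div_mul_eq_mul_div, div_mul_eq_mul_div, div_eq_iff hnQ.ne', hni]; ring
      have e5 : (D : ℚ) * σ = ∑ i, (j i : ℚ) := by
        simp only [σ, Finset.mul_sum]
        exact Finset.sum_congr rfl fun i _ => hj i
      push_cast
      linear_combination e3 + (2 * T : ℚ) * e5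
    simp only [Gm, Gp, e1, e4, Finset.sum_add_distrib, ← Finset.sum_div]
    have : (∑ i, (v i : ℚ)) = s := by rw [hs_def]; push_cast; rfl
    rw [this]
    ring
  -- At an integral coordinate sum, {∑ x_i} drops by 1, which offsets a drop of at most 1 in ∑
  -- {x_i}. Elsewhere there is no jump.
  have hjump : ∀ w, Gm w ≤ Gp w := by
    intro w
    simp only [Gm, Gp]
    by_cases hσ : ∃ m : ℤ, ∑ i, x w i = m
    · obtain ⟨m, hm⟩ := hσ
      have e1 := H.sum_neg_sub_sum_le_one (hx w) (hxv w)
      have e2 := directedFract_intCast s m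
      rw [Int.sign_eq_one_of_pos hs] at e2
      rw [hm]
      push_cast at e2
      linarith
    · push Not at hσ
      rw [H.sum_neg_eq_sum (hx w) (hxv w)
        (Nat.mul_pos hD (by omega : 0 < n.toNat)) (hxD w) hσ, directedFract_of_notInt hσ,
        directedFract_of_notInt hσ]
  have hmono : Monotone Gm := monotone_int_of_le_succ fun w => (hjump w).trans (hstep w).ge
  have hper : ∀ w (k : ℤ), Gm (w + k * n) = Gm w := by
    intro w k
    have e1 : ∀ i, x (w + k * n) i = x w i + ((k * v i : ℤ) : ℚ) := fun i => by
      simp only [x]; push_cast; field_simp; ring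
    have e2 : ∑ i, x (w + k * n) i = ∑ i, x w i + ((k * s : ℤ) : ℚ) := by
      rw [hxσ, hxσ]; push_cast; field_simp; ring
    simp only [Gm, e2, directedFract_add_intCast]
    simp only [e1, directedFract_add_intCast]
  have hle : ∀ w w', Gm w ≤ Gm w' := by
    intro w w'
    rw [← hper w' |w - w'|]
    refine hmono ?_
    have h1 : w - w' ≤ |w - w'| := le_abs_self _
    have h2 : |w - w'| * 1 ≤ |w - w'| * n := mul_le_mul_of_nonneg_left hn (abs_nonneg _)
    linarith
  -- The solution w of σ + (w / n) s = 1/2.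
  let w₁ : ℤ := D * T - 2 * T * ∑ i, j i
  have e5 : (D : ℚ) * σ = ∑ i, (j i : ℚ) := by
    simp only [σ, Finset.mul_sum]
    exact Finset.sum_congr rfl fun i _ => hj i
  have hmid : ∑ i, x w₁ i = 1 / 2 := by
    rw [hxσ]
    have hTQ : (T : ℚ) ≠ 0 := by exact_mod_cast hT.ne'
    have hDQ : (D : ℚ) ≠ 0 := by exact_mod_cast hD.ne'
    have hsQ : (s : ℚ) ≠ 0 := by exact_mod_cast hs.ne'
    simp only [w₁, n]
    push_cast
    rw [← e5]
    field_simp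
    ring
  have hval : Gp w₁ = 2 := by
    have e1 := H.sum_eq_of_mid (hx w₁) (hxv w₁) (y := 1 / 2) (n := 0) (by rw [hmid]; simp)
      (by norm_num) (by norm_num)
    simp only [Gp]
    rw [e1, hmid, directedFract_of_nonneg hs.le]
    have : Int.fract (1 / 2 : ℚ) = 1 / 2 := Int.fract_eq_self.2 ⟨by norm_num, by norm_num⟩
    rw [this]; ring
  have h0 : Gp 0 = 2 := by
    rw [← hval, ← hstep, ← hstep]
    exact le_antisymm (hle _ _) (hle _ _)
  have hx0 : ∀ i, x 0 i = h i := fun i => by simp [x]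
  have h1 := directedFract_nonneg s (∑ i, x 0 i)
  simp only [Gp, hx0] at h0 h1
  linarith

end HasLargeSums

end Line

/-! ### A uniform Kronecker theorem by a moment argument -/

section Equidistribution

open Finset

/-- The character `t ↦ exp (2πit)`. -/
def unitChar (t : ℝ) : ℂ := Complex.exp (2 * Real.pi * Complex.I * t)

theorem unitChar_add (s t : ℝ) : unitChar (s + t) = unitChar s * unitChar t := by
  rw [unitChar, unitChar, unitChar, ← Complex.exp_add]
  congr 1; push_cast; ring

theorem unitChar_zero : unitChar 0 = 1 := by simp [unitChar]

theorem unitChar_intCast (n : ℤ) : unitChar n = 1 := by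
  rw [unitChar, Complex.exp_eq_one_iff]
  exact ⟨n, by push_cast; ring⟩

theorem unitChar_sum {ι : Type*} (s : Finset ι) (f : ι → ℝ) :
    unitChar (∑ i ∈ s, f i) = ∏ i ∈ s, unitChar (f i) := by
  classical
  induction s using Finset.induction_on with
  | empty => simp [unitChar_zero]
  | insert i s hi ih => rw [sum_insert hi, prod_insert hi, unitChar_add, ih]

theorem unitChar_eq (t : ℝ) : unitChar t =
    (Real.cos (2 * Real.pi * t) : ℂ) + (Real.sin (2 * Real.pi * t) : ℂ) * Complex.I := by
  rw [unitChar, show (2 * Real.pi * Complex.I * t : ℂ) = ((2 * Real.pi * t : ℝ) : ℂ) * Complex.I by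
    push_cast; ring, Complex.exp_mul_I]
  push_cast
  rfl

theorem norm_unitChar (t : ℝ) : ‖unitChar t‖ = 1 := by
  rw [unitChar, show (2 * Real.pi * Complex.I * t : ℂ) = ((2 * Real.pi * t : ℝ) : ℂ) * Complex.I by
    push_cast; ring, Complex.norm_exp_ofReal_mul_I]

theorem conj_unitChar (t : ℝ) : (starRingEnd ℂ) (unitChar t) = unitChar (-t) := by
  rw [unitChar_eq, unitChar_eq, mul_neg, Real.cos_neg, Real.sin_neg, map_add, map_mul,
    Complex.conj_ofReal, Complex.conj_ofReal, Complex.conj_I]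
  push_cast
  ring

theorem unitChar_eq_one_iff (t : ℝ) : unitChar t = 1 ↔ ∃ n : ℤ, t = n := by
  constructor
  · intro h
    rw [unitChar, Complex.exp_eq_one_iff] at h
    obtain ⟨n, hn⟩ := h
    refine ⟨n, ?_⟩
    have h1 : (2 * Real.pi * Complex.I : ℂ) ≠ 0 := Complex.two_pi_I_ne_zero
    have h2 : (t : ℂ) = n := mul_left_cancel₀ h1 (by rw [hn]; ring)
    exact_mod_cast h2
  · rintro ⟨n, rfl⟩
    exact unitChar_intCast n

/-- Orthogonality of characters of ℤ/r, by summing a geometric series. -/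
theorem sum_unitChar_div {r : ℕ} (hr : 0 < r) (q : ℤ) :
    ∑ k ∈ range r, unitChar (k * q / r) = if (r : ℤ) ∣ q then (r : ℂ) else 0 := by
  have hr' : (r : ℝ) ≠ 0 := by exact_mod_cast hr.ne'
  have h1 : ∀ k : ℕ, unitChar (k * q / r) = unitChar (q / r) ^ k := by
    intro k
    induction k with
    | zero => simp [unitChar_zero]
    | succ k ih =>
      rw [pow_succ, ← ih, ← unitChar_add]
      congr 1; push_cast; ring
  simp only [h1]
  split_ifs with hd
  · obtain ⟨n, rfl⟩ := hd
    have : unitChar (((r * n : ℤ) : ℝ) / r) = 1 := by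
      rw [show (((r * n : ℤ) : ℝ) / r) = (n : ℝ) by push_cast; field_simp]
      exact unitChar_intCast n
    simp only [this, one_pow, sum_const, card_range, nsmul_eq_mul, mul_one]
  · have hne : unitChar (q / r) ≠ 1 := by
      intro h
      obtain ⟨n, hn⟩ := (unitChar_eq_one_iff _).1 h
      rw [div_eq_iff hr'] at hn
      exact hd ⟨n, by rw [mul_comm]; exact_mod_cast hn⟩
    rw [geom_sum_eq hne, ← h1, show ((r : ℕ) * q / r : ℝ) = q by field_simp, unitChar_intCast,
      sub_self, zero_div]

variable {d : ℕ}

/-- The trigonometric polynomial `1 + ∑ exp (2πi y_i)`, which is largest at integral points. -/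
def peak (y : Fin d → ℝ) : ℂ := ∑ o : Option (Fin d), unitChar (o.elim 0 y)

/-- The exponents of the monomial given by a word in the terms of `peak`. -/
def wordExponent {p : ℕ} (w : Fin p → Option (Fin d)) (i : Fin d) : ℕ :=
  #{t | w t = some i}

theorem wordExponent_le {p : ℕ} (w : Fin p → Option (Fin d)) (i : Fin d) :
    wordExponent w i ≤ p :=
  (card_filter_le _ _).trans (by simp)

theorem peak_pow (y : Fin d → ℝ) (p : ℕ) :
    peak y ^ p = ∑ w : Fin p → Option (Fin d), unitChar (∑ i, wordExponent w i * y i) := by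
  rw [peak, Fintype.sum_pow]
  refine sum_congr rfl fun w _ => ?_
  rw [← unitChar_sum]
  congr 1
  have h1 : ∀ t, (w t).elim 0 y = ∑ i, if w t = some i then y i else 0 := by
    intro t
    cases h : w t with
    | none => simp
    | some j => simp
  simp only [h1, wordExponent]
  rw [sum_comm]
  refine sum_congr rfl fun i _ => ?_
  rw [← sum_filter, sum_const, nsmul_eq_mul]

/-- Cauchy–Schwarz: the (d + 1) ^ p words fall into at most (p + 1) ^ d classes by exponent vector.
-/
theorem card_pow_le_pairs (p : ℕ) : (d + 1) ^ (2 * p) ≤ (p + 1) ^ d *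
    #{x : (Fin p → Option (Fin d)) × (Fin p → Option (Fin d)) |
      wordExponent x.1 = wordExponent x.2} := by
  let W := Fin p → Option (Fin d)
  let box : Finset (Fin d → ℕ) := Fintype.piFinset fun _ => range (p + 1)
  have hbox : ∀ w ∈ (univ : Finset W), wordExponent w ∈ box := fun w _ => by
    simp only [box, Fintype.mem_piFinset, mem_range]
    exact fun i => Nat.lt_succ_of_le (wordExponent_le w i)
  have hcard : #(univ : Finset W) = (d + 1) ^ p := by simp [W]
  have h1 : #(univ : Finset W) = ∑ b ∈ box, #{w : W | wordExponent w = b} :=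
    card_eq_sum_card_fiberwise hbox
  have h2 : #{x : W × W | wordExponent x.1 = wordExponent x.2} =
      ∑ b ∈ box, #{w : W | wordExponent w = b} ^ 2 := by
    rw [card_eq_sum_card_fiberwise (f := fun x : W × W => wordExponent x.1) (t := box)
      fun x _ => hbox x.1 (mem_univ _)]
    refine sum_congr rfl fun b _ => ?_
    rw [sq, ← card_product]
    congr 1
    ext x
    simp only [mem_filter, mem_univ, true_and, mem_product]
    constructor
    · rintro ⟨h, h'⟩
      exact ⟨h', h ▸ h'⟩
    · rintro ⟨h, h'⟩
      exact ⟨h.trans h'.symm, h⟩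
  have h3 := sq_sum_le_card_mul_sum_sq (s := box) (f := fun b => #{w : W | wordExponent w = b})
  rw [← h1, ← h2, hcard, ← pow_mul, mul_comm p 2] at h3
  simpa [box] using h3

/-- If every integral relation of size at most `p` among the `a i` modulo `r` is satisfied by
`x`, then `peak` cannot be small at all the points `k a / r - x`. -/
theorem pow_le_of_forall_norm_peak_le {r : ℕ} (hr : 0 < r) (a : Fin d → ℤ) (x : Fin d → ℝ) (p : ℕ)
    (hx : ∀ m : Fin d → ℤ, (∀ i, |m i| ≤ p) → (r : ℤ) ∣ ∑ i, m i * a i →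
      ∃ n : ℤ, ∑ i, m i * x i = n) {R : ℝ}
    (hR : ∀ k : ℕ, ‖peak fun i => k * a i / r - x i‖ ≤ R) :
    ((d : ℝ) + 1) ^ (2 * p) ≤ (p + 1) ^ d * R ^ (2 * p) := by
  let W := Fin p → Option (Fin d)
  have hr' : (0 : ℝ) < r := by exact_mod_cast hr
  let y : ℕ → Fin d → ℝ := fun k i => k * a i / r - x i
  let P : Finset (W × W) := {z | (r : ℤ) ∣ ∑ i, ((wordExponent z.1 i : ℤ) -
    wordExponent z.2 i) * a i}
  have hpair : ∀ w w' : W, ∑ k ∈ range r, unitChar (∑ i, wordExponent w i * y k i) *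
      (starRingEnd ℂ) (unitChar (∑ i, wordExponent w' i * y k i)) =
      if (w, w') ∈ P then (r : ℂ) else 0 := by
    intro w w'
    set m : Fin d → ℤ := fun i => (wordExponent w i : ℤ) - wordExponent w' i with hm
    have h1 : ∀ k ∈ range r, unitChar (∑ i, wordExponent w i * y k i) *
        (starRingEnd ℂ) (unitChar (∑ i, wordExponent w' i * y k i)) =
        unitChar (k * (∑ i, m i * a i : ℤ) / r) * unitChar (-∑ i, m i * x i) := by
      intro k _
      rw [conj_unitChar, ← unitChar_add, ← unitChar_add]
      congr 1
      push_cast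
      rw [mul_sum, sum_div, ← sub_eq_add_neg, ← sub_eq_add_neg, ← sum_sub_distrib,
        ← sum_sub_distrib]
      refine sum_congr rfl fun i _ => ?_
      simp only [y, hm]
      push_cast
      ring
    rw [sum_congr rfl h1, ← sum_mul, sum_unitChar_div hr]
    have h2 : (w, w') ∈ P ↔ (r : ℤ) ∣ ∑ i, m i * a i := by simp [P, hm]
    by_cases hd : (r : ℤ) ∣ ∑ i, m i * a i
    · rw [if_pos hd, if_pos (h2.2 hd)]
      obtain ⟨n, hn⟩ := hx m (fun i => by
        have h3 := wordExponent_le w i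
        have h4 := wordExponent_le w' i
        simp only [hm]
        rw [abs_le]
        constructor <;> omega) hd
      rw [hn, show (-(n : ℝ)) = ((-n : ℤ) : ℝ) by push_cast; ring, unitChar_intCast, mul_one]
    · rw [if_neg hd, if_neg (fun h => hd (h2.1 h)), zero_mul]
  -- The 2p-th moment counts the pairs of words whose exponent difference is a relation modulo r. By
  -- `hx` each such pair contributes with phase 1, so nothing cancels.
  have htotal : ∑ k ∈ range r, ‖peak (y k)‖ ^ (2 * p) = r * (#P : ℝ) := by
    have h1 : ∑ k ∈ range r, ((‖peak (y k)‖ ^ (2 * p) : ℝ) : ℂ) = r * (#P : ℂ) := by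
      have h2 : ∀ k, ((‖peak (y k)‖ ^ (2 * p) : ℝ) : ℂ) = ∑ w : W, ∑ w' : W,
          unitChar (∑ i, wordExponent w i * y k i) *
            (starRingEnd ℂ) (unitChar (∑ i, wordExponent w' i * y k i)) := by
        intro k
        rw [← sum_mul_sum, ← map_sum, ← peak_pow, Complex.mul_conj, Complex.normSq_eq_norm_sq,
          norm_pow, ← pow_mul, mul_comm p 2]
      simp only [h2]
      rw [sum_comm]
      simp_rw [sum_comm (s := range r), hpair]
      rw [← sum_product', univ_product_univ]
      simp [mul_comm]
    exact_mod_cast h1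
  have hle : ∑ k ∈ range r, ‖peak (y k)‖ ^ (2 * p) ≤ r * R ^ (2 * p) := by
    calc ∑ k ∈ range r, ‖peak (y k)‖ ^ (2 * p) ≤ ∑ _k ∈ range r, R ^ (2 * p) :=
          sum_le_sum fun k _ => pow_le_pow_left₀ (norm_nonneg _) (hR k) _
      _ = r * R ^ (2 * p) := by simp
  rw [htotal] at hle
  have hP : (#P : ℝ) ≤ R ^ (2 * p) := le_of_mul_le_mul_left hle hr'
  have hsub : #{z : W × W | wordExponent z.1 = wordExponent z.2} ≤ #P := by
    refine card_le_card fun z hz => ?_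
    simp only [mem_filter, mem_univ, true_and] at hz
    simp [P, hz]
  calc ((d : ℝ) + 1) ^ (2 * p) ≤ (p + 1) ^ d *
        (#{z : W × W | wordExponent z.1 = wordExponent z.2} : ℝ) := by
        exact_mod_cast card_pow_le_pairs (d := d) p
    _ ≤ (p + 1) ^ d * R ^ (2 * p) := by
        refine mul_le_mul_of_nonneg_left (le_trans ?_ hP) (by positivity)
        exact_mod_cast hsub

/-- `peak` is bounded away from its maximum away from the integral points. -/
theorem exists_norm_peak_le {η : ℝ} (hη : 0 < η) : ∃ R : ℝ, 0 < R ∧ R < d + 1 ∧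
    ∀ (y : Fin d → ℝ) (i : Fin d), (∀ n : ℤ, η ≤ |y i - n|) → ‖peak y‖ ≤ R := by
  set η' := min η (1 / 2) with hη'
  have h0 : 0 < η' := lt_min hη (by norm_num)
  have h12 : η' ≤ 1 / 2 := min_le_right _ _
  have hpi := Real.pi_pos
  set ρ := Real.sqrt (2 + 2 * Real.cos (2 * Real.pi * η')) with hρ
  have hcos : Real.cos (2 * Real.pi * η') < 1 := by
    have := Real.strictAntiOn_cos (a := 0) (b := 2 * Real.pi * η') ⟨le_rfl, hpi.le⟩
      ⟨by positivity, by nlinarith⟩ (by positivity)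
    simpa using this
  have hρ2 : ρ < 2 := by
    rw [hρ, Real.sqrt_lt' (by norm_num)]
    linarith
  have hρ0 : 0 ≤ ρ := Real.sqrt_nonneg _
  have hmain : ∀ (y : Fin d → ℝ) (i : Fin d), (∀ n : ℤ, η ≤ |y i - n|) →
      ‖peak y‖ ≤ d - 1 + ρ := by
    intro y i hy
    have h1 : ‖1 + unitChar (y i)‖ ≤ ρ := by
      have h2 : ‖1 + unitChar (y i)‖ ^ 2 = 2 + 2 * Real.cos (2 * Real.pi * y i) := by
        rw [← Complex.normSq_eq_norm_sq, unitChar_eq, Complex.normSq_apply]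
        have := Real.sin_sq_add_cos_sq (2 * Real.pi * y i)
        simp only [Complex.add_re, Complex.add_im, Complex.one_re, Complex.one_im,
          Complex.ofReal_re, Complex.ofReal_im, Complex.mul_re, Complex.mul_im, Complex.I_re,
          Complex.I_im]
        linarith [this]
      have h3 : Real.cos (2 * Real.pi * y i) ≤ Real.cos (2 * Real.pi * η') := by
        set u := y i - round (y i) with hu
        have hu1 : |u| ≤ 1 / 2 := abs_sub_round _
        have hu2 : η' ≤ |u| := (min_le_left _ _).trans (hy _)
        have e1 : Real.cos (2 * Real.pi * y i) = Real.cos (2 * Real.pi * |u|) := by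
          have : Real.cos (2 * Real.pi * |u|) = Real.cos (2 * Real.pi * u) := by
            rw [← Real.cos_abs (2 * Real.pi * u), abs_mul,
              abs_of_pos (show 0 < 2 * Real.pi by positivity)]
          rw [this, hu, mul_sub, mul_comm (2 * Real.pi) (round (y i) : ℝ),
            Real.cos_sub_int_mul_two_pi]
        rw [e1]
        refine Real.antitoneOn_cos ⟨by positivity, by nlinarith⟩ ⟨by positivity, by nlinarith⟩ ?_
        exact mul_le_mul_of_nonneg_left hu2 (by positivity)
      rw [hρ]
      refine Real.le_sqrt_of_sq_le ?_
      rw [h2]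
      linarith
    have h4 : peak y = (1 + unitChar (y i)) + ∑ j ∈ univ.erase i, unitChar (y j) := by
      rw [peak, Fintype.sum_option, ← add_sum_erase _ _ (mem_univ i)]
      simp [unitChar_zero, add_assoc]
    rw [h4]
    have h5 : ‖∑ j ∈ univ.erase i, unitChar (y j)‖ ≤ (d : ℝ) - 1 := by
      refine (norm_sum_le _ _).trans ?_
      have : 1 ≤ d := i.pos
      simp [norm_unitChar, card_erase_of_mem, Nat.cast_sub this]
    linarith [norm_add_le (1 + unitChar (y i)) (∑ j ∈ univ.erase i, unitChar (y j))]
  -- The maximum with 1/2 only keeps the bound positive in small dimension.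
  refine ⟨max (d - 1 + ρ) (1 / 2), lt_max_of_lt_right (by norm_num), max_lt (by linarith) ?_,
    fun y i hy => (hmain y i hy).trans (le_max_left _ _)⟩
  have : (0 : ℝ) ≤ d := Nat.cast_nonneg d
  linarith

/-- Quantitative form of Kronecker's theorem, uniform in `r` and `a`: a point satisfying all small
integral relations between the `a i` modulo `r` is close to a multiple of `a / r`. -/
theorem exists_forall_close (d : ℕ) {η : ℝ} (hη : 0 < η) : ∃ p : ℕ, ∀ (r : ℕ) (a : Fin d → ℤ)
    (x : Fin d → ℝ), 0 < r → (∀ m : Fin d → ℤ, (∀ i, |m i| ≤ p) → (r : ℤ) ∣ ∑ i, m i * a i →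
      ∃ n : ℤ, ∑ i, m i * x i = n) →
    ∃ k : ℕ, ∀ i, ∃ n : ℤ, |(k * a i / r : ℝ) - x i - n| < η := by
  obtain ⟨R, hR0, hR, hpeak⟩ := exists_norm_peak_le (d := d) hη
  have hd : (0 : ℝ) < d + 1 := by positivity
  set ρ := (R / (d + 1)) ^ 2 with hρ
  have hρ0 : 0 ≤ ρ := sq_nonneg _
  have hρ1 : ρ < 1 := by
    rw [hρ, sq_lt_one_iff₀ (by positivity), div_lt_one hd]
    exact hR
  -- Exponential decay beats the polynomial loss of Cauchy–Schwarz. The choice of p depends only on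
  -- d and η, which gives uniformity in r and a.
  obtain ⟨p, hp⟩ : ∃ p : ℕ, ((p : ℝ) + 1) ^ d * ρ ^ p < 1 := by
    have h1 := tendsto_pow_const_mul_const_pow_of_abs_lt_one d
      (by rwa [abs_of_nonneg hρ0] : |ρ| < 1)
    rcases hρ0.eq_or_lt with h | h
    · refine ⟨1, ?_⟩
      rw [← h]; simp
    have h2 := (h1.comp (Filter.tendsto_add_atTop_nat 1)).eventually (gt_mem_nhds h)
    obtain ⟨p, hp⟩ := h2.exists
    refine ⟨p, ?_⟩
    simp only [Function.comp_apply, pow_succ ρ p] at hp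
    push_cast at hp
    have : ((p : ℝ) + 1) ^ d * ρ ^ p * ρ < 1 * ρ := by linarith
    exact lt_of_mul_lt_mul_right this h.le
  refine ⟨p, fun r a x hr hx => ?_⟩
  by_contra hcon
  push Not at hcon
  have h1 := pow_le_of_forall_norm_peak_le hr a x p hx (R := R) fun k => by
    obtain ⟨i, hi⟩ := hcon k
    exact hpeak _ i hi
  have h2 : R ^ (2 * p) = ρ ^ p * (d + 1) ^ (2 * p) := by
    rw [hρ, ← pow_mul, div_pow]
    field_simp
  rw [h2, ← mul_assoc] at h1
  have h3 : (0 : ℝ) < ((d : ℝ) + 1) ^ (2 * p) := by positivity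
  have h4 := mul_lt_mul_of_pos_right hp h3
  linarith

end Equidistribution

/-! ### The compactness argument -/

open Filter Topology

/-- A vector that is not torsion modulo `L` is detected by a functional vanishing on `L`. -/
theorem exists_functional_ne_zero {d : ℕ} (L : Submodule ℤ (Fin d → ℤ)) (x : Fin d → ℤ)
    (hx : ∀ N : ℤ, N ≠ 0 → N • x ∉ L) :
    ∃ φ : (Fin d → ℤ) →ₗ[ℤ] ℤ, (∀ m ∈ L, φ m = 0) ∧ φ x ≠ 0 := by
  let Q := (Fin d → ℤ) ⧸ L
  -- Modulo torsion the quotient is free, and some coordinate of the nonzero class of x is nonzero.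
  let T := Submodule.torsion ℤ Q
  let b := Module.Free.chooseBasis ℤ (Q ⧸ T)
  have h1 : T.mkQ (L.mkQ x) ≠ 0 := by
    intro h
    rw [Submodule.mkQ_apply, Submodule.Quotient.mk_eq_zero] at h
    obtain ⟨N, hN⟩ := (Submodule.mem_torsion_iff _).1 h
    refine hx N (nonZeroDivisors.coe_ne_zero N) ?_
    rw [← Submodule.Quotient.mk_eq_zero, Submodule.Quotient.mk_smul]
    exact hN
  obtain ⟨i, hi⟩ : ∃ i, b.repr (T.mkQ (L.mkQ x)) i ≠ 0 := by
    by_contra hcon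
    push Not at hcon
    exact h1 (b.repr.map_eq_zero_iff.1 (Finsupp.ext hcon))
  refine ⟨b.coord i ∘ₗ T.mkQ ∘ₗ L.mkQ, fun m hm => ?_, hi⟩
  have : L.mkQ m = 0 := by rwa [Submodule.mkQ_apply, Submodule.Quotient.mk_eq_zero]
  rw [LinearMap.comp_apply, LinearMap.comp_apply, this, map_zero, map_zero]

/-- The directed fractional part is a one-sided limit of fractional parts. -/
theorem eventually_fract_add_mul {n : ℤ} {x : ℚ} (h : n = 0 → ∀ m : ℤ, x ≠ m) :
    ∀ᶠ t : ℝ in 𝓝[>] 0, (∀ m : ℤ, (x : ℝ) + t * n ≠ m) ∧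
      Int.fract ((x : ℝ) + t * n) = (directedFract n x : ℝ) + t * n := by
  have hcont : Tendsto (fun t : ℝ => (directedFract n x : ℝ) + t * n) (𝓝[>] 0)
      (𝓝 (directedFract n x : ℝ)) := by
    have : Tendsto (fun t : ℝ => (directedFract n x : ℝ) + t * n) (𝓝 0)
        (𝓝 ((directedFract n x : ℝ) + 0 * n)) := by
      apply Continuous.tendsto
      fun_prop
    rw [zero_mul, add_zero] at this
    exact this.mono_left nhdsWithin_le_nhds
  have hpos : ∀ᶠ t : ℝ in 𝓝[>] 0, 0 < t := self_mem_nhdsWithin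
  have hlow : ∀ᶠ t : ℝ in 𝓝[>] 0, 0 < (directedFract n x : ℝ) + t * n := by
    rcases (directedFract_nonneg n x).eq_or_lt with h0 | h0
    · have hn : 0 < n := by
        rcases lt_trichotomy n 0 with hn | hn | hn
        · rw [directedFract_of_neg hn] at h0
          linarith [Int.fract_lt_one (-x)]
        · rw [directedFract_of_nonneg hn.ge] at h0
          obtain ⟨m, hm⟩ := Int.fract_eq_zero_iff.1 h0.symm
          exact absurd hm.symm (h hn m)
        · exact hn
      rw [← h0]
      filter_upwards [hpos] with t ht
      have : (0 : ℝ) < n := by exact_mod_cast hn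
      simp only [Rat.cast_zero, zero_add]
      positivity
    · exact hcont.eventually (lt_mem_nhds (by exact_mod_cast h0))
  have hup : ∀ᶠ t : ℝ in 𝓝[>] 0, (directedFract n x : ℝ) + t * n < 1 := by
    by_cases hn : 0 ≤ n
    · refine hcont.eventually (gt_mem_nhds ?_)
      rw [directedFract_of_nonneg hn]
      exact_mod_cast Int.fract_lt_one x
    · rw [directedFract_of_neg (not_le.1 hn)]
      filter_upwards [hpos] with t ht
      have h1 : (n : ℝ) < 0 := by exact_mod_cast not_le.1 hn
      have h2 : (0 : ℝ) ≤ (Int.fract (-x) : ℚ) := by exact_mod_cast Int.fract_nonneg (-x)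
      push_cast at h2 ⊢
      nlinarith
  obtain ⟨m, hm⟩ := exists_directedFract_eq n x
  filter_upwards [hlow, hup] with t h1 h2
  have hf : Int.fract ((x : ℝ) + t * n) = (directedFract n x : ℝ) + t * n := by
    rw [Int.fract_eq_iff]
    refine ⟨h1.le, h2, -m, ?_⟩
    rw [hm]; push_cast; ring
  refine ⟨fun l hl => ?_, hf⟩
  rw [hl, Int.fract_intCast] at hf
  linarith

/-- If `y` is within `η` of `x` modulo the integers and `x` is at least `η` away from
the integers, then the fractional parts differ by less than `η`. -/
theorem fract_eq_of_close {x y η : ℝ} {n : ℤ} (h : |y - x - n| < η) (h0 : η < Int.fract x)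
    (h1 : η < 1 - Int.fract x) :
    (∀ m : ℤ, y ≠ m) ∧ Int.fract y < Int.fract x + η := by
  rw [abs_lt] at h
  have hf : Int.fract y = Int.fract x + (y - x - n) := by
    rw [Int.fract_eq_iff]
    exact ⟨by linarith, by linarith, n + ⌊x⌋, by rw [Int.fract]; push_cast; ring⟩
  refine ⟨fun m hm => ?_, by linarith⟩
  have : Int.fract y = 0 := by rw [hm, Int.fract_intCast]
  linarith

/-- The order of a cyclic quotient is bounded if all nonintegral multiples have fractional
parts with sum at least `11 / 6 + ε` and some such sum is less than two. -/
theorem exists_bound {ε : ℝ} (hε : 0 < ε) : ∃ N : ℕ, ∀ (r : ℕ) (a : Fin 5 → ℤ), 0 < r →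
    IsCoprime (r : ℤ) (∑ i, a i) →
    (∀ k : ℤ, (∀ i, ¬ (r : ℤ) ∣ k * a i) → 11 / 6 + ε ≤ ∑ i, Int.fract ((k * a i : ℝ) / r)) →
    (∃ k : ℤ, (∀ i, ¬ (r : ℤ) ∣ k * a i) ∧ ∑ i, Int.fract ((k * a i : ℚ) / r) < 2) →
    r ≤ N := by
  by_contra hcon
  push Not at hcon
  choose r a hr hcop hbig hsmall hlt using hcon
  -- For each m, the ultrafilter decides whether r_j ∣ m·a_j holds for almost all j or fails for
  -- almost all j. Thus L is a limit of the relation lattices without passing to subsequences.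
  let U : Ultrafilter ℕ := hyperfilter ℕ
  have hU : ∀ n : ℕ, ∀ᶠ j in (U : Filter ℕ), n ≤ j := fun n =>
    (Nat.hyperfilter_le_atTop : (U : Filter ℕ) ≤ atTop) (eventually_ge_atTop n)
  let L : Submodule ℤ (Fin 5 → ℤ) :=
    { carrier := {m | ∀ᶠ j in (U : Filter ℕ), (r j : ℤ) ∣ ∑ i, m i * a j i}
      add_mem' := fun {m n} hm hn => by
        filter_upwards [hm, hn] with j h1 h2
        simp only [Pi.add_apply, add_mul, Finset.sum_add_distrib]
        exact dvd_add h1 h2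
      zero_mem' := by simp
      smul_mem' := fun q m hm => by
        filter_upwards [hm] with j h1
        simp only [Pi.smul_apply, smul_eq_mul, mul_assoc, ← Finset.mul_sum]
        exact h1.mul_left q }
  -- Finite generation of L lets one index serve all its relations simultaneously.
  have hL : ∀ᶠ j in (U : Filter ℕ), ∀ m ∈ L, (r j : ℤ) ∣ ∑ i, m i * a j i := by
    obtain ⟨S, hS⟩ := IsNoetherian.noetherian L
    have h1 : ∀ᶠ j in (U : Filter ℕ), ∀ m ∈ S, (r j : ℤ) ∣ ∑ i, m i * a j i :=
      (eventually_all_finset S).2 fun m hm => (hS ▸ Submodule.subset_span hm : m ∈ L)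
    filter_upwards [h1] with j hj m hm
    rw [← hS] at hm
    induction hm using Submodule.span_induction with
    | mem m hm => exact hj m hm
    | zero => simp
    | add m n _ _ h1 h2 =>
      simp only [Pi.add_apply, add_mul, Finset.sum_add_distrib]
      exact dvd_add h1 h2
    | smul q m _ h1 =>
      simp only [Pi.smul_apply, smul_eq_mul, mul_assoc, ← Finset.mul_sum]
      exact h1.mul_left q
  -- A functional vanishing on `L` and positive on the sum of the basis vectors.
  obtain ⟨φ, hφL, hφ⟩ : ∃ φ : (Fin 5 → ℤ) →ₗ[ℤ] ℤ, (∀ m ∈ L, φ m = 0) ∧ 0 < φ 1 := by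
    -- If N (1, …, 1) were in L, then r_j would divide N ∑ a_i, hence N, for arbitrarily large j,
    -- although r_j > j.
    obtain ⟨φ, h1, h2⟩ := exists_functional_ne_zero L 1 fun N hN hmem => by
      obtain ⟨j, hj1, hj2⟩ := ((hU N.natAbs).and hmem).exists
      have h3 : (r j : ℤ) ∣ N := by
        refine (hcop j).dvd_of_dvd_mul_right ?_
        simpa [Finset.mul_sum] using hj2
      have h4 := Int.natAbs_dvd_natAbs.2 h3
      have h5 := Nat.le_of_dvd (Int.natAbs_pos.2 hN) h4
      have h6 := hlt j
      simp only [Int.natAbs_natCast] at h5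
      omega
    rcases lt_or_gt_of_ne h2 with h | h
    · exact ⟨-φ, fun m hm => by simp [h1 m hm], by simpa using h⟩
    · exact ⟨φ, h1, h⟩
  let v : Fin 5 → ℤ := fun i => φ (Pi.single i 1)
  have hφv : ∀ m, φ m = ∑ i, m i * v i := fun m => by
    conv_lhs => rw [← Finset.univ_sum_single m, map_sum]
    refine Finset.sum_congr rfl fun i _ => ?_
    rw [show (Pi.single i (m i) : Fin 5 → ℤ) = m i • Pi.single i 1 by
      rw [← Pi.single_smul]; simp, map_smul, smul_eq_mul]
  have hs : 0 < ∑ i, v i := by simpa [hφv] using hφ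
  -- Points satisfying the relations in `L` have large sums of fractional parts.
  have hdense : ∀ x : Fin 5 → ℝ, (∀ m ∈ L, ∃ n : ℤ, ∑ i, m i * x i = n) →
      (∀ i, ∀ m : ℤ, x i ≠ m) → 11 / 6 + ε ≤ ∑ i, Int.fract (x i) := by
    intro x hx hxi
    by_contra hlt'
    push Not at hlt'
    have hfr : ∀ i, 0 < Int.fract (x i) := fun i =>
      lt_of_le_of_ne (Int.fract_nonneg _) fun h0 => by
        obtain ⟨m, hm⟩ := Int.fract_eq_zero_iff.1 h0.symm
        exact hxi i m hm.symm
    have hfr1 : ∀ i, 0 < 1 - Int.fract (x i) := fun i => sub_pos.2 (Int.fract_lt_one _)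
    have hioo : ∀ b : ℝ, 0 < b → ∀ᶠ η : ℝ in 𝓝[>] 0, 0 < η ∧ η < b := fun b hb =>
      Ioo_mem_nhdsGT hb
    have hev : ∀ᶠ η : ℝ in 𝓝[>] 0, (0 < η ∧ η < (11 / 6 + ε - ∑ i, Int.fract (x i)) / 5) ∧
        ∀ i, (0 < η ∧ η < Int.fract (x i)) ∧ (0 < η ∧ η < 1 - Int.fract (x i)) :=
      (hioo _ (div_pos (sub_pos.2 hlt') (by norm_num))).and (eventually_all.2 fun i =>
        (hioo _ (hfr i)).and (hioo _ (hfr1 i)))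
    obtain ⟨η, ⟨hη0, hη1⟩, hη2⟩ := hev.exists
    obtain ⟨p, hp⟩ := exists_forall_close 5 hη0
    -- At precision η only the finitely many relations of size at most p matter. For almost all j,
    -- those of them that hold for a_j belong to L.
    have hfin : ∀ᶠ j in (U : Filter ℕ), ∀ m ∈ Fintype.piFinset fun _ : Fin 5 =>
        Finset.Icc (-(p : ℤ)) p, (r j : ℤ) ∣ ∑ i, m i * a j i → m ∈ L := by
      refine (eventually_all_finset _).2 fun m _ => ?_
      by_cases hm : m ∈ L
      · exact Eventually.of_forall fun _ _ => hm
      · have h1 := Ultrafilter.eventually_not.2 hm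
        filter_upwards [h1] with j hj hj'
        exact absurd hj' hj
    obtain ⟨j, hj⟩ := hfin.exists
    obtain ⟨k, hk⟩ := hp (r j) (a j) x (hr j) fun m hm hd => hx m (hj m (by
      rw [Fintype.mem_piFinset]
      exact fun i => Finset.mem_Icc.2 (abs_le.1 (hm i))) hd)
    choose n hn using hk
    have hrj : (r j : ℝ) ≠ 0 := by exact_mod_cast (hr j).ne'
    have hcl := fun i => fract_eq_of_close (hn i) (hη2 i).1.2 (hη2 i).2.2
    have h1 := hbig j k fun i hd => by
      obtain ⟨q, hq⟩ := hd
      refine (hcl i).1 q ?_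
      rw [div_eq_iff hrj, mul_comm (q : ℝ)]
      exact_mod_cast hq
    have h2 : ∑ i, Int.fract (((k : ℤ) : ℝ) * a j i / r j) <
        ∑ i, (Int.fract (x i) + η) :=
      Finset.sum_lt_sum_of_nonempty Finset.univ_nonempty fun i _ => by
        simpa using (hcl i).2
    rw [Finset.sum_add_distrib] at h2
    simp only [Finset.sum_const, Finset.card_univ, Fintype.card_fin, nsmul_eq_mul] at h2
    rw [lt_div_iff₀ (by norm_num)] at hη1
    push_cast at h1 h2
    linarith
  let K : (Fin 5 → ℚ) → Prop := fun h => ∀ m ∈ L, ∃ n : ℤ, ∑ i, m i * h i = n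
  -- A directed sum is a limit along h + t v' as t decreases to 0. The slack ε turns the bound at
  -- small t into a strict inequality at the limit.
  have hstar : ∀ v' : Fin 5 → ℤ, (∀ m ∈ L, ∑ i, m i * v' i = 0) → ∀ h, K h →
      (∀ i, v' i = 0 → ∀ m : ℤ, h i ≠ m) → 11 / 6 < ∑ i, directedFract (v' i) (h i) := by
    intro v' hv' h hK hval
    have hev : ∀ᶠ t : ℝ in 𝓝[>] 0, t * ∑ i, (v' i : ℝ) < ε := by
      have : Tendsto (fun t : ℝ => t * ∑ i, (v' i : ℝ)) (𝓝 0) (𝓝 (0 * ∑ i, (v' i : ℝ))) := by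
        apply Continuous.tendsto
        fun_prop
      rw [zero_mul] at this
      exact (this.mono_left nhdsWithin_le_nhds).eventually (gt_mem_nhds hε)
    obtain ⟨t, ht1, ht2⟩ := (hev.and
      (eventually_all.2 fun i => eventually_fract_add_mul (hval i))).exists
    have h1 := hdense (fun i => (h i : ℝ) + t * v' i) (fun m hm => by
      obtain ⟨n, hn⟩ := hK m hm
      refine ⟨n, ?_⟩
      have h2 : ∑ i, (m i : ℝ) * h i = n := by exact_mod_cast hn
      have h3 : ∑ i, (m i : ℝ) * v' i = 0 := by exact_mod_cast hv' m hm
      rw [← h2, ← add_zero (∑ i, (m i : ℝ) * h i), ← mul_zero t, ← h3, Finset.mul_sum,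
        ← Finset.sum_add_distrib]
      exact Finset.sum_congr rfl fun i _ => by ring) fun i => (ht2 i).1
    rw [Finset.sum_congr rfl fun i _ => (ht2 i).2, Finset.sum_add_distrib, ← Finset.mul_sum] at h1
    have h2 : (11 / 6 : ℝ) < ∑ i, (directedFract (v' i) (h i) : ℝ) := by linarith
    have h3 : ((11 / 6 : ℚ) : ℝ) < ((∑ i, directedFract (v' i) (h i) : ℚ) : ℝ) := by
      push_cast; exact h2
    exact_mod_cast h3
  have hsums : HasLargeSums v K :=
    { add_smul := fun h hK q m hm => by
        obtain ⟨n, hn⟩ := hK m hm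
        refine ⟨n, ?_⟩
        have h1 : ∑ i, (m i : ℚ) * v i = 0 := by
          have := hφL m hm
          rw [hφv] at this
          exact_mod_cast this
        rw [← hn, ← add_zero (∑ i, (m i : ℚ) * h i), ← mul_zero q, ← h1, Finset.mul_sum,
          ← Finset.sum_add_distrib]
        exact Finset.sum_congr rfl fun i _ => by ring
      zsmul := fun h hK u m hm => by
        obtain ⟨n, hn⟩ := hK m hm
        refine ⟨u * n, ?_⟩
        push_cast
        rw [← hn, Finset.mul_sum]
        exact Finset.sum_congr rfl fun i _ => by ring
      lt_sum := hstar v fun m hm => by rw [← hφv]; exact hφL m hm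
      lt_sum_neg := fun h hK hval => hstar (fun i => -v i) (fun m hm => by
        have := hφL m hm
        rw [hφv] at this
        simpa using this) h hK fun i hi => hval i (by simpa using hi) }
  -- For this j all relations in L hold for a_j, so the offending multiple of a_j / r_j belongs to
  -- K.
  obtain ⟨j, hj⟩ := hL.exists
  obtain ⟨k, hk, hk2⟩ := hsmall j
  have hrj : (r j : ℚ) ≠ 0 := by exact_mod_cast (hr j).ne'
  have h_int : ∀ i, ∀ m : ℤ, (k * a j i : ℚ) / r j ≠ m := fun i m hm => by
    refine hk i ⟨m, ?_⟩
    rw [div_eq_iff hrj, mul_comm (m : ℚ)] at hm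
    exact_mod_cast hm
  have hfinal := hsums.two_le_sum (h := fun i => (k * a j i : ℚ) / r j) (fun m hm => by
    obtain ⟨n, hn⟩ := hj m hm
    refine ⟨k * n, ?_⟩
    have hn' : ∑ i, (m i : ℚ) * a j i = r j * n := by exact_mod_cast hn
    have h1 : ∑ i, (m i : ℚ) * ((k * a j i : ℚ) / r j) =
        k / r j * ∑ i, (m i : ℚ) * a j i := by
      rw [Finset.mul_sum]
      exact Finset.sum_congr rfl fun i _ => by ring
    rw [h1, hn']
    push_cast
    field_simp) (fun i _ => h_int i) hs
  rw [Finset.sum_congr rfl fun i _ => directedFract_of_notInt (h_int i) (v i)] at hfinal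
  linarith

end CyclicQuotient

end

/-! ### From the minimal log discrepancy to fractional parts -/

theorem mainTheorem4 (ε : ℝ) (hε : ε ∈ Set.Ioo (0 : ℝ) (1 / 6)) :
    ∃ Γ₀ : Finset ℕ, (∀ n ∈ Γ₀, 0 < n) ∧
      ∀ (r : ℕ) (a : Fin 5 → ℤ), 0 < r →
        Int.gcd (a 0) r = 1 → Int.gcd (a 1) r = 1 → Int.gcd (a 2) r = 1 →
        Int.gcd (a 3) r = Int.gcd (a 4) r →
        Int.gcd (∑ i, a i) r = 1 →
        CyclicQuotient.cyclicMld r a ∈ Set.Ico (((11 / 6 + ε : ℝ)) : EReal) (2 : EReal) →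
        (a 0 + a 1 + a 4 ≡ 0 [ZMOD r] ∨
          2 * a 3 + a 4 ≡ 0 [ZMOD r] ∨
          (2 * a 0 + a 4 ≡ 0 [ZMOD r] ∧ Int.gcd (a 3) r ≤ 2)) →
        r ∈ Γ₀ := by
  obtain ⟨N, hN⟩ := CyclicQuotient.exists_bound hε.1
  refine ⟨Finset.Icc 1 N, fun n hn => (Finset.mem_Icc.1 hn).1, ?_⟩
  intro r a hr h0 h1 h2 h34 hσ hmld _
  refine Finset.mem_Icc.2 ⟨hr, hN r a hr (Int.isCoprime_iff_gcd_eq_one.2 hσ).symm ?_ ?_⟩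
  · intro k hk
    have h := hmld.1.trans (CyclicQuotient.cyclicMld_le hr.ne' (by decide : (1 : Fin 5) ≠ 0)
      (Int.isCoprime_iff_gcd_eq_one.2 h0).symm (Int.isCoprime_iff_gcd_eq_one.2 h1).symm k hk)
    have h' := EReal.coe_le_coe_iff.1 h
    push_cast at h'
    exact h'
  · obtain ⟨v, k, hv0, hv, hsum⟩ := CyclicQuotient.exists_of_cyclicMld_lt (b := 2) hr.ne'
      (by decide : (1 : Fin 5) ≠ 0) (Int.isCoprime_iff_gcd_eq_one.2 h0).symm
      (Int.isCoprime_iff_gcd_eq_one.2 h1).symm hmld.2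
    have hsum' : ∑ i, v i < 2 := by exact_mod_cast hsum
    have hrQ : (r : ℚ) ≠ 0 := by exact_mod_cast hr.ne'
    have hone : ∀ i, (r : ℤ) ∣ k * a i → 1 ≤ v i := by
      rintro i ⟨l, hl⟩
      obtain ⟨n, hn⟩ := hv i
      have hl' : (k * a i : ℚ) = r * l := by exact_mod_cast hl
      have h3 : v i = (l + n : ℤ) := by rw [hn, hl']; push_cast; field_simp
      have h4 := hv0 i
      rw [h3] at h4 ⊢
      have h5 : 0 < l + n := by exact_mod_cast h4
      exact_mod_cast h5
    -- Each integral coordinate of a positive vector contributes at least 1, so a sum less than 2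
    -- allows at most one of them.
    have hpair : ∀ i j : Fin 5, i ≠ j → (r : ℤ) ∣ k * a i → ¬ (r : ℤ) ∣ k * a j := by
      intro i j hij hi hj
      have h3 : v i + v j ≤ ∑ i, v i := by
        rw [← Finset.sum_pair hij]
        exact Finset.sum_le_sum_of_subset_of_nonneg (Finset.subset_univ _)
          fun i _ _ => (hv0 i).le
      linarith [hone i hi, hone j hj]
    have hunit : ∀ i : Fin 5, Int.gcd (a i) r = 1 → ¬ (r : ℤ) ∣ k * a i := by
      intro i hi hd
      have hk : (r : ℤ) ∣ k :=
        (Int.isCoprime_iff_gcd_eq_one.2 hi).symm.dvd_of_dvd_mul_right hd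
      exact hpair 0 1 (by decide) (hk.mul_right _) (hk.mul_right _)
    -- Integrality of k a_i / r depends only on gcd(a_i, r). So the last two coordinates are
    -- integral together, which `hpair` forbids.
    have hgcd : ∀ i : Fin 5, (r : ℤ) ∣ k * a i ↔ (r : ℤ) ∣ k * Int.gcd (a i) r := by
      intro i
      constructor
      · intro h
        rw [Int.gcd_eq_gcd_ab, mul_add, ← mul_assoc, ← mul_assoc]
        exact dvd_add (h.mul_right _) ((dvd_mul_left _ _).mul_right _)
      · exact fun h => h.trans (mul_dvd_mul_left _ (Int.gcd_dvd_left _ _))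
    have h3 : ¬ (r : ℤ) ∣ k * a 3 := fun h =>
      hpair 3 4 (by decide) h ((hgcd 4).2 (h34 ▸ (hgcd 3).1 h))
    have h4 : ¬ (r : ℤ) ∣ k * a 4 := fun h => h3 ((hgcd 3).2 (h34 ▸ (hgcd 4).1 h))
    refine ⟨k, fun i => ?_, lt_of_le_of_lt (Finset.sum_le_sum fun i _ => ?_) hsum'⟩
    · fin_cases i
      exacts [hunit 0 h0, hunit 1 h1, hunit 2 h2, h3, h4]
    · obtain ⟨n, hn⟩ := hv i
      have h5 : Int.fract ((k * a i : ℚ) / r) = Int.fract (v i) := by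
        rw [hn, Int.fract_add_intCast]
      rw [h5]
      have h6 : (0 : ℚ) ≤ ⌊v i⌋ := by exact_mod_cast Int.floor_nonneg.2 (hv0 i).le
      rw [Int.fract]
      linarith
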